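/- Boolean circuits here have unrestricted fan-out and gates computing arbitrary Boolean functions of fan-in at most two. For a circuit $C$ on inputs $x_1,\dots,x_n$ let $\sigma(C)$ be the number of its binary gates, $\eta(C)$ the number of input variables of fan-out at least one (that is, read by some gate), and $\mu(C)=\sigma(C)+\eta(C)$. There is a deterministic algorithm, running in time polynomial in $n$ and the number of gates of $C$, with the following property. Let $A\in\mathbb F_2^{n\times d'}$ have full column rank and let $a\in\mathbb F_2^n$, so that $S=\{Ay+a : y\in\mathbb F_2^{d'}\}$ is an affine space of dimension $d'$, and let $C$ be a circuit on $n$ inputs. On input $(C,A,a)$ the algorithm outputs a matrix $W\in\mathbb F_2^{n\times\delta}$ of full column rank and a vector $w\in\mathbb F_2^n$ such that, for every integer $0\le d<d'$ with $\mu(C)<4(d'-d)$, one has $\{Wz+w : z\in\mathbb F_2^\delta\}\subseteq S$, $\delta\ge d$, and $C$ is constant on $\{Wz+w\}$. (The algorithm is not given $d$; nothing is claimed if there is no such $d$.) -/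

import Mathlib

open scoped Matrix

/-! ### Boolean circuits over the basis of all Boolean functions of fan-in at most two -/

namespace GateElim

/-- A wire readable by the `k`-th gate of a circuit on `n` inputs: one of the `n` input variables,
or one of the `k` gates that precede it in the topological order. -/
abbrev Wire (n k : ℕ) : Type := Fin n ⊕ Fin k

/-- A gate computing an arbitrary Boolean function of fan-in zero, one or two. -/
inductive Gate (n k : ℕ) : Type
  | const (b : ZMod 2)
  | unary (f : ZMod 2 → ZMod 2) (u : Wire n k)
  | binary (f : ZMod 2 → ZMod 2 → ZMod 2) (u v : Wire n k)

/-- The value of a gate, given the values of the inputs and of the preceding gates. -/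
def Gate.eval {n k : ℕ} (x : Fin n → ZMod 2) (y : Fin k → ZMod 2) : Gate n k → ZMod 2
  | .const b => b
  | .unary f u => f (Sum.elim x y u)
  | .binary f u v => f (Sum.elim x y u) (Sum.elim x y v)

/-- The gate has fan-in two. -/
def Gate.IsBinary {n k : ℕ} : Gate n k → Prop
  | .binary _ _ _ => True
  | _ => False

/-- One of the wires that feed the gate is the input variable `i`. -/
def Gate.ReadsInput {n k : ℕ} (i : Fin n) : Gate n k → Prop
  | .const _ => False
  | .unary _ u => u = Sum.inl i
  | .binary _ u v => u = Sum.inl i ∨ v = Sum.inl i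

/-- A circuit on `n` inputs with unrestricted fan-out; its gates are listed in a topological order,
and its output is an input variable or a gate. No normal form is imposed. -/
structure Circuit (n : ℕ) : Type where
  numGates : ℕ
  gate : (k : Fin numGates) → Gate n k
  output : Wire n numGates

/-- The value computed at the `k`-th gate on input `x`. -/
def Circuit.value {n : ℕ} (C : Circuit n) (x : Fin n → ZMod 2) (k : Fin C.numGates) : ZMod 2 :=
  (C.gate k).eval x (fun j : Fin k => C.value x ⟨j, j.isLt.trans k.isLt⟩)
termination_by k.val

/-- The value computed by the circuit on input `x`. -/
def Circuit.eval {n : ℕ} (C : Circuit n) (x : Fin n → ZMod 2) : ZMod 2 :=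
  Sum.elim x (C.value x) C.output

/-- `σ(C)`: the number of binary gates. -/
noncomputable def Circuit.sigma {n : ℕ} (C : Circuit n) : ℕ :=
  {k : Fin C.numGates | (C.gate k).IsBinary}.ncard

/-- `η(C)`: the number of input variables of fan-out at least one. -/
noncomputable def Circuit.eta {n : ℕ} (C : Circuit n) : ℕ :=
  {i : Fin n | ∃ k : Fin C.numGates, (C.gate k).ReadsInput i}.ncard

/-- `μ(C) = σ(C) + η(C)`. -/
noncomputable def Circuit.mu {n : ℕ} (C : Circuit n) : ℕ := C.sigma + C.eta

/-- The affine space `{A y + a}`; its dimension is `A.rank`. -/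
def affineSet {n m : ℕ} (A : Matrix (Fin n) (Fin m) (ZMod 2)) (a : Fin n → ZMod 2) :
    Set (Fin n → ZMod 2) :=
  Set.range fun y : Fin m → ZMod 2 => A *ᵥ y + a

/-! ### A machine model with a step count

Pure first-order LISP: data are binary trees, a program is a finite list of (possibly mutually
recursive) functions of one argument. The only operations are building a pair, taking a pair apart,
testing for the empty tree, naming an intermediate result, and calling a function. Each of them is
one step, and each is a bounded number of pointer operations (there is no unit-cost equality test
and no arithmetic), so polynomial time in this model is, for outputs of polynomial size, polynomial
time on Turing machines. -/

/-- Binary trees, the data of the model. -/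
inductive Data : Type
  | nil
  | cons (l r : Data)

/-- Expressions. Variables are de Bruijn indices into the list of values in scope. -/
inductive Expr : Type
  | var (i : ℕ)
  | nil
  | cons (e₁ e₂ : Expr)
  /-- Evaluate `e₁`, push its value, evaluate `e₂`. -/
  | bind (e₁ e₂ : Expr)
  /-- If `e` is the empty tree then `e₁`; if it is a pair, push its right and then its left
  component (so that the left one has index `0`) and evaluate `e₂`. -/
  | split (e e₁ e₂ : Expr)
  /-- Call the function number `f` on the value of `e`. -/
  | call (f : ℕ) (e : Expr)

/-- A program is the list of the bodies of its functions; function number `0` is the main one. -/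
abbrev Program : Type := List Expr

/-- `Eval P ρ e v t`: in the program `P`, with the values `ρ` in scope, evaluation of `e` terminates
with value `v` after exactly `t` steps. -/
inductive Eval (P : Program) : List Data → Expr → Data → ℕ → Prop
  | var {ρ : List Data} {i : ℕ} {v : Data} (h : ρ[i]? = some v) : Eval P ρ (.var i) v 1
  | nil {ρ : List Data} : Eval P ρ .nil .nil 1
  | cons {ρ : List Data} {e₁ e₂ : Expr} {v₁ v₂ : Data} {t₁ t₂ : ℕ}
      (h₁ : Eval P ρ e₁ v₁ t₁) (h₂ : Eval P ρ e₂ v₂ t₂) :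
      Eval P ρ (.cons e₁ e₂) (.cons v₁ v₂) (t₁ + t₂ + 1)
  | bind {ρ : List Data} {e₁ e₂ : Expr} {v₁ v : Data} {t₁ t₂ : ℕ}
      (h₁ : Eval P ρ e₁ v₁ t₁) (h₂ : Eval P (v₁ :: ρ) e₂ v t₂) :
      Eval P ρ (.bind e₁ e₂) v (t₁ + t₂ + 1)
  | splitNil {ρ : List Data} {e e₁ e₂ : Expr} {v : Data} {t t₁ : ℕ}
      (h : Eval P ρ e .nil t) (h₁ : Eval P ρ e₁ v t₁) :
      Eval P ρ (.split e e₁ e₂) v (t + t₁ + 1)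
  | splitCons {ρ : List Data} {e e₁ e₂ : Expr} {l r v : Data} {t t₂ : ℕ}
      (h : Eval P ρ e (.cons l r) t) (h₂ : Eval P (l :: r :: ρ) e₂ v t₂) :
      Eval P ρ (.split e e₁ e₂) v (t + t₂ + 1)
  | call {ρ : List Data} {f : ℕ} {e body : Expr} {u v : Data} {t s : ℕ}
      (h : Eval P ρ e u t) (hf : P[f]? = some body) (hb : Eval P [u] body v s) :
      Eval P ρ (.call f e) v (t + s + 1)

/-- On input `u` the main function of `P` halts with output `v` after exactly `t` steps. -/
def Program.Runs (P : Program) (u v : Data) (t : ℕ) : Prop :=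
  ∃ body : Expr, P[0]? = some body ∧ Eval P [u] body v t

/-- Evaluation is deterministic. -/
theorem Eval.det {P : Program} {ρ : List Data} {e : Expr} {v w : Data} {t s : ℕ}
    (h : Eval P ρ e v t) (h' : Eval P ρ e w s) : v = w ∧ t = s := by
  induction h generalizing w s with
  | var h => cases h' with | var h2 => simp_all
  | nil => cases h'; simp
  | cons _ _ i1 i2 =>
    cases h' with
    | cons a b => obtain ⟨rfl, rfl⟩ := i1 a; obtain ⟨rfl, rfl⟩ := i2 b; simp
  | bind _ _ i1 i2 =>
    cases h' with
    | bind a b => obtain ⟨rfl, rfl⟩ := i1 a; obtain ⟨rfl, rfl⟩ := i2 b; simp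
  | splitNil _ _ i1 i2 =>
    cases h' with
    | splitNil a b => obtain ⟨_, rfl⟩ := i1 a; obtain ⟨rfl, rfl⟩ := i2 b; simp
    | splitCons a b => exact absurd (i1 a).1 (by simp)
  | splitCons _ _ i1 i2 =>
    cases h' with
    | splitNil a b => exact absurd (i1 a).1 (by simp)
    | splitCons a b =>
      obtain ⟨h1, rfl⟩ := i1 a
      cases h1
      obtain ⟨rfl, rfl⟩ := i2 b; simp
  | call _ hf _ i1 i2 =>
    cases h' with
    | call a hg b =>
      obtain ⟨rfl, rfl⟩ := i1 a
      cases hf.symm.trans hg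
      obtain ⟨rfl, rfl⟩ := i2 b; simp

/-! ### Representation of the inputs and outputs as data -/

/-- The list with the given entries. -/
def encList : List Data → Data
  | [] => .nil
  | v :: l => .cons v (encList l)

/-- A number in unary: indices of variables and gates have size linear in the circuit. -/
def encNat : ℕ → Data
  | 0 => .nil
  | k + 1 => .cons .nil (encNat k)

/-- A bit. -/
def encBit (b : ZMod 2) : Data := if b = 0 then .nil else .cons .nil .nil

/-- A vector, as the list of its coordinates. -/
def encVec {n : ℕ} (v : Fin n → ZMod 2) : Data := encList (List.ofFn fun i => encBit (v i))

/-- A matrix, as the list of its columns. -/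
def encMatrix {n m : ℕ} (A : Matrix (Fin n) (Fin m) (ZMod 2)) : Data :=
  encList (List.ofFn fun j => encVec fun i => A i j)

/-- A description of the affine space `{A y + a}`. -/
def encAffine {n m : ℕ} (A : Matrix (Fin n) (Fin m) (ZMod 2)) (a : Fin n → ZMod 2) : Data :=
  .cons (encMatrix A) (encVec a)

/-- A wire, as a tag and an index. -/
def encWire {n k : ℕ} : Wire n k → Data
  | .inl i => .cons (encNat 0) (encNat i)
  | .inr j => .cons (encNat 1) (encNat j)

/-- A gate, as its fan-in, its truth table and the wires that feed it. -/
def encGate {n k : ℕ} : Gate n k → Data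
  | .const b => encList [encNat 0, encBit b]
  | .unary f u => encList [encNat 1, encBit (f 0), encBit (f 1), encWire u]
  | .binary f u v => encList [encNat 2, encBit (f 0 0), encBit (f 0 1), encBit (f 1 0),
      encBit (f 1 1), encWire u, encWire v]

/-- A circuit, as its output wire and the list of its gates in topological order. -/
def encCircuit {n : ℕ} (C : Circuit n) : Data :=
  .cons (encWire C.output) (encList (List.ofFn fun k => encGate (C.gate k)))

/-- The input `(C, A, a)` of the algorithm. -/
def encInput {n m : ℕ} (C : Circuit n) (A : Matrix (Fin n) (Fin m) (ZMod 2))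
    (a : Fin n → ZMod 2) : Data :=
  .cons (encCircuit C) (encAffine A a)

end GateElim

/-! The circuit is run symbolically on an affine space given by affine forms in `d` variables. A
gate with operand forms p, q computes c₀ + c₁p + c₂q + c₃pq over 𝔽₂. The product is affine for an
obvious reason if p, q or p + q is constant; otherwise it is replaced by a new variable that belongs
to this gate alone. Forms are compared modulo constants, as classes (`cls`). A gate is fresh
(`Fresh`) if its class is nonzero and differs from the classes of all earlier wires. The potential N
is the number of classes of fresh gates and of their operands (`classes`). Only binary gates can be
fresh, and every operand class traces back to a binary gate or to an input that is read, so N ≤ μ(C)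
at the start (`Circuit.ncard_classes_le`).

The core is `IsRun.exists_good_wire`: while the output form is not constant, some equation v = c,
with v the form of a wire in the space variables, makes the output constant or lowers N by four. If
the output is linear in the space variables, fix it. Otherwise take the first live gate A whose form
is not linear: its operands are linear and c₃ = 1, so fixing either operand to a suitable value
makes A constant. If A gives the output, this is enough. Otherwise a live gate B reads A. The fixed
class p and the class of A become constant, and B becomes constant or is merged with its other
operand: three classes are lost. For the fourth, let q be the class of the second operand of A. If q
is also produced by a fresh gate or read by another one, fix q itself: the producer has its two
operands merged, or the other reader collapses (`IsRun.drop_of_shared`). If not, fix the first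
operand: once A is constant, nothing uses q any more (`IsRun.drop_of_not_shared`).

The counting rests on `IsRun.exists_subst`: restricting the inputs changes all forms by one common
substitution, so the new classes are images of old ones. By `ncard_add_four_le` it suffices that
each of the four classes has its image out of use, or shares it with a class of smaller rank.

The algorithm is greedy: it tries every wire with both values and keeps the restriction with the
smallest `key`. Each round costs at most one dimension, so N + 4d < 4·dim is preserved while N drops
by four. In the round that makes the output constant, this strict inequality pays for the dimension
lost. The algorithm never uses d.

For the running time, `Poly` collects the functions computable in polynomial time with results of
polynomial size. It is closed under composition, pairing, case distinction and folds whose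
intermediate states stay polynomially bounded, and the algorithm is written in these terms. -/

namespace GateElim

/-! ### Compiling functions into the tree language with polynomial time bounds. -/

/-! ### Evaluation under extensions of the program and of the context -/

/-- `P'` agrees with `P` on all function numbers of `P` except possibly `0`. -/
def Ext (P P' : Program) : Prop :=
  P.length ≤ P'.length ∧ ∀ i, 0 < i → i < P.length → P'[i]? = P[i]?

theorem Ext.refl (P : Program) : Ext P P := ⟨le_rfl, fun _ _ _ => rfl⟩

theorem Ext.trans {P Q R : Program} (h : Ext P Q) (h' : Ext Q R) : Ext P R :=
  ⟨h.1.trans h'.1, fun i hi hl => (h'.2 i hi (hl.trans_le h.1)).trans (h.2 i hi hl)⟩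

theorem Ext.append (P Q : Program) : Ext P (P ++ Q) :=
  ⟨by simp, fun i _ hl => List.getElem?_append_left hl⟩

theorem Ext.set_zero (P : Program) (e : Expr) : Ext P (P.set 0 e) :=
  ⟨by simp, fun i hi _ => by rw [List.getElem?_set_ne (by omega)]⟩

/-- Indices count from the front of the context and called bodies run in a context of their own, so
values appended at the end are never seen. This lets an expression compiled for a single argument
run inside a larger one. -/
theorem Eval.weaken {P : Program} {ρ : List Data} {e : Expr} {v : Data} {t : ℕ}
    (h : Eval P ρ e v t) (σ : List Data) : Eval P (ρ ++ σ) e v t := by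
  induction h with
  | var h =>
    refine .var ?_
    rw [List.getElem?_append_left]
    · exact h
    · exact (List.getElem?_eq_some_iff.1 h).1
  | nil => exact .nil
  | cons _ _ i1 i2 => exact .cons i1 i2
  | bind _ _ i1 i2 => exact .bind i1 i2
  | splitNil _ _ i1 i2 => exact .splitNil i1 i2
  | splitCons _ _ i1 i2 => exact .splitCons i1 i2
  | call _ hf hb i1 _ => exact .call i1 hf hb

/-! ### Encodings and sizes -/

/-- The number of nodes of a tree. -/
def Data.size : Data → ℕ
  | .nil => 1
  | .cons l r => l.size + r.size + 1

/-- Types whose elements are represented as data. -/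
class Enc (α : Type) where
  enc : α → Data

open Enc (enc)

instance : Enc Data := ⟨id⟩
instance : Enc (ZMod 2) := ⟨encBit⟩
instance : Enc Bool := ⟨fun b => bif b then .cons .nil .nil else .nil⟩
instance : Enc ℕ := ⟨encNat⟩
instance {α β : Type} [Enc α] [Enc β] : Enc (α × β) := ⟨fun x => .cons (enc x.1) (enc x.2)⟩
instance {α : Type} [Enc α] : Enc (List α) := ⟨fun l => encList (l.map enc)⟩

variable {α β γ σ τ : Type} [Enc α] [Enc β] [Enc γ] [Enc σ] [Enc τ]

/-- The size of the representation. -/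
def sz (a : α) : ℕ := (enc a).size

theorem Data.size_pos (d : Data) : 0 < d.size := by cases d <;> simp [Data.size]

theorem sz_pos (a : α) : 0 < sz a := Data.size_pos _

theorem sz_pair (a : α) (b : β) : sz (a, b) = sz a + sz b + 1 := rfl

theorem sz_nil : sz ([] : List α) = 1 := rfl

theorem sz_cons (a : α) (l : List α) : sz (a :: l) = sz a + sz l + 1 := rfl

theorem sz_bit (b : ZMod 2) : sz b ≤ 3 := by
  revert b; decide

theorem sz_bool (b : Bool) : sz b ≤ 3 := by
  revert b; decide

theorem sz_nat (k : ℕ) : sz k = 2 * k + 1 := by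
  induction k with
  | zero => rfl
  | succ k ih =>
    have : sz (k + 1) = 1 + sz k + 1 := rfl
    omega

theorem length_lt_sz (l : List α) : l.length < sz l := by
  induction l with
  | nil => exact sz_pos _
  | cons a l ih => simp only [List.length_cons, sz_cons]; have := sz_pos a; omega

theorem sz_lt_of_mem {a : α} {l : List α} (h : a ∈ l) : sz a < sz l := by
  induction l with
  | nil => simp at h
  | cons b l ih =>
    rw [sz_cons]
    rcases List.mem_cons.1 h with rfl | h
    · have := sz_pos l; omega
    · have := ih h; omega

theorem sz_le_of_forall {l : List α} {B : ℕ} (h : ∀ a ∈ l, sz a ≤ B) :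
    sz l ≤ l.length * (B + 1) + 1 := by
  induction l with
  | nil => simp [sz_nil]
  | cons a l ih =>
    have h1 := ih fun b hb => h b (List.mem_cons_of_mem _ hb)
    have h2 := h a List.mem_cons_self
    rw [sz_cons, List.length_cons, Nat.succ_mul]
    omega

theorem sz_vec (l : List (ZMod 2)) : sz l ≤ 4 * l.length + 1 := by
  have := sz_le_of_forall (l := l) (B := 3) fun a _ => sz_bit a
  omega

/-! ### Polynomial bounds -/

theorem eval_mono (p : Polynomial ℕ) {m n : ℕ} (h : m ≤ n) : p.eval m ≤ p.eval n := by
  rw [Polynomial.eval_eq_sum, Polynomial.eval_eq_sum, Polynomial.sum_def, Polynomial.sum_def]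
  exact Finset.sum_le_sum fun i _ => Nat.mul_le_mul le_rfl (Nat.pow_le_pow_left h i)

/-- `g` is bounded by a polynomial in the size of the argument. -/
def PolyBdd (g : α → ℕ) : Prop := ∃ p : Polynomial ℕ, ∀ a, g a ≤ p.eval (sz a)

namespace PolyBdd

theorem mono {g h : α → ℕ} (hh : PolyBdd h) (H : ∀ a, g a ≤ h a) : PolyBdd g := by
  obtain ⟨p, hp⟩ := hh
  exact ⟨p, fun a => (H a).trans (hp a)⟩

theorem const (k : ℕ) : PolyBdd (fun _ : α => k) := ⟨Polynomial.C k, fun a => by simp⟩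

theorem size : PolyBdd (fun a : α => sz a) := ⟨Polynomial.X, fun a => by simp⟩

theorem add {g h : α → ℕ} (hg : PolyBdd g) (hh : PolyBdd h) : PolyBdd (fun a => g a + h a) := by
  obtain ⟨p, hp⟩ := hg
  obtain ⟨q, hq⟩ := hh
  exact ⟨p + q, fun a => by simpa using Nat.add_le_add (hp a) (hq a)⟩

theorem mul {g h : α → ℕ} (hg : PolyBdd g) (hh : PolyBdd h) : PolyBdd (fun a => g a * h a) := by
  obtain ⟨p, hp⟩ := hg
  obtain ⟨q, hq⟩ := hh
  exact ⟨p * q, fun a => by simpa using Nat.mul_le_mul (hp a) (hq a)⟩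

theorem comp {g : β → ℕ} {f : α → β} (hg : PolyBdd g) (hf : PolyBdd fun a => sz (f a)) :
    PolyBdd (fun a => g (f a)) := by
  obtain ⟨p, hp⟩ := hg
  obtain ⟨q, hq⟩ := hf
  exact ⟨p.comp q, fun a => by
    rw [Polynomial.eval_comp]
    exact (hp _).trans (eval_mono p (hq a))⟩

theorem eval (p : Polynomial ℕ) {g : α → ℕ} (hg : PolyBdd g) :
    PolyBdd (fun a => p.eval (g a)) := by
  obtain ⟨q, hq⟩ := hg
  exact ⟨p.comp q, fun a => by
    rw [Polynomial.eval_comp]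
    exact eval_mono p (hq a)⟩

end PolyBdd

/-! ### Functions computable in polynomial time -/

/-- Every program can be extended so that some expression computes `f` within `T` steps, also in
all further extensions. -/
def ComputesWithin (f : α → β) (T : α → ℕ) : Prop :=
  ∀ P₀ : Program, 0 < P₀.length → ∃ P e, Ext P₀ P ∧ ∀ P', Ext P P' →
    ∀ a, ∃ t, Eval P' [enc a] e (enc (f a)) t ∧ t ≤ T a

/-- `f` is computable in polynomial time, with values of polynomial size. -/
@[fun_prop]
def Poly (f : α → β) : Prop :=
  PolyBdd (fun a => sz (f a)) ∧ ∃ T : α → ℕ, PolyBdd T ∧ ComputesWithin f T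

namespace Poly

theorem of_expr {f : α → β} (hs : PolyBdd fun a => sz (f a)) (e : Expr) (k : ℕ)
    (h : ∀ P a, ∃ t, Eval P [enc a] e (enc (f a)) t ∧ t ≤ k) : Poly f :=
  ⟨hs, fun _ => k, .const k, fun P₀ _ => ⟨P₀, e, .refl _, fun P' _ a => h P' a⟩⟩

/-- A function that does not change the representation. -/
theorem of_enc_eq {f : α → β} (h : ∀ a, enc (f a) = enc a) : Poly f :=
  of_expr (PolyBdd.size.mono fun a => by unfold sz; rw [h]) (.var 0) 1
    fun _ a => ⟨1, .var (by simp [h]), le_rfl⟩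

@[fun_prop]
theorem id : Poly (fun a : α => a) := of_enc_eq fun _ => rfl

theorem exists_literal (d : Data) : ∃ (e : Expr) (k : ℕ), ∀ P ρ, Eval P ρ e d k := by
  induction d with
  | nil => exact ⟨.nil, 1, fun _ _ => .nil⟩
  | cons l r ihl ihr =>
    obtain ⟨e, k, h⟩ := ihl
    obtain ⟨e', k', h'⟩ := ihr
    exact ⟨.cons e e', k + k' + 1, fun P ρ => .cons (h P ρ) (h' P ρ)⟩

@[fun_prop]
theorem const (b : β) : Poly (fun _ : α => b) := by
  obtain ⟨e, k, h⟩ := exists_literal (enc b)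
  exact of_expr (.const (sz b)) e k fun P a => ⟨k, h P _, le_rfl⟩

@[fun_prop]
theorem comp {f : β → γ} {g : α → β} (hf : Poly f) (hg : Poly g) : Poly (fun a => f (g a)) := by
  obtain ⟨sf, Tf, bf, cf⟩ := hf
  obtain ⟨sg, Tg, bg, cg⟩ := hg
  refine ⟨sf.comp sg, fun a => Tg a + Tf (g a) + 1, (bg.add (bf.comp sg)).add (.const 1), ?_⟩
  intro P₀ h₀
  obtain ⟨P₁, e₁, x₁, h₁⟩ := cg P₀ h₀
  obtain ⟨P₂, e₂, x₂, h₂⟩ := cf P₁ (h₀.trans_le x₁.1)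
  refine ⟨P₂, .bind e₁ e₂, x₁.trans x₂, fun P' x a => ?_⟩
  obtain ⟨t₁, r₁, l₁⟩ := h₁ P' (x₂.trans x) a
  obtain ⟨t₂, r₂, l₂⟩ := h₂ P' x (g a)
  exact ⟨t₁ + t₂ + 1, .bind r₁ (r₂.weaken [enc a]), by dsimp only; omega⟩

@[fun_prop]
theorem pair {f : α → β} {g : α → γ} (hf : Poly f) (hg : Poly g) :
    Poly (fun a => (f a, g a)) := by
  obtain ⟨sf, Tf, bf, cf⟩ := hf
  obtain ⟨sg, Tg, bg, cg⟩ := hg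
  refine ⟨(sf.add sg).add (.const 1), fun a => Tf a + Tg a + 1, (bf.add bg).add (.const 1), ?_⟩
  intro P₀ h₀
  obtain ⟨P₁, e₁, x₁, h₁⟩ := cf P₀ h₀
  obtain ⟨P₂, e₂, x₂, h₂⟩ := cg P₁ (h₀.trans_le x₁.1)
  refine ⟨P₂, .cons e₁ e₂, x₁.trans x₂, fun P' x a => ?_⟩
  obtain ⟨t₁, r₁, l₁⟩ := h₁ P' (x₂.trans x) a
  obtain ⟨t₂, r₂, l₂⟩ := h₂ P' x a
  exact ⟨t₁ + t₂ + 1, .cons r₁ r₂, by dsimp only; omega⟩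

theorem fst' : Poly (fun x : α × β => x.1) :=
  of_expr (PolyBdd.size.mono fun x => by rw [← Prod.mk.eta (p := x), sz_pair]; simp; omega)
    (.split (.var 0) .nil (.var 0)) 3
    fun _ x => ⟨3, .splitCons (l := enc x.1) (r := enc x.2) (.var rfl) (.var rfl), le_rfl⟩

theorem snd' : Poly (fun x : α × β => x.2) :=
  of_expr (PolyBdd.size.mono fun x => by rw [← Prod.mk.eta (p := x), sz_pair]; simp; omega)
    (.split (.var 0) .nil (.var 1)) 3
    fun _ x => ⟨3, .splitCons (l := enc x.1) (r := enc x.2) (.var rfl) (.var rfl), le_rfl⟩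

@[fun_prop]
theorem fst {f : α → β × γ} (hf : Poly f) : Poly (fun a => (f a).1) := fst'.comp hf

@[fun_prop]
theorem snd {f : α → β × γ} (hf : Poly f) : Poly (fun a => (f a).2) := snd'.comp hf

@[fun_prop]
theorem cond {c : α → Bool} {f g : α → β} (hc : Poly c) (hf : Poly f) (hg : Poly g) :
    Poly (fun a => bif c a then f a else g a) := by
  obtain ⟨-, Tc, bc, cc⟩ := hc
  obtain ⟨sf, Tf, bf, cf⟩ := hf
  obtain ⟨sg, Tg, bg, cg⟩ := hg
  refine ⟨(sf.add sg).mono fun a => ?_, fun a => Tc a + (Tf a + Tg a + 2) + 1,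
    (bc.add ((bf.add bg).add (.const 2))).add (.const 1), ?_⟩
  · dsimp only
    cases c a
    · exact Nat.le_add_left _ _
    · exact Nat.le_add_right _ _
  intro P₀ h₀
  obtain ⟨P₁, e₁, x₁, h₁⟩ := cc P₀ h₀
  obtain ⟨P₂, e₂, x₂, h₂⟩ := cf P₁ (h₀.trans_le x₁.1)
  obtain ⟨P₃, e₃, x₃, h₃⟩ := cg P₂ ((h₀.trans_le x₁.1).trans_le x₂.1)
  -- In the true branch `split` has pushed two components, so the argument has index 2 and is bound
  -- again at index 0, where `e₂` expects it.
  refine ⟨P₃, .split e₁ e₃ (.bind (.var 2) e₂), (x₁.trans x₂).trans x₃, fun P' x a => ?_⟩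
  obtain ⟨t₁, r₁, l₁⟩ := h₁ P' ((x₂.trans x₃).trans x) a
  obtain ⟨t₂, r₂, l₂⟩ := h₂ P' (x₃.trans x) a
  obtain ⟨t₃, r₃, l₃⟩ := h₃ P' x a
  dsimp only
  cases hca : c a with
  | false =>
    rw [hca] at r₁
    exact ⟨t₁ + t₃ + 1, .splitNil r₁ r₃, by omega⟩
  | true =>
    rw [hca] at r₁
    exact ⟨t₁ + (1 + t₂ + 1) + 1, .splitCons (l := .nil) (r := .nil) r₁
      (.bind (.var rfl) (r₂.weaken [.nil, .nil, enc a])), by omega⟩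

/-- Functions on a two-element type. -/
theorem of_bit (f : ZMod 2 → β) : Poly f := by
  have : f = fun b => bif (b != 0 : Bool) then f 1 else f 0 := by
    funext b
    obtain rfl | rfl : b = 0 ∨ b = 1 := by revert b; decide
    · rfl
    · rfl
  rw [this]
  refine cond (of_enc_eq fun b => ?_) (const _) (const _)
  obtain rfl | rfl : b = 0 ∨ b = 1 := by revert b; decide
  · rfl
  · rfl

theorem of_bool (f : Bool → β) : Poly f := by
  have : f = fun b => bif b then f true else f false := by funext b; cases b <;> rfl
  rw [this]
  exact cond id (const _) (const _)

@[fun_prop]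
theorem bit_add {f g : α → ZMod 2} (hf : Poly f) (hg : Poly g) : Poly (fun a => f a + g a) := by
  have : (fun a => f a + g a) = fun a => bif (f a != 0) then g a + 1 else g a := by
    funext a
    generalize f a = x; generalize g a = y
    revert x y; decide
  rw [this]
  exact cond ((of_bit (· != 0)).comp hf) ((of_bit (· + 1)).comp hg) hg

@[fun_prop]
theorem bit_isZero {f : α → ZMod 2} (hf : Poly f) : Poly (fun a => f a == 0) :=
  (of_bit (· == 0)).comp hf

@[fun_prop]
theorem not {f : α → Bool} (hf : Poly f) : Poly (fun a => !f a) := (of_bool (!·)).comp hf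

@[fun_prop]
theorem or {f g : α → Bool} (hf : Poly f) (hg : Poly g) : Poly (fun a => f a || g a) := by
  have : (fun a => f a || g a) = fun a => bif f a then true else g a := by
    funext a; cases f a <;> rfl
  rw [this]
  exact cond hf (const _) hg

@[fun_prop]
theorem list_cons {f : α → β} {g : α → List β} (hf : Poly f) (hg : Poly g) :
    Poly (fun a => f a :: g a) :=
  (of_enc_eq (f := fun x : β × List β => x.1 :: x.2) fun _ => rfl).comp (pair hf hg)

@[fun_prop]
theorem list_tail {f : α → List β} (hf : Poly f) : Poly (fun a => (f a).tail) := by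
  refine (of_expr (f := fun l : List β => l.tail) (PolyBdd.size.mono fun l => ?_)
    (.split (.var 0) .nil (.var 1)) 3 fun P l => ?_).comp hf
  · cases l with
    | nil => exact le_rfl
    | cons b l => rw [sz_cons]; simp; omega
  · cases l with
    | nil => exact ⟨3, .splitNil (.var rfl) .nil, le_rfl⟩
    | cons b l =>
      exact ⟨3, .splitCons (l := enc b) (r := enc l) (.var rfl) (.var rfl), le_rfl⟩

@[fun_prop]
theorem list_headD {f : α → List β} (d : β) (hf : Poly f) : Poly (fun a => (f a).headD d) := by
  obtain ⟨e, k, h⟩ := exists_literal (enc d)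
  refine (of_expr (f := fun l : List β => l.headD d)
    ((PolyBdd.size.add (.const (sz d))).mono fun l => ?_)
    (.split (.var 0) e (.var 0)) (k + 3) fun P l => ?_).comp hf
  · cases l with
    | nil => simp
    | cons b l => rw [sz_cons]; simp; omega
  · cases l with
    | nil => exact ⟨1 + k + 1, .splitNil (.var rfl) (h _ _), by omega⟩
    | cons b l =>
      exact ⟨3, .splitCons (l := enc b) (r := enc l) (.var rfl) (.var rfl), by omega⟩

@[fun_prop]
theorem list_isEmpty {f : α → List β} (hf : Poly f) : Poly (fun a => (f a).isEmpty) := by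
  refine (of_expr (f := fun l : List β => l.isEmpty) ((PolyBdd.const 3).mono fun l => sz_bool _)
    (.split (.var 0) (.cons .nil .nil) .nil) 5 fun P l => ?_).comp hf
  cases l with
  | nil => exact ⟨5, .splitNil (.var rfl) (.cons .nil .nil), le_rfl⟩
  | cons b l =>
    exact ⟨3, .splitCons (l := enc b) (r := enc l) (.var rfl) .nil, by omega⟩

/-- Iteration along a list, as long as all intermediate results have polynomial size. -/
theorem foldl_of_prefix {L : γ → List α} {s₀ : γ → σ} {step : γ × σ × α → σ}
    (hL : Poly L) (hs : Poly s₀) (hstep : Poly step) {B : γ → ℕ} (hB : PolyBdd B)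
    (H : ∀ c l, l <+: L c → sz (l.foldl (fun s x => step (c, s, x)) (s₀ c)) ≤ B c) :
    Poly (fun c => (L c).foldl (fun s x => step (c, s, x)) (s₀ c)) := by
  obtain ⟨sL, TL, bL, cL⟩ := hL
  obtain ⟨ss, Ts, bs, cs⟩ := hs
  obtain ⟨-, Tp, ⟨p, hp⟩, cp⟩ := hstep
  -- A bound for one round: the step runs on a triple (c, s, x) with s of size at most `B c` and x
  -- an entry of `L c`; 20 covers the fixed instructions of the loop body.
  set M : γ → ℕ := fun c => 20 + p.eval (sz c + (B c + sz (L c) + 1) + 1) with hM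
  have bM : PolyBdd M := (PolyBdd.const 20).add (.eval p
    ((PolyBdd.size.add ((hB.add sL).add (.const 1))).add (.const 1)))
  refine ⟨hB.mono fun c => H c _ List.prefix_rfl,
    fun c => Ts c + TL c + 10 + (sz (L c) + 1) * M c,
    (((bs.add bL).add (.const 10)).add ((sL.add (.const 1)).mul bM)), ?_⟩
  intro P₀ h₀
  obtain ⟨P₁, e₁, x₁, h₁⟩ := cL P₀ h₀
  obtain ⟨P₂, e₂, x₂, h₂⟩ := cs P₁ (h₀.trans_le x₁.1)
  obtain ⟨P₃, e₃, x₃, h₃⟩ := cp P₂ ((h₀.trans_le x₁.1).trans_le x₂.1)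
  set k := P₃.length with hk
  have hk0 : 0 < k := ((h₀.trans_le x₁.1).trans_le x₂.1).trans_le x₃.1
  -- The loop takes (c, (s, l)). After the three splits the context starts with head, tail, s, l, c,
  -- so 4 is c, 2 is s and 1 is the tail; the body then calls itself on (c, (new s, tail)).
  set body : Expr := .split (.var 0) .nil (.split (.var 1) .nil
    (.split (.var 1) (.var 0) (.call k (.cons (.var 4) (.cons
      (.bind (.cons (.var 4) (.cons (.var 2) (.var 0))) e₃) (.var 1)))))) with hbody
  refine ⟨P₃ ++ [body], .call k (.cons (.var 0) (.cons e₂ e₁)),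
    ((x₁.trans x₂).trans x₃).trans (.append _ _), fun P' x c => ?_⟩
  -- The loop calls itself by number; extensions keep every function but number 0, and k > 0.
  have hbk : P'[k]? = some body := by
    rw [x.2 k hk0 (by simp [hk])]
    simp [hk]
  have loop : ∀ (l l₁ : List α), l₁ ++ l = L c → ∃ t,
      Eval P' [.cons (enc c) (.cons (enc (l₁.foldl (fun s x => step (c, s, x)) (s₀ c))) (enc l))]
        body (enc ((L c).foldl (fun s x => step (c, s, x)) (s₀ c))) t ∧
        t ≤ (l.length + 1) * M c := by
    intro l
    induction l with
    | nil =>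
      intro l₁ hl
      rw [List.append_nil] at hl
      subst hl
      refine ⟨_, .splitCons (.var rfl) (.splitCons (.var rfl) (.splitNil (.var rfl) (.var rfl))), ?_⟩
      simp [hM]
      omega
    | cons b l ih =>
      intro l₁ hl
      obtain ⟨t, r, ht⟩ := ih (l₁ ++ [b]) (by simpa using hl)
      rw [List.foldl_append] at r
      obtain ⟨t', r', ht'⟩ := h₃ P' (Ext.trans (.append _ _) x)
        (c, l₁.foldl (fun s x => step (c, s, x)) (s₀ c), b)
      refine ⟨_, .splitCons (.var rfl) (.splitCons (.var rfl) (.splitCons (l := enc b) (r := enc l)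
        (.var rfl) (.call (.cons (.var rfl) (.cons (.bind (.cons (.var rfl) (.cons (.var rfl)
          (.var rfl))) (r'.weaken _)) (.var rfl))) hbk r))), ?_⟩
      have e1 := H c l₁ ⟨_, hl⟩
      have e2 : sz b < sz (L c) := sz_lt_of_mem (by rw [← hl]; simp)
      have e3 := (ht'.trans (hp _)).trans (eval_mono p (n := sz c + (B c + sz (L c) + 1) + 1) (by
        rw [sz_pair, sz_pair]; omega))
      rw [List.length_cons, Nat.succ_mul (l.length + 1)]
      have e4 : M c = 20 + p.eval (sz c + (B c + sz (L c) + 1) + 1) := rfl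
      omega
  obtain ⟨t, r, ht⟩ := loop (L c) [] rfl
  obtain ⟨t₁, r₁, l₁⟩ := h₁ P' ((((x₂.trans x₃).trans (.append _ _))).trans x) c
  obtain ⟨t₂, r₂, l₂⟩ := h₂ P' ((x₃.trans (.append _ _)).trans x) c
  refine ⟨_, .call (.cons (.var rfl) (.cons r₂ r₁)) hbk r, ?_⟩
  have := Nat.mul_le_mul_right (M c) (Nat.succ_le_succ (length_lt_sz (L c)).le)
  show 1 + (t₂ + t₁ + 1) + 1 + t + 1 ≤ Ts c + TL c + 10 + (sz (L c) + 1) * M c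
  have h3 : (List.length (L c) + 1) * M c ≤ (sz (L c) + 1) * M c := this
  omega

/-- Iteration along a list, with an invariant that bounds the size. -/
theorem foldl_of_inv {L : γ → List α} {s₀ : γ → σ} {step : γ × σ × α → σ}
    (hL : Poly L) (hs : Poly s₀) (hstep : Poly step) {B : γ → ℕ} (hB : PolyBdd B)
    (I : γ → ℕ → σ → Prop) (h0 : ∀ c, I c 0 (s₀ c))
    (hI : ∀ c k s x, k < (L c).length → x ∈ L c → I c k s → I c (k + 1) (step (c, s, x)))
    (hIB : ∀ c k s, k ≤ (L c).length → I c k s → sz s ≤ B c) :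
    Poly (fun c => (L c).foldl (fun s x => step (c, s, x)) (s₀ c)) := by
  refine foldl_of_prefix hL hs hstep hB fun c l hl => ?_
  refine hIB c l.length _ hl.length_le ?_
  induction l using List.reverseRecOn with
  | nil => exact h0 c
  | append_singleton l x ih =>
    have hl' : l <+: L c := (List.prefix_append l [x]).trans hl
    rw [List.foldl_append, List.length_append]
    refine hI c _ _ x ?_ (hl.subset (by simp)) (ih hl')
    have := hl.length_le
    simp at this
    omega

/-- Iteration along a list, with steps that add a bounded amount to the size. -/
theorem foldl_of_add {L : γ → List α} {s₀ : γ → σ} {step : γ × σ × α → σ}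
    (hL : Poly L) (hs : Poly s₀) (hstep : Poly step) {B : γ → ℕ} (hB : PolyBdd B)
    (H : ∀ c s x, x ∈ L c → sz (step (c, s, x)) ≤ sz s + B c) :
    Poly (fun c => (L c).foldl (fun s x => step (c, s, x)) (s₀ c)) := by
  refine foldl_of_inv hL hs hstep (B := fun c => sz (s₀ c) + sz (L c) * B c)
    (hs.1.add (hL.1.mul hB)) (fun c k s => sz s ≤ sz (s₀ c) + k * B c) (by simp) ?_ ?_
  · intro c k s x _ hx h
    have := H c s x hx
    rw [Nat.succ_mul]
    omega
  · intro c k s hk h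
    exact h.trans (Nat.add_le_add_left (Nat.mul_le_mul_right _
      (hk.trans (length_lt_sz _).le)) _)

end Poly
end GateElim

/-! ### Lists and unary numbers in polynomial time. -/

namespace GateElim
open Enc (enc)
variable {α β γ σ τ : Type} [Enc α] [Enc β] [Enc γ] [Enc σ] [Enc τ]

/-! ### Lists and numbers in polynomial time -/

/-- Combine the entries of two lists, the second one padded with `d` or truncated. -/
def zipPad {α β γ : Type} (g : α → β → γ) (d : β) : List α → List β → List γ
  | [], _ => []
  | a :: l, m => g a (m.headD d) :: zipPad g d l m.tail

/-- The branch of a tree that goes to the right. -/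
def Data.toList : Data → List Data
  | .nil => []
  | .cons l r => l :: r.toList

namespace Poly

@[fun_prop]
theorem list_reverse {f : α → List β} (hf : Poly f) : Poly (fun a => (f a).reverse) := by
  refine comp (f := fun l : List β => l.reverse) ?_ hf
  have : (fun l : List β => l.reverse) = fun l => l.foldl (fun s x => x :: s) [] := by
    funext l
    have : ∀ m, l.foldl (fun s x => x :: s) m = l.reverse ++ m := by
      induction l with
      | nil => simp
      | cons a l ih => simp [ih]
    simp [this]
  rw [this]
  refine foldl_of_add (L := fun l : List β => l) (step := fun z => z.2.2 :: z.2.1)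
    (by fun_prop) (by fun_prop) (by fun_prop) (PolyBdd.size.add (.const 1)) ?_
  intro c s x hx
  have := sz_lt_of_mem hx
  simp only [sz_cons]
  omega

theorem foldr_of_inv {L : γ → List α} {s₀ : γ → σ} {step : γ × σ × α → σ}
    (hL : Poly L) (hs : Poly s₀) (hstep : Poly step) {B : γ → ℕ} (hB : PolyBdd B)
    (I : γ → ℕ → σ → Prop) (h0 : ∀ c, I c 0 (s₀ c))
    (hI : ∀ c k s x, k < (L c).length → x ∈ L c → I c k s → I c (k + 1) (step (c, s, x)))
    (hIB : ∀ c k s, k ≤ (L c).length → I c k s → sz s ≤ B c) :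
    Poly (fun c => (L c).foldr (fun x s => step (c, s, x)) (s₀ c)) := by
  have := foldl_of_inv (list_reverse hL) hs hstep hB I h0
    (fun c k s x hk hx => hI c k s x (by simpa using hk) (by simpa using hx))
    (fun c k s hk => hIB c k s (by simpa using hk))
  simpa only [List.foldl_reverse] using this

theorem foldr_of_add {L : γ → List α} {s₀ : γ → σ} {step : γ × σ × α → σ}
    (hL : Poly L) (hs : Poly s₀) (hstep : Poly step) {B : γ → ℕ} (hB : PolyBdd B)
    (H : ∀ c s x, x ∈ L c → sz (step (c, s, x)) ≤ sz s + B c) :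
    Poly (fun c => (L c).foldr (fun x s => step (c, s, x)) (s₀ c)) := by
  have := foldl_of_add (list_reverse hL) hs hstep hB
    (fun c s x hx => H c s x (by simpa using hx))
  simpa only [List.foldl_reverse] using this

theorem list_map {L : γ → List α} {f : γ → α → β} (hL : Poly L)
    (hf : Poly fun z : γ × α => f z.1 z.2) : Poly (fun c => (L c).map (f c)) := by
  have : (fun c => (L c).map (f c)) = fun c => (L c).foldr (fun x s => f c x :: s) [] := by
    funext c
    induction L c with
    | nil => rfl
    | cons a l ih => rw [List.map_cons, List.foldr_cons, ih]
  rw [this]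
  obtain ⟨p, hp⟩ := hf.1
  refine foldr_of_add (step := fun z : γ × List β × α => f z.1 z.2.2 :: z.2.1) hL (const _)
    (list_cons (comp hf (g := fun z : γ × List β × α => (z.1, z.2.2)) (by fun_prop))
      (by fun_prop))
    (B := fun c => p.eval (sz c + sz (L c) + 1) + 1)
    ((PolyBdd.eval p ((PolyBdd.size.add hL.1).add (.const 1))).add (.const 1)) ?_
  intro c s x hx
  have h1 := sz_lt_of_mem hx
  have h2 := (hp (c, x)).trans (eval_mono p (n := sz c + sz (L c) + 1)
    (by rw [sz_pair]; omega))
  simp only [sz_cons] at *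
  omega

@[fun_prop]
theorem list_append {f g : α → List β} (hf : Poly f) (hg : Poly g) :
    Poly (fun a => f a ++ g a) := by
  have : (fun a => f a ++ g a) = fun a => (f a).foldr (fun x s => x :: s) (g a) := by
    funext a; simp
  rw [this]
  refine foldr_of_add (step := fun z : α × List β × β => z.2.2 :: z.2.1) hf hg (by fun_prop)
    (B := fun a => sz (f a) + 1) (hf.1.add (.const 1)) ?_
  intro c s x hx
  have := sz_lt_of_mem hx
  simp only [sz_cons]
  omega

theorem list_filter {L : γ → List α} {f : γ → α → Bool} (hL : Poly L)
    (hf : Poly fun z : γ × α => f z.1 z.2) : Poly (fun c => (L c).filter (f c)) := by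
  have : (fun c => (L c).filter (f c)) =
      fun c => (L c).foldr (fun x s => bif f c x then x :: s else s) [] := by
    funext c
    induction L c with
    | nil => rfl
    | cons a l ih => rw [List.filter_cons, List.foldr_cons, ih]; cases f c a <;> simp
  rw [this]
  refine foldr_of_add (step := fun z : γ × List α × α => bif f z.1 z.2.2 then z.2.2 :: z.2.1
    else z.2.1) hL (const _) (cond (comp hf (g := fun z : γ × List α × α => (z.1, z.2.2))
      (by fun_prop)) (by fun_prop) (by fun_prop))
    (B := fun a => sz (L a) + 1) (hL.1.add (.const 1)) ?_
  intro c s x hx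
  have := sz_lt_of_mem hx
  dsimp only
  cases f c x
  · simp only [cond_false]; omega
  · simp only [cond_true, sz_cons]; omega

theorem list_any {L : γ → List α} {f : γ → α → Bool} (hL : Poly L)
    (hf : Poly fun z : γ × α => f z.1 z.2) : Poly (fun c => (L c).any (f c)) := by
  have : (fun c => (L c).any (f c)) = fun c => (L c).foldr (fun x s => f c x || s) false := by
    funext c
    induction L c with
    | nil => rfl
    | cons a l ih => rw [List.any_cons, List.foldr_cons, ih]
  rw [this]
  exact foldr_of_add (step := fun z : γ × Bool × α => f z.1 z.2.2 || z.2.1) hL (const _)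
    (or (comp hf (g := fun z : γ × Bool × α => (z.1, z.2.2)) (by fun_prop)) (by fun_prop))
    (PolyBdd.const 3) fun c s x _ => (sz_bool _).trans (Nat.le_add_left _ _)

/-- A unary number and a list of empty trees have the same representation, so loops over numbers
become folds over lists at no cost. -/
theorem nat_unary : Poly (fun k : ℕ => List.replicate k Data.nil) := by
  refine of_enc_eq fun k => ?_
  induction k with
  | zero => rfl
  | succ k ih => rw [List.replicate_succ]; exact congrArg (Data.cons .nil) ih

@[fun_prop]
theorem nat_succ {f : α → ℕ} (hf : Poly f) : Poly (fun a => f a + 1) :=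
  comp (f := fun k : ℕ => k + 1) (of_expr
    ((PolyBdd.size.add (.const 2)).mono fun k => by simp only [sz_nat]; omega)
    (.cons .nil (.var 0)) 3 fun P k => ⟨3, .cons .nil (.var rfl), le_rfl⟩) hf

@[fun_prop]
theorem nat_add {f g : α → ℕ} (hf : Poly f) (hg : Poly g) : Poly (fun a => f a + g a) := by
  have : (fun a => f a + g a) =
      fun a => (List.replicate (f a) Data.nil).foldl (fun s _ => s + 1) (g a) := by
    funext a
    generalize g a = k
    induction f a generalizing k with
    | zero => simp
    | succ n ih => rw [List.replicate_succ, List.foldl_cons, ← ih]; omega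
  rw [this]
  refine foldl_of_add (step := fun z : α × ℕ × Data => z.2.1 + 1) (nat_unary.comp hf) hg
    (by fun_prop) (PolyBdd.const 2) fun c s x _ => ?_
  simp only [sz_nat]
  omega

@[fun_prop]
theorem list_length {f : α → List β} (hf : Poly f) : Poly (fun a => (f a).length) := by
  have : (fun a => (f a).length) = fun a => (f a).foldr (fun _ s => s + 1) 0 := by
    funext a
    induction f a with
    | nil => rfl
    | cons b l ih => rw [List.length_cons, List.foldr_cons, ih]
  rw [this]
  refine foldr_of_add (step := fun z : α × ℕ × β => z.2.1 + 1) hf (const _)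
    (by fun_prop) (PolyBdd.const 2) fun c s x _ => ?_
  simp only [sz_nat]
  omega

@[fun_prop]
theorem list_drop {f : α → List β} {k : α → ℕ} (hf : Poly f) (hk : Poly k) :
    Poly (fun a => (f a).drop (k a)) := by
  have : (fun a => (f a).drop (k a)) =
      fun a => (List.replicate (k a) Data.nil).foldl (fun s _ => s.tail) (f a) := by
    funext a
    generalize f a = l
    induction k a generalizing l with
    | zero => simp
    | succ n ih => rw [List.replicate_succ, List.foldl_cons, ← ih]; cases l <;> simp
  rw [this]
  refine foldl_of_add (step := fun z : α × List β × Data => z.2.1.tail) (nat_unary.comp hk) hf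
    (by fun_prop) (PolyBdd.const 0) fun c s x _ => ?_
  cases s with
  | nil => exact le_rfl
  | cons b l => simp only [sz_cons, List.tail_cons]; omega

@[fun_prop]
theorem list_getD {f : α → List β} {k : α → ℕ} (d : β) (hf : Poly f) (hk : Poly k) :
    Poly (fun a => (f a).getD (k a) d) := by
  have : (fun a => (f a).getD (k a) d) = fun a => ((f a).drop (k a)).headD d := by
    funext a
    rw [List.headD_eq_head?_getD, List.head?_drop, List.getD_eq_getElem?_getD]
  rw [this]
  fun_prop

@[fun_prop]
theorem nat_lt {f g : α → ℕ} (hf : Poly f) (hg : Poly g) : Poly (fun a => decide (f a < g a)) := by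
  have : (fun a => decide (f a < g a)) =
      fun a => !((List.replicate (g a) Data.nil).drop (f a)).isEmpty := by
    funext a
    rw [Bool.eq_iff_iff]
    simp only [decide_eq_true_eq, Bool.not_eq_true', ← Bool.not_eq_true, List.isEmpty_iff,
      List.drop_eq_nil_iff, List.length_replicate]
    omega
  rw [this]
  have := nat_unary.comp hg
  fun_prop

theorem list_zipPad {F : α → List β} {G : α → List γ} {g : β → γ → σ} (d : γ)
    (hg : Poly fun z : β × γ => g z.1 z.2) (hF : Poly F) (hG : Poly G) :
    Poly (fun a => zipPad g d (F a) (G a)) := by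
  -- The fold state is the unread part of the second list together with the output in reverse order.
  have key : ∀ (l : List β) (m : List γ) (acc : List σ),
      (l.foldl (fun s x => (s.1.tail, g x (s.1.headD d) :: s.2)) (m, acc)).2 =
        (zipPad g d l m).reverse ++ acc := by
    intro l
    induction l with
    | nil => intro m acc; simp [zipPad]
    | cons b l ih => intro m acc; rw [List.foldl_cons, ih]; simp [zipPad]
  have : (fun a => zipPad g d (F a) (G a)) = fun a =>
      ((F a).foldl (fun s x => (s.1.tail, g x (s.1.headD d) :: s.2)) (G a, [])).2.reverse := by
    funext a
    rw [key, List.append_nil, List.reverse_reverse]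
  rw [this]
  refine list_reverse (snd ?_)
  obtain ⟨p, hp⟩ := hg.1
  have hstep : Poly (fun z : α × (List γ × List σ) × β =>
      (z.2.1.1.tail, g z.2.2 (z.2.1.1.headD d) :: z.2.1.2)) :=
    pair (by fun_prop) (list_cons (comp hg
      (g := fun z : α × (List γ × List σ) × β => (z.2.2, z.2.1.1.headD d)) (by fun_prop)) (by fun_prop))
  refine foldl_of_inv (s₀ := fun a => (G a, ([] : List σ))) hF (by fun_prop) hstep
    (B := fun a => sz (G a) + (sz (F a) * (p.eval (sz (F a) + (sz (G a) + sz d) + 1) + 1) + 1) + 1)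
    ((hG.1.add ((hF.1.mul ((PolyBdd.eval p ((hF.1.add (hG.1.add (.const _))).add
      (.const 1))).add (.const 1))).add (.const 1))).add (.const 1))
    (fun a k s => sz s.1 ≤ sz (G a) ∧
      sz s.2 ≤ k * (p.eval (sz (F a) + (sz (G a) + sz d) + 1) + 1) + 1) ?_ ?_ ?_
  · intro c
    simp [sz_nil]
  · rintro c k ⟨m, acc⟩ x _ hx ⟨h1, h2⟩
    dsimp only at h1 h2 ⊢
    have h3 : sz m.tail ≤ sz m := by
      cases m with
      | nil => exact le_rfl
      | cons b l => simp only [sz_cons, List.tail_cons]; omega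
    have h4 : sz (m.headD d) ≤ sz m + sz d := by
      cases m with
      | nil => exact Nat.le_add_left _ _
      | cons b l => simp only [sz_cons, List.headD_cons]; omega
    have h5 := sz_lt_of_mem hx
    have h6 := (hp (x, m.headD d)).trans (eval_mono p
      (n := sz (F c) + (sz (G c) + sz d) + 1) (by rw [sz_pair]; omega))
    refine ⟨by omega, ?_⟩
    rw [sz_cons, Nat.succ_mul]
    dsimp only at h6
    omega
  · rintro c k ⟨m, acc⟩ hk ⟨h1, h2⟩
    dsimp only at h1 h2
    have := Nat.mul_le_mul_right (p.eval (sz (F c) + (sz (G c) + sz d) + 1) + 1)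
      (hk.trans (length_lt_sz _).le)
    rw [sz_pair]
    omega

@[fun_prop]
theorem data_toList {f : α → Data} (hf : Poly f) : Poly (fun a => (f a).toList) := by
  refine comp (f := fun d : Data => d.toList) (of_enc_eq fun d => ?_) hf
  induction d with
  | nil => rfl
  | cons l r _ ih => exact congrArg (Data.cons l) ih

end Poly
end GateElim

/-! ### The greedy algorithm and its running time. -/

namespace GateElim
open Enc (enc)

/-! ### The algorithm -/

/-- Affine forms: the constant term, followed by the coefficients of the variables. Missing
coefficients are zero. -/
abbrev Vec : Type := List (ZMod 2)

/-- The sum of two forms. -/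
def vadd (u v : Vec) : Vec := zipPad (· + ·) 0 u v ++ v.drop u.length

/-- A multiple of a form. -/
def smul (b : ZMod 2) (v : Vec) : Vec := bif b == 0 then [] else v

/-- The form has no variable. -/
def isConst (v : Vec) : Bool := !v.tail.any (fun b => !(b == 0))

/-- The two forms differ by a constant. -/
def equiv (u v : Vec) : Bool := isConst (vadd u v)

/-- The product of the forms `p` and `q` if it is a form for an obvious reason, else `z`. -/
def mulForm (z p q : Vec) : Vec :=
  bif isConst p then smul (p.headD 0) q else
  bif isConst q then smul (q.headD 0) p else
  bif equiv p q then smul ((vadd p q).headD 0 + 1) p else z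

/-- The coefficients of `1`, `x`, `y` and `x y` in a Boolean function of `x` and `y`. -/
abbrev Coeffs : Type := ZMod 2 × ZMod 2 × ZMod 2 × ZMod 2

/-- A gate in normal form, with its two operands as positions in the list of all wires. -/
abbrev NGate : Type := Coeffs × ℕ × ℕ

/-- The form of a gate with operands `p` and `q`; the fresh variable is `z`. -/
def gateForm (z : Vec) (c : Coeffs) (p q : Vec) : Vec :=
  vadd [c.1] (vadd (smul c.2.1 p) (vadd (smul c.2.2.1 q) (smul c.2.2.2 (mulForm z p q))))

/-- Add a form to a list of forms, pairwise distinct up to constants. -/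
def insertClass (x : Vec) (N : List Vec) : List Vec := bif N.any (fun y => equiv x y) then N else x :: N

/-- The forms of the wires, a list of zeros that is longer than all of them, and the list of
classes in use. -/
abbrev RunState : Type := List Vec × Vec × List Vec

/-- Process a gate. -/
def stepGate (s : RunState) (g : NGate) : RunState :=
  (s.1 ++ [gateForm (s.2.1 ++ [1]) g.1 (s.1.getD g.2.1 []) (s.1.getD g.2.2 [])], 0 :: s.2.1,
    bif isConst (gateForm (s.2.1 ++ [1]) g.1 (s.1.getD g.2.1 []) (s.1.getD g.2.2 [])) ||
        s.1.any (fun y => equiv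
          (gateForm (s.2.1 ++ [1]) g.1 (s.1.getD g.2.1 []) (s.1.getD g.2.2 [])) y) then s.2.2
    else insertClass (s.1.getD g.2.1 []) (insertClass (s.1.getD g.2.2 [])
      (insertClass (gateForm (s.2.1 ++ [1]) g.1 (s.1.getD g.2.1 []) (s.1.getD g.2.2 [])) s.2.2)))

/-- A circuit in normal form, its output, and the zero form of the input length. -/
abbrev Net : Type := List NGate × ℕ × Vec

/-- Process all gates. -/
def runGates (c : Net) (rows : List Vec) : RunState :=
  c.1.foldl stepGate (rows, c.2.2, [])

/-- Zero if the output is constant, else one more than the number of classes in use. -/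
def key (c : Net) (rows : List Vec) : ℕ :=
  bif isConst ((runGates c rows).1.getD c.2.1 []) then 0 else (runGates c rows).2.2.length + 1

/-- The position of the first variable of a form. -/
def pivot (v : Vec) : ℕ := v.tail.foldr (fun b k => bif b == 0 then k + 1 else 0) 0

/-- Substitute for the first variable of `v` so that the restriction of `v` becomes `c`. -/
def restrictRow (v : Vec) (c : ZMod 2) (row : Vec) : Vec :=
  bif row.tail.getD (pivot v) 0 == 0 then row else zipPad (· + ·) 0 row (vadd v [c])

/-- Restrict an affine space by the equation `v = c`. -/
def restrict (v : Vec) (c : ZMod 2) (rows : List Vec) : List Vec :=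
  bif isConst v then rows else rows.map (restrictRow v c)

/-- The better one of two affine spaces. -/
def better (c : Net) (r r' : List Vec) : List Vec := bif decide (key c r' < key c r) then r' else r

/-- The best restriction to a hyperplane given by a wire. -/
def best (c : Net) (rows : List Vec) : List Vec :=
  (runGates c rows).1.foldl
    (fun r v => better c (better c r (restrict v 0 rows)) (restrict v 1 rows)) rows

/-- Iterate as often as the given list is long. -/
def solve (c : Net) (rows : List Vec) (l : List Vec) : List Vec :=
  l.foldl (fun r _ => best c r) rows

/-- The transpose of a list of vectors, on top of `base`. -/
def transp (base : List Vec) (l : List Vec) : List Vec :=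
  l.foldr (fun v acc => zipPad (fun b w => b :: w) [] v acc) base

/-- A bit from its representation. -/
def toBit (d : Data) : ZMod 2 := bif d.toList.isEmpty then 0 else 1

/-- The position of a wire in the list of all wires. -/
def wireIdx (n : ℕ) (d : Data) : ℕ :=
  bif (d.toList.headD .nil).toList.isEmpty then d.toList.tail.length else n + d.toList.tail.length

/-- The normal form of a gate. -/
def normalGate (n : ℕ) (g : List Data) : NGate :=
  bif (g.headD .nil).toList.isEmpty then ((toBit (g.getD 1 .nil), 0, 0, 0), 0, 0) else
  bif (g.headD .nil).toList.tail.isEmpty then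
    ((toBit (g.getD 1 .nil), toBit (g.getD 1 .nil) + toBit (g.getD 2 .nil), 0, 0),
      wireIdx n (g.getD 3 .nil), wireIdx n (g.getD 3 .nil))
  else
    ((toBit (g.getD 1 .nil), toBit (g.getD 1 .nil) + toBit (g.getD 3 .nil),
        toBit (g.getD 1 .nil) + toBit (g.getD 2 .nil),
        toBit (g.getD 1 .nil) + toBit (g.getD 2 .nil) + toBit (g.getD 3 .nil) +
          toBit (g.getD 4 .nil)),
      wireIdx n (g.getD 5 .nil), wireIdx n (g.getD 6 .nil))

/-- The shape of the input. -/
abbrev Input : Type := (Data × List (List Data)) × (List Vec × Vec)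

/-- The circuit of the input in normal form. -/
def inputNet (x : Input) : Net :=
  (x.1.2.map (normalGate x.2.2.length), wireIdx x.2.2.length x.1.1, 0 :: x.2.1.map fun _ => 0)

/-- The affine forms of the input variables. -/
def inputRows (x : Input) : List Vec := transp (x.2.2.map fun _ => []) (x.2.2 :: x.2.1)

/-- The columns of a list of `k` rows. -/
def columns (k : Vec) (rows : List Vec) : List Vec := transp (k.map fun _ => []) rows

/-- The matrix without its zero columns, and the translation vector. -/
def toAffine (cols : List Vec) : List Vec × Vec :=
  (cols.tail.filter (fun v => v.any (fun b => !(b == 0))), cols.headD [])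

/-- The main function. -/
def algorithm (x : Input) : List Vec × Vec :=
  toAffine (columns (0 :: x.2.1.map fun _ => 0)
    (solve (inputNet x) (inputRows x) (x.2.2 :: x.2.1)))

/-! ### The algorithm runs in polynomial time -/

theorem length_zipPad {α β γ : Type} (g : α → β → γ) (d : β) (l : List α) (m : List β) :
    (zipPad g d l m).length = l.length := by
  induction l generalizing m with
  | nil => rfl
  | cons a l ih => simp [zipPad, ih]

theorem length_vadd (u v : Vec) : (vadd u v).length = max u.length v.length := by
  simp [vadd, length_zipPad]
  omega

theorem length_smul (b : ZMod 2) (v : Vec) : (smul b v).length ≤ v.length := by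
  unfold smul
  cases b == 0 <;> simp

theorem length_mulForm (z p q : Vec) {L : ℕ} (hz : z.length ≤ L) (hp : p.length ≤ L)
    (hq : q.length ≤ L) : (mulForm z p q).length ≤ L := by
  unfold mulForm
  cases isConst p <;> cases isConst q <;> cases equiv p q <;>
    simp only [cond_true, cond_false] <;>
    first | exact hz | exact (length_smul _ _).trans hp | exact (length_smul _ _).trans hq

theorem length_gateForm (z : Vec) (c : Coeffs) (p q : Vec) {L : ℕ} (hL : 0 < L)
    (hz : z.length ≤ L) (hp : p.length ≤ L) (hq : q.length ≤ L) :
    (gateForm z c p q).length ≤ L := by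
  simp only [gateForm, length_vadd, List.length_singleton, sup_le_iff]
  exact ⟨hL, (length_smul _ _).trans hp, (length_smul _ _).trans hq,
    (length_smul _ _).trans (length_mulForm z p q hz hp hq)⟩

theorem mem_insertClass {x y : Vec} {N : List Vec} (h : y ∈ insertClass x N) : y = x ∨ y ∈ N := by
  unfold insertClass at h
  cases hN : N.any (fun y => equiv x y) <;> simp [hN] at h <;> tauto

theorem length_insertClass (x : Vec) (N : List Vec) :
    (insertClass x N).length ≤ N.length + 1 := by
  unfold insertClass
  cases N.any (fun y => equiv x y) <;> simp

theorem length_getD_le {l : List Vec} {L : ℕ} (h : ∀ v ∈ l, v.length ≤ L) (i : ℕ) :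
    (l.getD i []).length ≤ L := by
  rw [List.getD_eq_getElem?_getD]
  cases hi : l[i]? with
  | none => simp
  | some v => exact h v (List.mem_of_getElem? hi)

theorem sz_vecs_le {l : List Vec} {L : ℕ} (h : ∀ v ∈ l, v.length ≤ L) :
    sz l ≤ l.length * (4 * L + 2) + 1 :=
  sz_le_of_forall (B := 4 * L + 1) fun v hv => (sz_vec v).trans (by have := h v hv; omega)

variable {α β γ σ τ : Type} [Enc α] [Enc β] [Enc γ] [Enc σ] [Enc τ]

namespace Poly

@[fun_prop]
theorem vadd {f g : α → Vec} (hf : Poly f) (hg : Poly g) : Poly (fun a => vadd (f a) (g a)) := by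
  unfold GateElim.vadd
  exact list_append (list_zipPad 0 (by fun_prop) hf hg) (by fun_prop)

@[fun_prop]
theorem smul {f : α → ZMod 2} {g : α → Vec} (hf : Poly f) (hg : Poly g) :
    Poly (fun a => smul (f a) (g a)) := by
  unfold GateElim.smul
  fun_prop

@[fun_prop]
theorem isConst {f : α → Vec} (hf : Poly f) : Poly (fun a => isConst (f a)) := by
  unfold GateElim.isConst
  exact not (list_any (by fun_prop) (by fun_prop))

@[fun_prop]
theorem equiv {f g : α → Vec} (hf : Poly f) (hg : Poly g) : Poly (fun a => equiv (f a) (g a)) := by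
  unfold GateElim.equiv
  fun_prop

@[fun_prop]
theorem mulForm {f g h : α → Vec} (hf : Poly f) (hg : Poly g) (hh : Poly h) :
    Poly (fun a => mulForm (f a) (g a) (h a)) := by
  unfold GateElim.mulForm
  fun_prop

@[fun_prop]
theorem gateForm {f g h : α → Vec} {c : α → Coeffs} (hf : Poly f) (hc : Poly c) (hg : Poly g)
    (hh : Poly h) : Poly (fun a => gateForm (f a) (c a) (g a) (h a)) := by
  unfold GateElim.gateForm
  fun_prop

@[fun_prop]
theorem insertClass {f : α → Vec} {g : α → List Vec} (hf : Poly f) (hg : Poly g) :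
    Poly (fun a => insertClass (f a) (g a)) := by
  unfold GateElim.insertClass
  exact cond (list_any hg (f := fun a y => GateElim.equiv (f a) y) (by fun_prop)) hg
    (by fun_prop)

@[fun_prop]
theorem stepGate {f : α → RunState} {g : α → NGate} (hf : Poly f) (hg : Poly g) :
    Poly (fun a => stepGate (f a) (g a)) := by
  unfold GateElim.stepGate
  have h1 : Poly fun a => GateElim.gateForm ((f a).2.1 ++ [1]) (g a).1
    ((f a).1.getD (g a).2.1 []) ((f a).1.getD (g a).2.2 []) := by fun_prop
  have h2 : Poly fun a => (f a).1.any (fun y => GateElim.equiv (GateElim.gateForm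
      ((f a).2.1 ++ [1]) (g a).1 ((f a).1.getD (g a).2.1 []) ((f a).1.getD (g a).2.2 [])) y) :=
    list_any (by fun_prop) (f := fun a y => GateElim.equiv (GateElim.gateForm
      ((f a).2.1 ++ [1]) (g a).1 ((f a).1.getD (g a).2.1 []) ((f a).1.getD (g a).2.2 [])) y)
      (by fun_prop)
  exact pair (by fun_prop) (pair (by fun_prop) (cond (or (by fun_prop) h2) (by fun_prop)
    (by fun_prop)))

@[fun_prop]
theorem runGates {f : α → Net} {g : α → List Vec} (hf : Poly f) (hg : Poly g) :
    Poly (fun a => runGates (f a) (g a)) := by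
  suffices h : Poly (fun x : Net × List Vec => GateElim.runGates x.1 x.2) from
    h.comp (pair hf hg)
  have hM : PolyBdd (fun x : Net × List Vec => 4 * (sz x.1.2.2 + sz x.2 + sz x.1.1) + 2) := by
    have h1 : Poly fun x : Net × List Vec => x.1.2.2 := by fun_prop
    have h2 : Poly fun x : Net × List Vec => x.2 := by fun_prop
    have h3 : Poly fun x : Net × List Vec => x.1.1 := by fun_prop
    exact ((PolyBdd.const 4).mul ((h1.1.add h2.1).add h3.1)).add (.const 2)
  refine foldl_of_inv (L := fun x : Net × List Vec => x.1.1)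
    (step := fun z : (Net × List Vec) × RunState × NGate => GateElim.stepGate z.2.1 z.2.2)
    (s₀ := fun x : Net × List Vec => (x.2, x.1.2.2, [])) (by fun_prop) (by fun_prop)
    (by fun_prop) (((hM.mul hM).mul (.const 4)).add (hM.add (.const 4)))
    -- After k gates there are k further forms and at most 3k recorded classes. Form lengths do not
    -- compound from gate to gate: they are bounded by the longest row and the position of the
    -- newest variable.
    (fun x k s => s.1.length ≤ sz x.2 + k ∧
      (∀ v ∈ s.1, v.length ≤ sz x.1.2.2 + sz x.2 + sz x.1.1) ∧
      s.2.1.length ≤ sz x.1.2.2 + k ∧ s.2.2.length ≤ 3 * k ∧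
      ∀ v ∈ s.2.2, v.length ≤ sz x.1.2.2 + sz x.2 + sz x.1.1) ?_ ?_ ?_
  · intro x
    refine ⟨(length_lt_sz _).le, fun v hv => ?_, (length_lt_sz _).le, le_rfl, by simp⟩
    have h1 := sz_lt_of_mem hv
    have h2 := length_lt_sz v
    dsimp only at h1
    omega
  · rintro x k ⟨ws, zs, N⟩ g hk _ ⟨h1, h2, h3, h4, h5⟩
    dsimp only at h1 h2 h3 h4 h5 hk ⊢
    have h6 := length_lt_sz x.1.1
    have h7 : (GateElim.gateForm (zs ++ [1]) g.1 (ws.getD g.2.1 []) (ws.getD g.2.2 [])).length ≤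
        sz x.1.2.2 + sz x.2 + sz x.1.1 := by
      refine length_gateForm _ _ _ _ (by omega) ?_ (length_getD_le h2 _) (length_getD_le h2 _)
      have := sz_pos x.2
      simp only [List.length_append, List.length_singleton]
      omega
    unfold GateElim.stepGate
    refine ⟨by simp; omega, ?_, by simp; omega, ?_, ?_⟩
    · intro v hv
      rcases List.mem_append.1 hv with hv | hv
      · exact h2 v hv
      · rw [List.mem_singleton.1 hv]
        exact h7
    · dsimp only
      have e1 := length_insertClass
        (GateElim.gateForm (zs ++ [1]) g.1 (ws.getD g.2.1 []) (ws.getD g.2.2 [])) N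
      have e2 := length_insertClass (ws.getD g.2.2 []) (GateElim.insertClass
        (GateElim.gateForm (zs ++ [1]) g.1 (ws.getD g.2.1 []) (ws.getD g.2.2 [])) N)
      have e3 := length_insertClass (ws.getD g.2.1 []) (GateElim.insertClass (ws.getD g.2.2 [])
        (GateElim.insertClass
        (GateElim.gateForm (zs ++ [1]) g.1 (ws.getD g.2.1 []) (ws.getD g.2.2 [])) N))
      cases (GateElim.isConst
        (GateElim.gateForm (zs ++ [1]) g.1 (ws.getD g.2.1 []) (ws.getD g.2.2 [])) ||
        ws.any fun y => GateElim.equiv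
          (GateElim.gateForm (zs ++ [1]) g.1 (ws.getD g.2.1 []) (ws.getD g.2.2 [])) y)
      · simp only [cond_false]; omega
      · simp only [cond_true]; omega
    · dsimp only
      intro v hv
      generalize (GateElim.isConst
        (GateElim.gateForm (zs ++ [1]) g.1 (ws.getD g.2.1 []) (ws.getD g.2.2 [])) ||
        ws.any fun y => GateElim.equiv
          (GateElim.gateForm (zs ++ [1]) g.1 (ws.getD g.2.1 []) (ws.getD g.2.2 [])) y) = b at hv
      cases b
      · simp only [cond_false] at hv
        rcases mem_insertClass hv with rfl | hv
        · exact length_getD_le h2 _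
        rcases mem_insertClass hv with rfl | hv
        · exact length_getD_le h2 _
        rcases mem_insertClass hv with rfl | hv
        · exact h7
        · exact h5 v hv
      · exact h5 v hv
  · rintro x k ⟨ws, zs, N⟩ hk ⟨h1, h2, h3, h4, h5⟩
    dsimp only at h1 h2 h3 h4 h5 hk ⊢
    have h6 := length_lt_sz x.1.1
    set Λ := sz x.1.2.2 + sz x.2 + sz x.1.1 with hΛ
    have e1 := (sz_vecs_le h2).trans (Nat.add_le_add_right (Nat.mul_le_mul_right (4 * Λ + 2)
      (show ws.length ≤ 4 * Λ + 2 by omega)) 1)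
    have e2 := (sz_vecs_le h5).trans (Nat.add_le_add_right (Nat.mul_le_mul_right (4 * Λ + 2)
      (show N.length ≤ 4 * Λ + 2 by omega)) 1)
    have e3 := sz_vec zs
    rw [sz_pair, sz_pair]
    omega

@[fun_prop]
theorem key {f : α → Net} {g : α → List Vec} (hf : Poly f) (hg : Poly g) :
    Poly (fun a => key (f a) (g a)) := by
  unfold GateElim.key
  fun_prop

@[fun_prop]
theorem pivot {f : α → Vec} (hf : Poly f) : Poly (fun a => pivot (f a)) := by
  unfold GateElim.pivot
  exact foldr_of_add (step := fun z : α × ℕ × ZMod 2 => bif z.2.2 == 0 then z.2.1 + 1 else 0)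
    (by fun_prop) (const _) (by fun_prop) (PolyBdd.const 2) fun c s x _ => by
      dsimp only
      cases x == 0 <;> simp only [cond_true, cond_false, sz_nat] <;> omega

@[fun_prop]
theorem restrictRow {f : α → Vec} {c : α → ZMod 2} {g : α → Vec} (hf : Poly f) (hc : Poly c)
    (hg : Poly g) : Poly (fun a => restrictRow (f a) (c a) (g a)) := by
  unfold GateElim.restrictRow
  exact cond (by fun_prop) hg (list_zipPad 0 (by fun_prop) hg (by fun_prop))

@[fun_prop]
theorem restrict {f : α → Vec} {g : α → List Vec} (b : ZMod 2) (hf : Poly f) (hg : Poly g) :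
    Poly (fun a => restrict (f a) b (g a)) := by
  unfold GateElim.restrict
  exact cond (by fun_prop) hg (list_map hg (f := fun a r => GateElim.restrictRow (f a) b r)
    (by fun_prop))

@[fun_prop]
theorem better {f : α → Net} {g h : α → List Vec} (hf : Poly f) (hg : Poly g) (hh : Poly h) :
    Poly (fun a => better (f a) (g a) (h a)) := by
  unfold GateElim.better
  fun_prop

end Poly

theorem length_restrictRow (v : Vec) (c : ZMod 2) (row : Vec) :
    (restrictRow v c row).length = row.length := by
  unfold restrictRow
  cases row.tail.getD (pivot v) 0 == 0 <;> simp [length_zipPad]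

theorem shape_restrict (v : Vec) (c : ZMod 2) (rows : List Vec) :
    (restrict v c rows).map List.length = rows.map List.length := by
  unfold restrict
  cases isConst v
  · simp only [cond_false, List.map_map]
    exact List.map_congr_left fun r _ => length_restrictRow v c r
  · rfl

theorem better_eq_or (c : Net) (r r' : List Vec) : better c r r' = r ∨ better c r r' = r' := by
  unfold better
  cases decide (key c r' < key c r) <;> simp

/-- All candidates are restrictions of the original `rows`, not of the current favourite, so a round
imposes at most one equation. -/
theorem best_induction (c : Net) (rows : List Vec) {p : List Vec → Prop} (h0 : p rows)
    (h : ∀ v ∈ (runGates c rows).1, ∀ b, p (restrict v b rows)) : p (best c rows) := by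
  unfold best
  suffices H : ∀ (l : List Vec) r, (∀ v ∈ l, ∀ b, p (restrict v b rows)) → p r →
      p (l.foldl (fun r v => better c (better c r (restrict v 0 rows)) (restrict v 1 rows)) r) from
    H _ _ h h0
  intro l
  induction l with
  | nil => exact fun r _ hr => hr
  | cons v l ih =>
    intro r hl hr
    refine ih _ (fun w hw => hl w (List.mem_cons_of_mem _ hw)) ?_
    have h1 : p (better c r (restrict v 0 rows)) := by
      rcases better_eq_or c r (restrict v 0 rows) with e | e <;> rw [e]
      · exact hr
      · exact hl v List.mem_cons_self 0
    dsimp only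
    rcases better_eq_or c (better c r (restrict v 0 rows)) (restrict v 1 rows) with e | e <;> rw [e]
    · exact h1
    · exact hl v List.mem_cons_self 1

theorem shape_best (c : Net) (rows : List Vec) :
    (best c rows).map List.length = rows.map List.length :=
  best_induction c rows (p := fun r => r.map List.length = rows.map List.length) rfl
    fun v _ b => shape_restrict v b rows

/-- A bit has size 1 or 3, so a vector of length L has size between 2L + 1 and 4L + 1. As
restrictions keep the row lengths, sizes cannot build up over the rounds. -/
theorem sz_le_of_shape {r r' : List Vec} (h : r.map List.length = r'.map List.length) :
    sz r ≤ 2 * sz r' := by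
  induction r generalizing r' with
  | nil =>
    have := sz_pos r'
    rw [sz_nil]
    omega
  | cons v r ih =>
    cases r' with
    | nil => simp at h
    | cons v' r' =>
      simp only [List.map_cons, List.cons.injEq] at h
      have h1 := ih h.2
      have h2 := sz_vec v
      have h3 : 2 * v'.length + 1 ≤ sz v' := by
        clear h ih h1
        induction v' with
        | nil => exact le_rfl
        | cons b l ih =>
          have := sz_pos b
          simp only [List.length_cons, sz_cons]
          omega
      simp only [sz_cons]
      omega

namespace Poly

@[fun_prop]
theorem best {f : α → Net} {g : α → List Vec} (hf : Poly f) (hg : Poly g) :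
    Poly (fun a => best (f a) (g a)) := by
  unfold GateElim.best
  refine foldl_of_inv (L := fun a => (GateElim.runGates (f a) (g a)).1)
    (step := fun z : α × List Vec × Vec => GateElim.better (f z.1) (GateElim.better (f z.1) z.2.1
      (GateElim.restrict z.2.2 0 (g z.1))) (GateElim.restrict z.2.2 1 (g z.1)))
    (by fun_prop) hg (by fun_prop) ((PolyBdd.const 2).mul hg.1)
    (fun a _ r => r.map List.length = (g a).map List.length) (fun _ => rfl) ?_
    fun a k r _ h => sz_le_of_shape h
  intro a k r v _ _ h
  dsimp only
  rcases better_eq_or (f a) (GateElim.better (f a) r (GateElim.restrict v 0 (g a)))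
    (GateElim.restrict v 1 (g a)) with e | e <;> rw [e]
  · rcases better_eq_or (f a) r (GateElim.restrict v 0 (g a)) with e | e <;> rw [e]
    · exact h
    · exact shape_restrict _ _ _
  · exact shape_restrict _ _ _

@[fun_prop]
theorem solve {f : α → Net} {g h : α → List Vec} (hf : Poly f) (hg : Poly g) (hh : Poly h) :
    Poly (fun a => solve (f a) (g a) (h a)) := by
  unfold GateElim.solve
  refine foldl_of_inv (L := h) (step := fun z : α × List Vec × Vec => GateElim.best (f z.1) z.2.1)
    hh hg (by fun_prop) ((PolyBdd.const 2).mul hg.1)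
    (fun a _ r => r.map List.length = (g a).map List.length) (fun _ => rfl)
    (fun a k r v _ _ h => (shape_best _ _).trans h) fun a k r _ h => sz_le_of_shape h

@[fun_prop]
theorem transp {f g : α → List Vec} (hf : Poly f) (hg : Poly g) :
    Poly (fun a => transp (f a) (g a)) := by
  unfold GateElim.transp
  have hM : PolyBdd (fun a => sz (f a) + sz (g a)) := hf.1.add hg.1
  refine foldr_of_inv (L := g) (s₀ := f) (step := fun z : α × List Vec × Vec =>
      zipPad (fun b w => b :: w) [] z.2.2 z.2.1) hg hf
    (list_zipPad [] (by fun_prop) (by fun_prop) (by fun_prop))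
    ((hM.mul (((PolyBdd.const 4).mul hM).add (.const 2))).add (.const 1))
    (fun a k acc => acc.length ≤ sz (f a) + sz (g a) ∧ ∀ v ∈ acc, v.length ≤ sz (f a) + k) ?_ ?_ ?_
  · intro a
    refine ⟨(length_lt_sz _).le.trans (Nat.le_add_right _ _), fun v hv => ?_⟩
    have h1 := sz_lt_of_mem hv
    have h2 := length_lt_sz v
    omega
  · rintro a k acc v - hv ⟨h1, h2⟩
    refine ⟨?_, ?_⟩
    · rw [length_zipPad]
      have h3 := sz_lt_of_mem hv
      have h4 := length_lt_sz v
      dsimp only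
      omega
    · dsimp only
      have : ∀ (v : Vec) (acc : List Vec) (L : ℕ), (∀ w ∈ acc, w.length ≤ L) →
          ∀ w ∈ zipPad (fun b w => b :: w) [] v acc, w.length ≤ L + 1 := by
        intro v
        induction v with
        | nil => simp [zipPad]
        | cons b v ih =>
          intro acc L hL w hw
          rcases List.mem_cons.1 hw with rfl | hw
          · cases acc with
            | nil => simp
            | cons u acc => simpa using hL u List.mem_cons_self
          · exact ih acc.tail L (fun u hu => hL u (List.mem_of_mem_tail hu)) w hw
      exact this v acc _ h2
  · rintro a k acc hk ⟨h1, h2⟩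
    have h3 := length_lt_sz (g a)
    refine (sz_vecs_le (L := sz (f a) + sz (g a)) fun v hv => (h2 v hv).trans (by omega)).trans ?_
    exact Nat.add_le_add_right (Nat.mul_le_mul_right _ h1) 1

@[fun_prop]
theorem toBit {f : α → Data} (hf : Poly f) : Poly (fun a => toBit (f a)) := by
  unfold GateElim.toBit
  fun_prop

@[fun_prop]
theorem wireIdx {f : α → Data} {n : α → ℕ} (hn : Poly n) (hf : Poly f) :
    Poly (fun a => wireIdx (n a) (f a)) := by
  unfold GateElim.wireIdx
  fun_prop

@[fun_prop]
theorem normalGate {f : α → List Data} {n : α → ℕ} (hn : Poly n) (hf : Poly f) :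
    Poly (fun a => normalGate (n a) (f a)) := by
  unfold GateElim.normalGate
  fun_prop

theorem map_const {f : α → List β} (b : γ) (hf : Poly f) : Poly (fun a => (f a).map fun _ => b) :=
  list_map hf (f := fun _ _ => b) (by fun_prop)

@[fun_prop]
theorem inputNet {f : α → Input} (hf : Poly f) : Poly (fun a => inputNet (f a)) := by
  unfold GateElim.inputNet
  exact pair (list_map (by fun_prop) (f := fun a g => GateElim.normalGate (f a).2.2.length g)
    (by fun_prop)) (pair (by fun_prop) (list_cons (const _) (map_const _ (by fun_prop))))

@[fun_prop]
theorem inputRows {f : α → Input} (hf : Poly f) : Poly (fun a => inputRows (f a)) := by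
  unfold GateElim.inputRows
  exact transp (map_const _ (by fun_prop)) (by fun_prop)

@[fun_prop]
theorem columns {f : α → Vec} {g : α → List Vec} (hf : Poly f) (hg : Poly g) :
    Poly (fun a => columns (f a) (g a)) := by
  unfold GateElim.columns
  exact transp (map_const _ hf) hg

@[fun_prop]
theorem toAffine {f : α → List Vec} (hf : Poly f) : Poly (fun a => toAffine (f a)) := by
  unfold GateElim.toAffine
  exact pair (list_filter (by fun_prop) (f := fun _ (v : Vec) => v.any (fun b => !(b == 0)))
    (list_any (by fun_prop) (by fun_prop))) (by fun_prop)

theorem algorithm : Poly algorithm := by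
  unfold GateElim.algorithm
  exact toAffine (columns (list_cons (const _) (map_const _ (by fun_prop)))
    (solve (by fun_prop) (by fun_prop) (by fun_prop)))

/-- The program of a function that is computable in polynomial time. -/
theorem exists_program {f : α → β} (hf : Poly f) : ∃ (P : Program) (p : Polynomial ℕ),
    ∀ a, ∃ t, P.Runs (enc a) (enc (f a)) t ∧ t ≤ p.eval (sz a) := by
  obtain ⟨-, T, ⟨p, hp⟩, h⟩ := hf
  obtain ⟨P, e, x, h⟩ := h [.nil] (by simp)
  refine ⟨P.set 0 e, p, fun a => ?_⟩
  obtain ⟨t, r, ht⟩ := h _ (Ext.set_zero P e) a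
  refine ⟨t, ⟨e, ?_, r⟩, ht.trans (hp a)⟩
  have := x.1
  simp at this
  rw [List.getElem?_set_self (by omega)]

end Poly
end GateElim

/-! ### Affine forms, their classes, and symbolic runs. -/

namespace GateElim

/-! ### The meaning of forms -/

theorem bit_cases (b : ZMod 2) : b = 0 ∨ b = 1 := by revert b; decide

theorem getD_zipPad (u v : Vec) (i : ℕ) :
    (zipPad (· + ·) 0 u v).getD i 0 = if i < u.length then u.getD i 0 + v.getD i 0 else 0 := by
  induction u generalizing v i with
  | nil => simp [zipPad]
  | cons a u ih =>
    cases i with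
    | zero => cases v <;> simp [zipPad]
    | succ i =>
      rw [zipPad, List.getD_cons_succ, ih]
      cases v <;> simp

theorem getD_vadd (u v : Vec) (i : ℕ) : (vadd u v).getD i 0 = u.getD i 0 + v.getD i 0 := by
  unfold vadd
  by_cases hi : i < u.length
  · rw [List.getD_append _ _ _ _ (by rwa [length_zipPad]), getD_zipPad, if_pos hi]
  · rw [List.getD_append_right _ _ _ _ (by rw [length_zipPad]; omega), length_zipPad,
      List.getD_eq_default u 0 (by omega), zero_add, List.getD_eq_getElem?_getD,
      List.getElem?_drop, List.getD_eq_getElem?_getD]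
    congr 3
    omega

/-- The values of the variables, preceded by the value of the constant. -/
def withOne (t : ℕ → ZMod 2) : ℕ → ZMod 2
  | 0 => 1
  | i + 1 => t i

/-- The value of a form. -/
def ev (v : Vec) (t : ℕ → ZMod 2) : ZMod 2 :=
  ∑ i ∈ Finset.range v.length, v.getD i 0 * withOne t i

theorem ev_eq_sum {v : Vec} {L : ℕ} (h : v.length ≤ L) (t : ℕ → ZMod 2) :
    ev v t = ∑ i ∈ Finset.range L, v.getD i 0 * withOne t i := by
  refine Finset.sum_subset (Finset.range_mono h) fun i _ hi => ?_
  rw [List.getD_eq_default _ _ (by simpa using hi), zero_mul]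

theorem ev_vadd (u v : Vec) (t : ℕ → ZMod 2) : ev (vadd u v) t = ev u t + ev v t := by
  rw [ev_eq_sum (le_refl _), ev_eq_sum (v := u) (L := (vadd u v).length) (by simp [length_vadd]),
    ev_eq_sum (v := v) (L := (vadd u v).length) (by simp [length_vadd]), ← Finset.sum_add_distrib]
  exact Finset.sum_congr rfl fun i _ => by rw [getD_vadd, add_mul]

theorem ev_nil (t : ℕ → ZMod 2) : ev [] t = 0 := by simp [ev]

theorem ev_singleton (b : ZMod 2) (t : ℕ → ZMod 2) : ev [b] t = b := by simp [ev, withOne]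

theorem ev_smul (b : ZMod 2) (v : Vec) (t : ℕ → ZMod 2) : ev (smul b v) t = b * ev v t := by
  rcases bit_cases b with rfl | rfl
  · simp [smul, ev_nil]
  · rw [one_mul]
    rfl

theorem ev_unit (k : ℕ) (t : ℕ → ZMod 2) :
    ev (List.replicate (k + 1) 0 ++ [1]) t = t k := by
  unfold ev
  rw [Finset.sum_eq_single (k + 1)]
  · rw [List.getD_append_right _ _ _ _ (by simp)]
    simp [withOne]
  · intro i hi hk
    have : i < k + 1 := by
      simp at hi
      omega
    rw [List.getD_append _ _ _ _ (by simpa using this), List.getD_replicate _ this, zero_mul]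
  · simp

theorem ev_congr {v : Vec} {t t' : ℕ → ZMod 2} (h : ∀ i, i + 1 < v.length → t i = t' i) :
    ev v t = ev v t' := by
  refine Finset.sum_congr rfl fun i hi => ?_
  cases i with
  | zero => rfl
  | succ i =>
    have : t i = t' i := h i (by simpa using hi)
    simp only [withOne, this]

theorem ev_update (v : Vec) (t : ℕ → ZMod 2) (i : ℕ) (b : ZMod 2) :
    ev v (Function.update t i (t i + b)) = ev v t + v.getD (i + 1) 0 * b := by
  have h1 : v.length ≤ max v.length (i + 2) := le_max_left _ _
  rw [ev_eq_sum h1, ev_eq_sum h1, ← Finset.add_sum_erase _ _ (a := i + 1) (by simp),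
    ← Finset.add_sum_erase (Finset.range _) (fun j => v.getD j 0 * withOne t j) (a := i + 1)
      (by simp)]
  have : ∑ x ∈ (Finset.range (max v.length (i + 2))).erase (i + 1),
      v.getD x 0 * withOne (Function.update t i (t i + b)) x =
      ∑ x ∈ (Finset.range (max v.length (i + 2))).erase (i + 1), v.getD x 0 * withOne t x := by
    refine Finset.sum_congr rfl fun j hj => ?_
    cases j with
    | zero => rfl
    | succ j =>
      have : j ≠ i := fun h => (Finset.mem_erase.1 hj).1 (by rw [h])
      simp [withOne, this]
  rw [this]
  simp only [withOne, Function.update_self]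
  ring

/-- The class of a form modulo constants. -/
def cls (v : Vec) : (ℕ → ZMod 2) → ZMod 2 := fun t => ev v t + ev v 0

theorem bit_add_self (b : ZMod 2) : b + b = 0 := CharTwo.add_self_eq_zero b

theorem bit_add_eq_zero {a b : ZMod 2} : a + b = 0 ↔ a = b := CharTwo.add_eq_zero

theorem cls_vadd (u v : Vec) : cls (vadd u v) = cls u + cls v := by
  funext t
  simp only [cls, ev_vadd, Pi.add_apply]
  ring

theorem cls_eq_zero_iff {v : Vec} : cls v = 0 ↔ ∀ t, ev v t = ev v 0 := by
  rw [funext_iff]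
  exact forall_congr' fun t => bit_add_eq_zero

theorem fun_add_eq_zero {f g : (ℕ → ZMod 2) → ZMod 2} : f + g = 0 ↔ f = g := by
  rw [funext_iff, funext_iff]
  exact forall_congr' fun t => bit_add_eq_zero

theorem cls_eq_iff {u v : Vec} : cls u = cls v ↔ ∀ t, ev u t + ev v t = ev u 0 + ev v 0 := by
  rw [← fun_add_eq_zero, ← cls_vadd, cls_eq_zero_iff]
  simp only [ev_vadd]

theorem ev_zero (v : Vec) : ev v 0 = v.headD 0 := by
  cases v with
  | nil => rfl
  | cons b v =>
    rw [ev, List.length_cons, Finset.sum_range_succ']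
    simp [withOne]

theorem isConst_iff {v : Vec} : isConst v = true ↔ cls v = 0 := by
  have h1 : isConst v = true ↔ ∀ i, v.getD (i + 1) 0 = 0 := by
    cases v with
    | nil => simp [isConst]
    | cons b v =>
      simp only [isConst, List.tail_cons, Bool.not_eq_true', List.any_eq_false,
        beq_iff_eq, List.getD_cons_succ, Bool.not_eq_false]
      constructor
      · intro h i
        rw [List.getD_eq_getElem?_getD]
        cases hi : v[i]? with
        | none => rfl
        | some x => exact h x (List.mem_of_getElem? hi)
      · intro h x hx
        obtain ⟨i, hi⟩ := List.mem_iff_getElem?.1 hx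
        have := h i
        rwa [List.getD_eq_getElem?_getD, hi] at this
  rw [h1, cls_eq_zero_iff]
  constructor
  · intro h t
    refine Finset.sum_congr rfl fun i _ => ?_
    cases i with
    | zero => rfl
    | succ i => rw [h, zero_mul, zero_mul]
  · intro h i
    have := ev_update v 0 i 1
    rw [h] at this
    simpa using this

theorem equiv_iff {u v : Vec} : equiv u v = true ↔ cls u = cls v := by
  rw [equiv, isConst_iff, cls_vadd, fun_add_eq_zero]

/-- The product of two forms is a form for an obvious reason. -/
def Deg (p q : Vec) : Prop := cls p = 0 ∨ cls q = 0 ∨ cls p = cls q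

/-- Besides the constant cases: if q = p + e with e constant, then pq = (1 + e)p because p² = p. -/
theorem ev_mulForm_of_deg {z p q : Vec} (h : Deg p q) (t : ℕ → ZMod 2) :
    ev (mulForm z p q) t = ev p t * ev q t := by
  unfold mulForm
  cases hp : isConst p with
  | true =>
    rw [cond_true, ev_smul, ← ev_zero, cls_eq_zero_iff.1 (isConst_iff.1 hp) t]
  | false =>
    rw [cond_false]
    cases hq : isConst q with
    | true =>
      rw [cond_true, ev_smul, ← ev_zero, cls_eq_zero_iff.1 (isConst_iff.1 hq) t, mul_comm]
    | false =>
      rw [cond_false]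
      cases hpq : equiv p q with
      | true =>
        rw [cond_true, ev_smul, ← ev_zero, ev_vadd, ← cls_eq_iff.1 (equiv_iff.1 hpq) t]
        generalize ev p t = x; generalize ev q t = y
        revert x y
        decide
      | false =>
        simp only [← Bool.not_eq_true, isConst_iff, equiv_iff] at hp hq hpq
        rcases h with h | h | h <;> contradiction

theorem mulForm_of_not_deg {z p q : Vec} (h : ¬ Deg p q) : mulForm z p q = z := by
  simp only [Deg, not_or] at h
  have h1 : isConst p = false := by rw [← Bool.not_eq_true, isConst_iff]; exact h.1
  have h2 : isConst q = false := by rw [← Bool.not_eq_true, isConst_iff]; exact h.2.1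
  have h3 : equiv p q = false := by rw [← Bool.not_eq_true, equiv_iff]; exact h.2.2
  simp [mulForm, h1, h2, h3]

theorem ev_gateForm (z : Vec) (c : Coeffs) (p q : Vec) (t : ℕ → ZMod 2) :
    ev (gateForm z c p q) t =
      c.1 + c.2.1 * ev p t + c.2.2.1 * ev q t + c.2.2.2 * ev (mulForm z p q) t := by
  simp only [gateForm, ev_vadd, ev_smul, ev_singleton]
  ring

/-- The only scalars are 0 and 1. Hence a gate whose operands span at most one nonzero class never
creates a new class. -/
theorem cls_of_affine {r q : Vec} (a b : ZMod 2) (h : ∀ t, ev r t = a + b * ev q t) :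
    cls r = 0 ∨ cls r = cls q := by
  rcases bit_cases b with rfl | rfl
  · left
    rw [cls_eq_zero_iff]
    intro t
    simp [h]
  · right
    rw [cls_eq_iff]
    intro t
    have key : ∀ a x y : ZMod 2, a + 1 * x + x = a + 1 * y + y := by decide
    rw [h t, h 0, key a _ (ev q 0)]

theorem cls_gateForm_left {z : Vec} {c : Coeffs} {p q : Vec} (h : cls p = 0) :
    cls (gateForm z c p q) = 0 ∨ cls (gateForm z c p q) = cls q := by
  refine cls_of_affine (c.1 + c.2.1 * ev p 0) (c.2.2.1 + c.2.2.2 * ev p 0) fun t => ?_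
  rw [ev_gateForm, ev_mulForm_of_deg (.inl h), cls_eq_zero_iff.1 h t]
  ring

theorem cls_gateForm_right {z : Vec} {c : Coeffs} {p q : Vec} (h : cls q = 0) :
    cls (gateForm z c p q) = 0 ∨ cls (gateForm z c p q) = cls p := by
  refine cls_of_affine (c.1 + c.2.2.1 * ev q 0) (c.2.1 + c.2.2.2 * ev q 0) fun t => ?_
  rw [ev_gateForm, ev_mulForm_of_deg (.inr (.inl h)), cls_eq_zero_iff.1 h t]
  ring

theorem cls_gateForm_of_eq {z : Vec} {c : Coeffs} {p q : Vec} (h : cls p = cls q) :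
    cls (gateForm z c p q) = 0 ∨ cls (gateForm z c p q) = cls p := by
  have key : ∀ (c0 c1 c2 c3 x y d : ZMod 2), x + y = d → c0 + c1 * x + c2 * y + c3 * (x * y) =
      c0 + c2 * d + (c1 + c2 + c3 * (d + 1)) * x := by decide
  refine cls_of_affine (c.1 + c.2.2.1 * (ev p 0 + ev q 0))
    (c.2.1 + c.2.2.1 + c.2.2.2 * (ev p 0 + ev q 0 + 1)) fun t => ?_
  rw [ev_gateForm, ev_mulForm_of_deg (.inr (.inr h))]
  exact key _ _ _ _ _ _ _ (cls_eq_iff.1 h t)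

theorem cls_gateForm_of_deg {z : Vec} {c : Coeffs} {p q : Vec} (h : Deg p q) :
    cls (gateForm z c p q) = 0 ∨ cls (gateForm z c p q) = cls p ∨
      cls (gateForm z c p q) = cls q := by
  rcases h with h | h | h
  · have := cls_gateForm_left (z := z) (c := c) (q := q) h; tauto
  · have := cls_gateForm_right (z := z) (c := c) (p := p) h; tauto
  · have := cls_gateForm_of_eq (z := z) (c := c) h; tauto

theorem cls_gateForm_of_linear {z : Vec} {c : Coeffs} {p q : Vec} (h : c.2.2.2 = 0) :
    cls (gateForm z c p q) = 0 ∨ cls (gateForm z c p q) = cls p ∨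
      cls (gateForm z c p q) = cls q ∨ cls (gateForm z c p q) = cls p + cls q := by
  have h0 : ∀ t, cls (gateForm z c p q) t = c.2.1 * cls p t + c.2.2.1 * cls q t := by
    intro t
    have key : ∀ c0 c1 c2 x y x' y' : ZMod 2, c0 + c1 * x + c2 * y + (c0 + c1 * x' + c2 * y') =
      c1 * (x + x') + c2 * (y + y') := by decide
    simp only [cls, ev_gateForm, h, zero_mul, add_zero]
    exact key _ _ _ _ _ _ _
  rcases bit_cases c.2.1 with h1 | h1 <;> rcases bit_cases c.2.2.1 with h2 | h2 <;>
    simp only [h1, h2, zero_mul, one_mul, zero_add, add_zero] at h0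
  · exact .inl (funext h0)
  · exact .inr (.inr (.inl (funext h0)))
  · exact .inr (.inl (funext h0))
  · exact .inr (.inr (.inr (funext h0)))

/-! ### Runs -/

/-- `w` lists the forms of `n` inputs, in `d` variables, and of `m` gates. -/
structure IsRun (n d m : ℕ) (g : ℕ → NGate) (w : ℕ → Vec) : Prop where
  lt : ∀ k < m, (g k).2.1 < n + k ∧ (g k).2.2 < n + k
  row : ∀ i < n, (w i).length = d + 1
  gate : ∀ k < m, w (n + k) = gateForm (List.replicate (d + k + 1) 0 ++ [1]) (g k).1
    (w (g k).2.1) (w (g k).2.2)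

theorem wire_cases {n m i : ℕ} (h : i < n + m) : i < n ∨ ∃ k < m, i = n + k := by
  by_cases h' : i < n
  · exact .inl h'
  · exact .inr ⟨i - n, by omega, by omega⟩

namespace IsRun

variable {n d m : ℕ} {g : ℕ → NGate} {w : ℕ → Vec}

theorem ev_gate (h : IsRun n d m g w) {k : ℕ} (hk : k < m) (t : ℕ → ZMod 2) :
    ev (w (n + k)) t = (g k).1.1 + (g k).1.2.1 * ev (w (g k).2.1) t +
      (g k).1.2.2.1 * ev (w (g k).2.2) t + (g k).1.2.2.2 *
        ev (mulForm (List.replicate (d + k + 1) 0 ++ [1]) (w (g k).2.1) (w (g k).2.2)) t := by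
  rw [h.gate k hk, ev_gateForm]

/-- Wires before gate k involve only variables of index below d + k, so the variable d + k is new at
gate k. -/
theorem length_le (h : IsRun n d m g w) {i : ℕ} (hi : i < n + m) :
    (w i).length ≤ d + 1 + (i + 1 - n) := by
  induction i using Nat.strong_induction_on with
  | _ i ih =>
    rcases wire_cases hi with h' | ⟨k, hk, rfl⟩
    · rw [h.row i h']
      omega
    · have h1 := h.lt k hk
      rw [h.gate k hk]
      refine length_gateForm _ _ _ _ (by omega) (by simp; omega) ?_ ?_
      · exact (ih _ h1.1 (by omega)).trans (by omega)
      · exact (ih _ h1.2 (by omega)).trans (by omega)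

/-- Functions that satisfy the equations of the gates are given by the forms. -/
theorem transfer {τ : Type} (h : IsRun n d m g w) (val : ℕ → τ → ZMod 2) (T : τ → ℕ → ZMod 2)
    (h0 : ∀ i < n, ∀ x, val i x = ev (w i) (T x))
    (h1 : ∀ k < m, ∀ x, val (n + k) x = (g k).1.1 + (g k).1.2.1 * val (g k).2.1 x +
      (g k).1.2.2.1 * val (g k).2.2 x + (g k).1.2.2.2 * T x (d + k))
    (h2 : ∀ k < m, (∀ x, val (g k).2.1 x = ev (w (g k).2.1) (T x)) →
      (∀ x, val (g k).2.2 x = ev (w (g k).2.2) (T x)) → Deg (w (g k).2.1) (w (g k).2.2) →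
      ∀ x, T x (d + k) = val (g k).2.1 x * val (g k).2.2 x) :
    ∀ i < n + m, ∀ x, val i x = ev (w i) (T x) := by
  intro i
  induction i using Nat.strong_induction_on with
  | _ i ih =>
    intro hi x
    rcases wire_cases hi with h' | ⟨k, hk, rfl⟩
    · exact h0 i h' x
    · have h3 := h.lt k hk
      have hu := ih _ h3.1 (by omega)
      have hv := ih _ h3.2 (by omega)
      rw [h1 k hk, h.ev_gate hk, hu, hv]
      congr 2
      by_cases hd : Deg (w (g k).2.1) (w (g k).2.2)
      · rw [h2 k hk hu hv hd, ev_mulForm_of_deg hd, hu, hv]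
      · rw [mulForm_of_not_deg hd, ev_unit]

/-- Restricting the inputs acts on the forms of all wires by a substitution. -/
theorem exists_subst {w' : ℕ → Vec} (h : IsRun n d m g w) (h' : IsRun n d m g w')
    (T₀ : (ℕ → ZMod 2) → ℕ → ZMod 2) (h0 : ∀ i < n, ∀ t, ev (w' i) t = ev (w i) (T₀ t)) :
    ∃ T : (ℕ → ZMod 2) → ℕ → ZMod 2, (∀ t, ∀ i < d, T t i = T₀ t i) ∧
      ∀ i < n + m, ∀ t, ev (w' i) t = ev (w i) (T t) := by
  -- The variable of gate k is sent to whatever represents the product at that gate in the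
  -- restricted run: again the new variable, or an affine form if the product has become degenerate.
  set T : (ℕ → ZMod 2) → ℕ → ZMod 2 := fun t i => if i < d then T₀ t i else
    ev (mulForm (List.replicate (d + (i - d) + 1) 0 ++ [1]) (w' (g (i - d)).2.1)
      (w' (g (i - d)).2.2)) t with hT
  have hTd : ∀ k t, T t (d + k) = ev (mulForm (List.replicate (d + k + 1) 0 ++ [1])
      (w' (g k).2.1) (w' (g k).2.2)) t := by
    intro k t
    simp [hT]
  refine ⟨T, fun t i hi => if_pos hi, h.transfer (fun i t => ev (w' i) t) T ?_ ?_ ?_⟩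
  · intro i hi t
    rw [h0 i hi]
    refine ev_congr fun j hj => ?_
    rw [h.row i hi] at hj
    exact (if_pos (by omega)).symm
  · intro k hk t
    rw [hTd]
    exact h'.ev_gate hk t
  · intro k hk hu hv hd t
    rw [hTd]
    refine ev_mulForm_of_deg ?_ t
    simp only [Deg, cls_eq_zero_iff, cls_eq_iff] at hd ⊢
    simp only [hu, hv]
    rcases hd with hd | hd | hd
    · left; intro t; rw [hd (T t), hd (T 0)]
    · right; left; intro t; rw [hd (T t), hd (T 0)]
    · right; right; intro t; rw [hd (T t), hd (T 0)]

end IsRun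
end GateElim

/-! ### Gate elimination: one restriction removes four classes. -/

namespace GateElim

/-! ### Classes in use, and how many of them disappear under a restriction -/

/-- The class of gate `k` is not constant and differs from the classes of all earlier wires. -/
def Fresh (n m : ℕ) (w : ℕ → Vec) (k : ℕ) : Prop :=
  k < m ∧ cls (w (n + k)) ≠ 0 ∧ ∀ j < n + k, cls (w j) ≠ cls (w (n + k))

/-- The gate `k` has an operand of class `κ`. -/
def Reads (g : ℕ → NGate) (w : ℕ → Vec) (k : ℕ) (κ : (ℕ → ZMod 2) → ZMod 2) : Prop :=
  cls (w (g k).2.1) = κ ∨ cls (w (g k).2.2) = κ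

/-- The classes of the fresh gates and of their operands. -/
def classes (n m : ℕ) (g : ℕ → NGate) (w : ℕ → Vec) : Set ((ℕ → ZMod 2) → ZMod 2) :=
  {κ | ∃ k, Fresh n m w k ∧ (Reads g w k κ ∨ cls (w (n + k)) = κ)}

/-- The class only depends on the first `d` variables. -/
def Lin (d : ℕ) (κ : (ℕ → ZMod 2) → ZMod 2) : Prop :=
  ∀ t t' : ℕ → ZMod 2, (∀ i < d, t i = t' i) → κ t = κ t'

theorem Lin.add {d : ℕ} {κ μ : (ℕ → ZMod 2) → ZMod 2} (h : Lin d κ) (h' : Lin d μ) :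
    Lin d (κ + μ) := fun t t' e => congrArg₂ (· + ·) (h t t' e) (h' t t' e)

/-- The action of a substitution on classes. -/
def push (T : (ℕ → ZMod 2) → ℕ → ZMod 2) (κ : (ℕ → ZMod 2) → ZMod 2) : (ℕ → ZMod 2) → ZMod 2 :=
  fun t => κ (T t) + κ (T 0)

theorem push_add (T : (ℕ → ZMod 2) → ℕ → ZMod 2) (κ μ : (ℕ → ZMod 2) → ZMod 2) :
    push T (κ + μ) = push T κ + push T μ := by
  funext t
  simp only [push, Pi.add_apply]
  ring

theorem push_zero (T : (ℕ → ZMod 2) → ℕ → ZMod 2) : push T 0 = 0 := by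
  funext t
  simp [push]

/-- The first wire of a class. -/
noncomputable def firstWire (w : ℕ → Vec) (κ : (ℕ → ZMod 2) → ZMod 2) : ℕ :=
  sInf {i | cls (w i) = κ}

theorem firstWire_le (w : ℕ → Vec) (i : ℕ) : firstWire w (cls (w i)) ≤ i := Nat.sInf_le rfl

theorem cls_firstWire (w : ℕ → Vec) (i : ℕ) : cls (w (firstWire w (cls (w i)))) = cls (w i) :=
  Nat.sInf_mem (s := {j | cls (w j) = cls (w i)}) ⟨i, rfl⟩

theorem Fresh.firstWire_eq {n m : ℕ} {w : ℕ → Vec} {k : ℕ} (h : Fresh n m w k) :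
    firstWire w (cls (w (n + k))) = n + k := by
  refine le_antisymm (firstWire_le _ _) ?_
  by_contra hlt
  exact h.2.2 _ (not_le.1 hlt) (cls_firstWire w _)

theorem Fresh.le_of_cls_eq {n m : ℕ} {w : ℕ → Vec} {k i : ℕ} (h : Fresh n m w k)
    (e : cls (w i) = cls (w (n + k))) : n + k ≤ i := by
  by_contra hlt
  exact h.2.2 i (not_le.1 hlt) e

theorem Fresh.eq_of_cls_eq {n m : ℕ} {w : ℕ → Vec} {k j : ℕ} (h : Fresh n m w k)
    (h' : Fresh n m w j) (e : cls (w (n + j)) = cls (w (n + k))) : j = k := by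
  have h1 := h.le_of_cls_eq e
  have h2 := h'.le_of_cls_eq e.symm
  omega

/-- The first wire of a nonzero class is an input, or else a fresh gate by minimality. -/
theorem exists_fresh_or_input {n m : ℕ} {w : ℕ → Vec} {i : ℕ} (hi : i < n + m)
    (h0 : cls (w i) ≠ 0) :
    ∃ j ≤ i, cls (w j) = cls (w i) ∧ (j < n ∨ ∃ k, j = n + k ∧ Fresh n m w k) := by
  refine ⟨_, firstWire_le w i, cls_firstWire w i, ?_⟩
  have hle := firstWire_le w i
  rcases wire_cases (hle.trans_lt hi) with h | ⟨k, hk, e⟩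
  · exact .inl h
  · refine .inr ⟨k, e, hk, ?_, fun j hj hc => ?_⟩
    · rw [← e, cls_firstWire]; exact h0
    · rw [← e, cls_firstWire] at hc
      have := firstWire_le w j
      rw [hc] at this
      omega

theorem finite_classes (n m : ℕ) (g : ℕ → NGate) (w : ℕ → Vec) : (classes n m g w).Finite := by
  have : classes n m g w ⊆ (fun k => cls (w (g k).2.1)) '' Set.Iio m ∪
      (fun k => cls (w (g k).2.2)) '' Set.Iio m ∪ (fun k => cls (w (n + k))) '' Set.Iio m := by
    rintro κ ⟨k, hk, (h | h) | h⟩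
    · exact .inl (.inl ⟨k, hk.1, h⟩)
    · exact .inl (.inr ⟨k, hk.1, h⟩)
    · exact .inr ⟨k, hk.1, h⟩
  exact ((((Set.finite_Iio m).image _).union ((Set.finite_Iio m).image _)).union
    ((Set.finite_Iio m).image _)).subset this

/-- Four classes disappear if each of them is dropped or merged with one of smaller rank. -/
theorem ncard_add_four_le {X : Type} {N N' : Set X} (hN : N.Finite) {φ : X → X} (rk : X → ℕ)
    (hsub : N' ⊆ φ '' N) {p a b y : X} (hp : p ∈ N) (ha : a ∈ N) (hb : b ∈ N) (hy : y ∈ N)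
    (hpa : p ≠ a) (hpb : p ≠ b) (hab : a ≠ b) (hyp : y ≠ p) (hya : y ≠ a) (hyb : y ≠ b)
    (kp : φ p ∉ N') (ka : φ a ∉ N')
    (kb : φ b ∈ N' → ∃ κ ∈ N, rk κ < rk b ∧ φ κ = φ b)
    (ky : φ y ∈ N' → ∃ κ ∈ N, rk κ < rk y ∧ φ κ = φ y) : N'.ncard + 4 ≤ N.ncard := by
  classical
  set K : Finset X := {p, a, b, y} with hK
  have hK4 : K.card = 4 := by
    rw [hK, Finset.card_insert_of_notMem, Finset.card_insert_of_notMem,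
      Finset.card_insert_of_notMem, Finset.card_singleton]
    · simpa using hyb.symm
    · simpa using ⟨hab, hya.symm⟩
    · simpa using ⟨hpa, hpb, hyp.symm⟩
  have hKN : (K : Set X) ⊆ N := by
    intro x hx
    simp only [hK, Finset.coe_insert, Finset.coe_singleton, Set.mem_insert_iff,
      Set.mem_singleton_iff] at hx
    rcases hx with rfl | rfl | rfl | rfl <;> assumption
  -- Choose a preimage of least rank for each element of N'. It is not `p` or `a`, whose images are
  -- outside N', nor `b` or `y`, which can be replaced by something of smaller rank.
  have hsub' : N' ⊆ φ '' (N \ K) := by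
    intro ν hν
    have hex : ∃ r, ∃ κ ∈ N, φ κ = ν ∧ rk κ = r := by
      obtain ⟨κ, h1, h2⟩ := hsub hν
      exact ⟨_, κ, h1, h2, rfl⟩
    obtain ⟨κ, h1, rfl, h3⟩ := Nat.find_spec hex
    have hmin : ∀ κ' ∈ N, φ κ' = φ κ → rk κ ≤ rk κ' := by
      intro κ' h4 h5
      rw [h3]
      exact Nat.find_min' hex ⟨κ', h4, h5, rfl⟩
    refine ⟨κ, ⟨h1, fun hx => ?_⟩, rfl⟩
    simp only [hK, Finset.coe_insert, Finset.coe_singleton, Set.mem_insert_iff,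
      Set.mem_singleton_iff] at hx
    rcases hx with rfl | rfl | rfl | rfl
    · exact kp hν
    · exact ka hν
    · obtain ⟨κ', h4, h5, h6⟩ := kb hν
      exact absurd (hmin κ' h4 h6) (not_le.2 h5)
    · obtain ⟨κ', h4, h5, h6⟩ := ky hν
      exact absurd (hmin κ' h4 h6) (not_le.2 h5)
  have h1 := (Set.ncard_le_ncard hsub' ((hN.sdiff).image _)).trans (Set.ncard_image_le hN.sdiff)
  have h2 := Set.ncard_sdiff_add_ncard_of_subset hKN hN
  rw [Set.ncard_coe_finset, hK4] at h2
  omega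

namespace IsRun

variable {n d m : ℕ} {g : ℕ → NGate} {w w' : ℕ → Vec} {T : (ℕ → ZMod 2) → ℕ → ZMod 2}

/-- A degenerate product would leave the gate constant or in the class of an operand, hence not
fresh. -/
theorem not_deg (h : IsRun n d m g w) {k : ℕ} (hk : Fresh n m w k) :
    ¬ Deg (w (g k).2.1) (w (g k).2.2) := by
  intro hd
  have h1 := h.lt k hk.1
  have h2 := cls_gateForm_of_deg (z := List.replicate (d + k + 1) 0 ++ [1]) (c := (g k).1) hd
  rw [← h.gate k hk.1] at h2
  rcases h2 with h2 | h2 | h2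
  · exact hk.2.1 h2
  · exact hk.2.2 _ h1.1 h2.symm
  · exact hk.2.2 _ h1.2 h2.symm

theorem cls_ne_of_reads (h : IsRun n d m g w) {k : ℕ} (hk : Fresh n m w k)
    {κ : (ℕ → ZMod 2) → ZMod 2} (hr : Reads g w k κ) : cls (w (n + k)) ≠ κ := by
  have h1 := h.lt k hk.1
  rcases hr with rfl | rfl
  · exact (hk.2.2 _ h1.1).symm
  · exact (hk.2.2 _ h1.2).symm

theorem cls_eq_add (h : IsRun n d m g w) {k : ℕ} (hk : Fresh n m w k) (h3 : (g k).1.2.2.2 = 0) :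
    cls (w (n + k)) = cls (w (g k).2.1) + cls (w (g k).2.2) := by
  have h1 := h.lt k hk.1
  have h2 := cls_gateForm_of_linear (z := List.replicate (d + k + 1) 0 ++ [1])
    (p := w (g k).2.1) (q := w (g k).2.2) h3
  rw [← h.gate k hk.1] at h2
  rcases h2 with h2 | h2 | h2 | h2
  · exact absurd h2 hk.2.1
  · exact absurd h2.symm (hk.2.2 _ h1.1)
  · exact absurd h2.symm (hk.2.2 _ h1.2)
  · exact h2

theorem lin_input (h : IsRun n d m g w) {i : ℕ} (hi : i < n) : Lin d (cls (w i)) := by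
  intro t t' e
  refine congrArg (· + _) (ev_congr fun j hj => e j ?_)
  rw [h.row i hi] at hj
  omega

/-- The gate's own variable d + k occurs with coefficient one and in neither operand; flipping it
changes the class. -/
theorem not_lin (h : IsRun n d m g w) {k : ℕ} (hk : Fresh n m w k) (h3 : (g k).1.2.2.2 ≠ 0) :
    ¬ Lin d (cls (w (n + k))) := by
  intro hl
  have h1 := h.lt k hk.1
  have h2 := hl 0 (Function.update 0 (d + k) (0 + 1)) fun i hi => by
    rw [Function.update_of_ne (by omega)]
  have h4 : ∀ u < n + k, ev (w u) (Function.update 0 (d + k) (0 + 1)) = ev (w u) 0 := by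
    intro u hu
    refine ev_congr fun j hj => ?_
    have := h.length_le (i := u) (by have := hk.1; omega)
    rw [Function.update_of_ne (by omega)]
  have h5 : (g k).1.2.2.2 = 1 := (bit_cases _).resolve_left h3
  simp only [cls] at h2
  rw [h.ev_gate hk.1, h.ev_gate hk.1, mulForm_of_not_deg (h.not_deg hk), ev_unit, ev_unit,
    h4 _ h1.1, h4 _ h1.2, h5] at h2
  simp at h2

/-- If the class of an operand becomes constant, then the gate becomes constant or is merged with
the other operand. -/
theorem collapse (h : IsRun n d m g w) (h' : IsRun n d m g w')
    (hT : ∀ i < n + m, cls (w' i) = push T (cls (w i))) {k : ℕ} (hk : Fresh n m w k)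
    {κ : (ℕ → ZMod 2) → ZMod 2} (hr : Reads g w k κ) (hκ : push T κ = 0) :
    ∃ r < n + k, Reads g w k (cls (w r)) ∧ cls (w r) ≠ κ ∧
      (push T (cls (w (n + k))) = 0 ∨ push T (cls (w (n + k))) = push T (cls (w r))) := by
  have h1 := h.lt k hk.1
  have hkm := hk.1
  have hd := h.not_deg hk
  simp only [Deg, not_or] at hd
  rw [← hT (n + k) (by omega), h'.gate k hk.1]
  rcases hr with hr | hr
  · refine ⟨_, h1.2, .inr rfl, fun e => hd.2.2 (hr.trans e.symm), ?_⟩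
    rw [← hT _ (by omega)]
    refine cls_gateForm_left ?_
    rw [hT _ (by omega), hr, hκ]
  · refine ⟨_, h1.1, .inl rfl, fun e => hd.2.2 (e.trans hr.symm), ?_⟩
    rw [← hT _ (by omega)]
    refine cls_gateForm_right ?_
    rw [hT _ (by omega), hr, hκ]

/-- A substitution preserves equalities between classes and the zero class, so freshness can be lost
but not gained. -/
theorem fresh_of_push (hT : ∀ i < n + m, cls (w' i) = push T (cls (w i))) {k : ℕ}
    (hk : Fresh n m w' k) : Fresh n m w k := by
  have hkm := hk.1
  refine ⟨hk.1, fun e => hk.2.1 ?_, fun j hj e => hk.2.2 j hj ?_⟩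
  · rw [hT _ (by omega), e, push_zero]
  · rw [hT _ (by omega), hT _ (by omega), e]

theorem zero_notMem_classes (h : IsRun n d m g w) : 0 ∉ classes n m g w := by
  rintro ⟨k, hk, hr⟩
  have hd := h.not_deg hk
  simp only [Deg, not_or] at hd
  rcases hr with (hr | hr) | hr
  · exact hd.1 hr
  · exact hd.2.1 hr
  · exact hk.2.1 hr

theorem exists_wire_of_mem_classes (h : IsRun n d m g w)
    (hT : ∀ i < n + m, cls (w' i) = push T (cls (w i))) {κ : (ℕ → ZMod 2) → ZMod 2}
    (hκ : κ ∈ classes n m g w') : ∃ k, Fresh n m w' k ∧ ∃ i < n + m, push T (cls (w i)) = κ ∧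
      (Reads g w k (cls (w i)) ∨ i = n + k) := by
  obtain ⟨k, hk, hr⟩ := hκ
  have h1 := h.lt k hk.1
  have hkm := hk.1
  refine ⟨k, hk, ?_⟩
  rcases hr with (hr | hr) | hr
  · exact ⟨_, by omega, by rw [← hT _ (by omega), hr], .inl (.inl rfl)⟩
  · exact ⟨_, by omega, by rw [← hT _ (by omega), hr], .inl (.inr rfl)⟩
  · exact ⟨_, by omega, by rw [← hT _ (by omega), hr], .inr rfl⟩

theorem classes_subset (h : IsRun n d m g w)
    (hT : ∀ i < n + m, cls (w' i) = push T (cls (w i))) :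
    classes n m g w' ⊆ push T '' classes n m g w := by
  intro κ hκ
  obtain ⟨k, hk, i, hi, e, hr⟩ := exists_wire_of_mem_classes h hT hκ
  refine ⟨_, ⟨k, fresh_of_push hT hk, ?_⟩, e⟩
  rcases hr with hr | rfl
  · exact .inl hr
  · exact .inr rfl

/-- The four classes that disappear when an operand of the gate `A` is fixed so that `A` becomes
constant; `B` reads `A`, and `y` is any further class. -/
theorem ncard_classes_add_four_le (h : IsRun n d m g w) (h' : IsRun n d m g w')
    (hT : ∀ i < n + m, cls (w' i) = push T (cls (w i))) {A B : ℕ} (hA : Fresh n m w A)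
    (hB : Fresh n m w B) (hBA : Reads g w B (cls (w (n + A)))) {p y : (ℕ → ZMod 2) → ZMod 2}
    (hp : Reads g w A p) (kp : push T p = 0) (ka : push T (cls (w (n + A))) = 0)
    (rk : ((ℕ → ZMod 2) → ZMod 2) → ℕ)
    (hy : y ∈ classes n m g w) (hyp : y ≠ p) (hya : y ≠ cls (w (n + A)))
    (hyb : y ≠ cls (w (n + B)))
    (hrk : ∀ r < n + B, Reads g w B (cls (w r)) → rk (cls (w r)) < rk (cls (w (n + B))))
    (ky : push T y ∈ classes n m g w' →
      ∃ κ ∈ classes n m g w, rk κ < rk y ∧ push T κ = push T y) :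
    (classes n m g w').ncard + 4 ≤ (classes n m g w).ncard := by
  have hAB : n + A < n + B := by
    have h1 := h.lt B hB.1
    rcases hBA with e | e
    · exact (hA.le_of_cls_eq e).trans_lt h1.1
    · exact (hA.le_of_cls_eq e).trans_lt h1.2
  have hpw : ∃ j < n + A, cls (w j) = p := by
    have h1 := h.lt A hA.1
    rcases hp with e | e
    · exact ⟨_, h1.1, e⟩
    · exact ⟨_, h1.2, e⟩
  obtain ⟨j, hj, rfl⟩ := hpw
  have h0 := h'.zero_notMem_classes
  refine ncard_add_four_le (finite_classes n m g w) rk (h.classes_subset hT)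
    ⟨A, hA, .inl hp⟩ ⟨A, hA, .inr rfl⟩ ⟨B, hB, .inr rfl⟩ hy (hA.2.2 j hj)
    (hB.2.2 j (hj.trans hAB)) (hB.2.2 _ hAB) hyp hya hyb (by rwa [kp]) (by rwa [ka]) ?_ ky
  intro hb
  obtain ⟨r, hr, hrr, -, e⟩ := h.collapse h' hT hB hBA ka
  rcases e with e | e
  · rw [e] at hb
    exact absurd hb h0
  · exact ⟨_, ⟨B, hB, .inl hrr⟩, hrk r hr hrr, e.symm⟩

end IsRun

/-- The fresh gates on which the output depends. -/
inductive Live (n m : ℕ) (g : ℕ → NGate) (w : ℕ → Vec) (o : ℕ) : ℕ → Prop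
  | out {k : ℕ} (hk : Fresh n m w k) (e : cls (w (n + k)) = cls (w o)) : Live n m g w o k
  | step {j k : ℕ} (hj : Live n m g w o j) (hk : Fresh n m w k)
      (hr : Reads g w j (cls (w (n + k)))) : Live n m g w o k

namespace Live

variable {n d m o : ℕ} {g : ℕ → NGate} {w : ℕ → Vec}

theorem fresh {k : ℕ} (h : Live n m g w o k) : Fresh n m w k := by
  cases h <;> assumption

theorem exists_reader {k : ℕ} (h : Live n m g w o k) (hne : cls (w (n + k)) ≠ cls (w o)) :
    ∃ j, Live n m g w o j ∧ Reads g w j (cls (w (n + k))) := by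
  cases h with
  | out hk e => exact absurd e hne
  | step hj hk hr => exact ⟨_, hj, hr⟩

/-- A live gate that is not linear, with linear operands. -/
theorem exists_first (h : IsRun n d m g w) (ho : o < n + m) (hl : ¬ Lin d (cls (w o))) :
    ∃ A, Live n m g w o A ∧ (g A).1.2.2.2 ≠ 0 ∧ Lin d (cls (w (g A).2.1)) ∧
      Lin d (cls (w (g A).2.2)) := by
  classical
  have hfresh : ∀ i < n + m, ¬ Lin d (cls (w i)) →
      ∃ k, Fresh n m w k ∧ n + k ≤ i ∧ cls (w (n + k)) = cls (w i) := by
    intro i hi hn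
    obtain ⟨j, hj, e, hc⟩ := exists_fresh_or_input (w := w) hi (fun e => hn (by
      rw [e]; exact fun _ _ _ => rfl))
    rcases hc with hc | ⟨k, rfl, hk⟩
    · rw [← e] at hn
      exact absurd (h.lin_input hc) hn
    · exact ⟨k, hk, hj, e⟩
  have hex : ∃ k, Live n m g w o k ∧ ¬ Lin d (cls (w (n + k))) := by
    obtain ⟨k, hk, -, e⟩ := hfresh o ho hl
    exact ⟨k, .out hk e, by rwa [e]⟩
  obtain ⟨hA, hnl⟩ := Nat.find_spec hex
  have hmin : ∀ k, Live n m g w o k → ¬ Lin d (cls (w (n + k))) → Nat.find hex ≤ k :=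
    fun k h1 h2 => Nat.find_min' hex ⟨h1, h2⟩
  set A := Nat.find hex
  have h1 := h.lt A hA.fresh.1
  have hAm := hA.fresh.1
  have hop : ∀ u < n + A, Reads g w A (cls (w u)) → Lin d (cls (w u)) := by
    intro u hu hr
    by_contra hn
    obtain ⟨k, hk, hku, e⟩ := hfresh u (by omega) hn
    have := hmin k (.step hA hk (by rwa [e])) (by rwa [e])
    omega
  have hu := hop _ h1.1 (.inl rfl)
  have hv := hop _ h1.2 (.inr rfl)
  refine ⟨A, hA, fun h3 => hnl ?_, hu, hv⟩
  rw [h.cls_eq_add hA.fresh h3]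
  exact hu.add hv

end Live

namespace IsRun

variable {n d m o : ℕ} {g : ℕ → NGate} {w w' : ℕ → Vec} {T : (ℕ → ZMod 2) → ℕ → ZMod 2}

/-- Besides the gate `A`, some gate produces or reads the class `p`. -/
def Shared (n m : ℕ) (g : ℕ → NGate) (w : ℕ → Vec) (A : ℕ) (p : (ℕ → ZMod 2) → ZMod 2) : Prop :=
  ∃ k, Fresh n m w k ∧ (cls (w (n + k)) = p ∨ k ≠ A ∧ Reads g w k p)

/-- The three classes p, A, B always go. The fourth comes from the second use of p: an operand of
its producer, another reader, or, if that reader is B, a gate reading B. Rank is the position of the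
first wire of the class. -/
theorem drop_of_shared (h : IsRun n d m g w) (h' : IsRun n d m g w') (ho : o < n + m)
    (hT : ∀ i < n + m, cls (w' i) = push T (cls (w i))) {A B : ℕ} (hA : Fresh n m w A)
    (hB : Live n m g w o B) (hBA : Reads g w B (cls (w (n + A)))) {p : (ℕ → ZMod 2) → ZMod 2}
    (hp : Reads g w A p) (hlin : Lin d p) (kp : push T p = 0)
    (ka : push T (cls (w (n + A))) = 0) (hs : Shared n m g w A p) :
    cls (w' o) = 0 ∨ (classes n m g w').ncard + 4 ≤ (classes n m g w).ncard := by
  have hAB : n + A < n + B := by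
    have h1 := h.lt B hB.fresh.1
    rcases hBA with e | e
    · exact (hA.le_of_cls_eq e).trans_lt h1.1
    · exact (hA.le_of_cls_eq e).trans_lt h1.2
  have hpw : ∃ j < n + A, cls (w j) = p := by
    have h1 := h.lt A hA.1
    rcases hp with e | e
    · exact ⟨_, h1.1, e⟩
    · exact ⟨_, h1.2, e⟩
  have hrk : ∀ r < n + B, Reads g w B (cls (w r)) →
      firstWire w (cls (w r)) < firstWire w (cls (w (n + B))) := by
    intro r hr _
    rw [hB.fresh.firstWire_eq]
    exact (firstWire_le w r).trans_lt hr
  have h0 := h'.zero_notMem_classes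
  have hread : ∀ {k κ}, Fresh n m w k → Reads g w k κ → push T κ = 0 →
      push T (cls (w (n + k))) ∈ classes n m g w' → ∃ κ' ∈ classes n m g w,
        firstWire w κ' < firstWire w (cls (w (n + k))) ∧ push T κ' = push T (cls (w (n + k))) := by
    intro k κ hk hr hκ hmem
    obtain ⟨r, hr, hrr, -, e⟩ := h.collapse h' hT hk hr hκ
    rcases e with e | e
    · rw [e] at hmem
      exact absurd hmem h0
    · refine ⟨_, ⟨k, hk, .inl hrr⟩, ?_, e.symm⟩
      rw [hk.firstWire_eq]
      exact (firstWire_le w r).trans_lt hr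
  obtain ⟨k, hk, hc⟩ := hs
  rcases hc with hc | ⟨hkA, hc⟩
  · right
    obtain ⟨j, hj, hjp⟩ := hpw
    have h1 := h.lt k hk.1
    have hkj : n + k ≤ j := hk.le_of_cls_eq (hjp.trans hc.symm)
    -- A fresh gate of linear class brings in no variable of its own. So p is the sum of the two
    -- operand classes of gate k, and these merge when p becomes constant.
    have h3 : (g k).1.2.2.2 = 0 := by
      by_contra h3
      refine h.not_lin hk h3 ?_
      rwa [hc]
    have hsum := h.cls_eq_add hk h3
    have hpush : push T (cls (w (g k).2.1)) = push T (cls (w (g k).2.2)) := by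
      rw [← fun_add_eq_zero, ← push_add, ← hsum, hc, kp]
    have hd := h.not_deg hk
    simp only [Deg, not_or] at hd
    have hy : ∀ u < n + k, Reads g w k (cls (w u)) →
        (∃ κ ∈ classes n m g w, firstWire w κ < firstWire w (cls (w u)) ∧
          push T κ = push T (cls (w u))) →
        (classes n m g w').ncard + 4 ≤ (classes n m g w).ncard := by
      intro u hu hr hex
      refine h.ncard_classes_add_four_le h' hT hA hB.fresh hBA hp kp ka (firstWire w)
        (y := cls (w u)) ⟨k, hk, .inl hr⟩ ?_ (hA.2.2 u (by omega)) (hB.fresh.2.2 u (by omega)) hrk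
        fun _ => hex
      rw [← hc]
      exact hk.2.2 u hu
    -- The operand class that appears later is the fourth class; it is merged with the earlier one.
    rcases lt_trichotomy (firstWire w (cls (w (g k).2.1))) (firstWire w (cls (w (g k).2.2)))
      with hlt | heq | hlt
    · exact hy _ h1.2 (.inr rfl) ⟨_, ⟨k, hk, .inl (.inl rfl)⟩, hlt, hpush⟩
    · refine absurd ?_ hd.2.2
      rw [← cls_firstWire w (g k).2.1, heq, cls_firstWire]
    · exact hy _ h1.1 (.inl rfl) ⟨_, ⟨k, hk, .inl (.inr rfl)⟩, hlt, hpush.symm⟩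
  · by_cases hkB : k = B
    · subst hkB
      -- Here `B` reads both p and A, and both are constant after the restriction, so `B` is
      -- constant too.
      have hb0 : push T (cls (w (n + k))) = 0 := by
        obtain ⟨r, hr, hrr, hne, e⟩ := h.collapse h' hT hB.fresh hBA ka
        have hrp : cls (w r) = p := by
          obtain ⟨j, hj, hjp⟩ := hpw
          have hpa : p ≠ cls (w (n + A)) := hjp ▸ hA.2.2 j hj
          have hd := h.not_deg hB.fresh
          simp only [Deg, not_or] at hd
          rcases hBA with h1 | h1 <;> rcases hc with h2 | h2 <;> rcases hrr with h3 | h3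
          · exact absurd (h2.symm.trans h1) hpa
          · exact absurd (h2.symm.trans h1) hpa
          · exact absurd (h3.symm.trans h1) hne
          · exact h3.symm.trans h2
          · exact h3.symm.trans h2
          · exact absurd (h3.symm.trans h1) hne
          · exact absurd (h2.symm.trans h1) hpa
          · exact absurd (h2.symm.trans h1) hpa
        rcases e with e | e
        · exact e
        · rw [e, hrp, kp]
      -- Either the output has become constant with `B`, or liveness supplies a gate `E` that reads
      -- `B` and collapses.
      by_cases hbo : cls (w (n + k)) = cls (w o)
      · left
        rw [hT o ho, ← hbo, hb0]
      · right
        obtain ⟨E, hE, hEB⟩ := hB.exists_reader hbo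
        have hBE : n + k < n + E := by
          have h1 := h.lt E hE.fresh.1
          rcases hEB with e | e
          · exact (hB.fresh.le_of_cls_eq e).trans_lt h1.1
          · exact (hB.fresh.le_of_cls_eq e).trans_lt h1.2
        obtain ⟨j, hj, hjp⟩ := hpw
        refine h.ncard_classes_add_four_le h' hT hA hB.fresh hBA hp kp ka (firstWire w)
          (y := cls (w (n + E))) ⟨E, hE.fresh, .inr rfl⟩ ?_ (hE.fresh.2.2 _ (by omega)).symm
          (hE.fresh.2.2 _ hBE).symm hrk (hread hE.fresh hEB hb0)
        rw [← hjp]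
        exact (hE.fresh.2.2 j (by omega)).symm
    · right
      exact h.ncard_classes_add_four_le h' hT hA hB.fresh hBA hp kp ka (firstWire w)
        (y := cls (w (n + k))) ⟨k, hk, .inr rfl⟩ (h.cls_ne_of_reads hk hc)
        (fun e => hkA (hA.eq_of_cls_eq hk e)) (fun e => hkB (hB.fresh.eq_of_cls_eq hk e)) hrk
        (hread hk hc kp)

/-- The class q is used by A alone. When A becomes constant, the image of q stays in use only if a
different class already in use has the same image. -/
theorem drop_of_not_shared (h : IsRun n d m g w) (h' : IsRun n d m g w')
    (hT : ∀ i < n + m, cls (w' i) = push T (cls (w i))) {A B : ℕ} (hA : Fresh n m w A)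
    (hB : Fresh n m w B) (hBA : Reads g w B (cls (w (n + A)))) {p q : (ℕ → ZMod 2) → ZMod 2}
    (hp : Reads g w A p) (hq : Reads g w A q) (hpq : p ≠ q) (kp : push T p = 0)
    (ka : push T (cls (w (n + A))) = 0) (hs : ¬ Shared n m g w A q) :
    (classes n m g w').ncard + 4 ≤ (classes n m g w).ncard := by
  classical
  have hs1 : ∀ k, Fresh n m w k → cls (w (n + k)) ≠ q := fun k hk e => hs ⟨k, hk, .inl e⟩
  have hs2 : ∀ k, Fresh n m w k → Reads g w k q → k = A := by
    intro k hk hr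
    by_contra hne
    exact hs ⟨k, hk, .inr ⟨hne, hr⟩⟩
  have hAB : A ≠ B := by
    rintro rfl
    exact h.cls_ne_of_reads hA hBA rfl
  -- The class q gets rank n + m, above every wire position, so any class merged with q may replace
  -- it.
  refine h.ncard_classes_add_four_le h' hT hA hB hBA hp kp ka
    (fun κ => if κ = q then n + m else firstWire w κ) (y := q) ⟨A, hA, .inl hq⟩ hpq.symm
    (hs1 A hA).symm (hs1 B hB).symm ?_ ?_
  · intro r hr hrr
    rw [if_neg (fun e : cls (w r) = q => hAB (hs2 B hB (e ▸ hrr)).symm), if_neg (hs1 B hB), hB.firstWire_eq]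
    exact (firstWire_le w r).trans_lt hr
  · intro hmem
    obtain ⟨k, hk, i, hi, e, hr⟩ := h.exists_wire_of_mem_classes hT hmem
    have hkw := fresh_of_push hT hk
    have hne : cls (w i) ≠ q := by
      rintro rfl
      rcases hr with hr | rfl
      · have := hs2 k hkw hr
        subst this
        have hkm := hk.1
        exact hk.2.1 (by rw [hT _ (by omega), ka])
      · exact hs1 k hkw rfl
    refine ⟨cls (w i), ⟨k, hkw, ?_⟩, ?_, e⟩
    · rcases hr with hr | rfl
      · exact .inl hr
      · exact .inr rfl
    · rw [if_neg hne, if_pos rfl]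
      exact (firstWire_le w i).trans_lt hi

theorem cls_eq_push {T : (ℕ → ZMod 2) → ℕ → ZMod 2} (hT : ∀ i < n + m, ∀ t, ev (w' i) t = ev (w i) (T t)) :
    ∀ i < n + m, cls (w' i) = push T (cls (w i)) := by
  intro i hi
  funext t
  simp only [cls, push, hT i hi]
  generalize ev (w i) (T t) = x
  generalize ev (w i) (T 0) = y
  generalize ev (w i) 0 = z
  revert x y z
  decide

/-- There is a wire with a linear form, and a value for it, such that fixing it makes the output
constant or removes four classes. -/
theorem exists_good_wire (h : IsRun n d m g w) (ho : o < n + m) (hne : cls (w o) ≠ 0) :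
    ∃ j < n + m, Lin d (cls (w j)) ∧ cls (w j) ≠ 0 ∧ ∃ c : ZMod 2,
      ∀ (w' : ℕ → Vec) (T : (ℕ → ZMod 2) → ℕ → ZMod 2), IsRun n d m g w' →
      (∀ i < n + m, ∀ t, ev (w' i) t = ev (w i) (T t)) → (∀ t, ev (w' j) t = c) →
      cls (w' o) = 0 ∨ (classes n m g w').ncard + 4 ≤ (classes n m g w).ncard := by
  by_cases hl : Lin d (cls (w o))
  · exact ⟨o, ho, hl, hne, 0, fun w' T _ _ hc => .inl (cls_eq_zero_iff.2 fun t => by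
      rw [hc, hc])⟩
  obtain ⟨A, hA, h3, hu, hv⟩ := Live.exists_first h ho hl
  have h1 := h.lt A hA.fresh.1
  have hAm := hA.fresh.1
  have hd := h.not_deg hA.fresh
  simp only [Deg, not_or] at hd
  have h3' : (g A).1.2.2.2 = 1 := (bit_cases _).resolve_left h3
  -- With c₃ = 1 and the first operand equal to c₂, the terms c₂y and c₃xy cancel. Symmetrically,
  -- the second operand is set to c₁ below.
  have hua : ∀ w', IsRun n d m g w' → (∀ t, ev (w' (g A).2.1) t = (g A).1.2.2.1) →
      cls (w' (n + A)) = 0 := by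
    intro w' h' hc
    rw [cls_eq_zero_iff]
    intro t
    have hdeg : Deg (w' (g A).2.1) (w' (g A).2.2) := .inl (cls_eq_zero_iff.2 fun t => by rw [hc, hc])
    have key : ∀ c0 c1 c2 y y' : ZMod 2, c0 + c1 * c2 + c2 * y + 1 * (c2 * y) =
      c0 + c1 * c2 + c2 * y' + 1 * (c2 * y') := by decide
    rw [h'.ev_gate hAm, h'.ev_gate hAm, ev_mulForm_of_deg hdeg, ev_mulForm_of_deg hdeg, hc, hc, h3']
    exact key _ _ _ _ _
  have hva : ∀ w', IsRun n d m g w' → (∀ t, ev (w' (g A).2.2) t = (g A).1.2.1) →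
      cls (w' (n + A)) = 0 := by
    intro w' h' hc
    rw [cls_eq_zero_iff]
    intro t
    have hdeg : Deg (w' (g A).2.1) (w' (g A).2.2) :=
      .inr (.inl (cls_eq_zero_iff.2 fun t => by rw [hc, hc]))
    have key : ∀ c0 c1 c2 y y' : ZMod 2, c0 + c1 * y + c2 * c1 + 1 * (y * c1) =
      c0 + c1 * y' + c2 * c1 + 1 * (y' * c1) := by decide
    rw [h'.ev_gate hAm, h'.ev_gate hAm, ev_mulForm_of_deg hdeg, ev_mulForm_of_deg hdeg, hc, hc, h3']
    exact key _ _ _ _ _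
  have hconst : ∀ {w' : ℕ → Vec} {j : ℕ} {c : ZMod 2}, (∀ t, ev (w' j) t = c) → cls (w' j) = 0 :=
    fun hc => cls_eq_zero_iff.2 fun t => by rw [hc, hc]
  by_cases hao : cls (w (n + A)) = cls (w o)
  · refine ⟨_, by omega, hu, hd.1, (g A).1.2.2.1, fun w' T h' hT hc => .inl ?_⟩
    have hT' := cls_eq_push hT
    rw [hT' o ho, ← hao, ← hT' _ (by omega)]
    exact hua w' h' hc
  obtain ⟨B, hB, hBA⟩ := hA.exists_reader hao
  -- Sharing decides which operand is fixed: the second one if its class is shared, otherwise the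
  -- first, so that the second loses its only use.
  by_cases hs : Shared n m g w A (cls (w (g A).2.2))
  · refine ⟨_, by omega, hv, hd.2.1, (g A).1.2.1, fun w' T h' hT hc => ?_⟩
    have hT' := cls_eq_push hT
    exact h.drop_of_shared h' ho hT' hA.fresh hB hBA (.inr rfl) hv
      (by rw [← hT' _ (by omega)]; exact hconst hc)
      (by rw [← hT' _ (by omega)]; exact hva w' h' hc) hs
  · refine ⟨_, by omega, hu, hd.1, (g A).1.2.2.1, fun w' T h' hT hc => ?_⟩
    have hT' := cls_eq_push hT
    exact .inr (h.drop_of_not_shared h' hT' hA.fresh hB.fresh hBA (.inl rfl) (.inr rfl) hd.2.2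
      (by rw [← hT' _ (by omega)]; exact hconst hc)
      (by rw [← hT' _ (by omega)]; exact hua w' h' hc) hs)

end IsRun
end GateElim

/-! ### Correctness of the symbolic run, of restrictions and of the greedy loop. -/

namespace GateElim

/-! ### What the run of a net computes -/

theorem isConst_eq_false {v : Vec} (h : cls v ≠ 0) : isConst v = false := by
  rw [← Bool.not_eq_true, isConst_iff]
  exact h

/-- The gate at a position of a net. -/
def gateAt (gs : List NGate) (k : ℕ) : NGate := gs.getD k ((0, 0, 0, 0), 0, 0)

/-- The forms at the wires. -/
def wires (c : Net) (rows : List Vec) (i : ℕ) : Vec := (runGates c rows).1.getD i []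

/-- A net on `n` inputs in topological order, for rows in `d` variables. -/
structure GoodNet (n d : ℕ) (c : Net) : Prop where
  zeros : c.2.2 = List.replicate (d + 1) 0
  lt : ∀ k < c.1.length, (gateAt c.1 k).2.1 < n + k ∧ (gateAt c.1 k).2.2 < n + k
  out : c.2.1 < n + c.1.length

/-- A list of `n` forms in `d` variables. -/
structure GoodRows (n d : ℕ) (rows : List Vec) : Prop where
  length : rows.length = n
  row : ∀ i < n, (rows.getD i []).length = d + 1

theorem getD_mem {α : Type} {l : List α} {i : ℕ} (d : α) (h : i < l.length) : l.getD i d ∈ l := by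
  rw [List.getD_eq_getElem _ _ h]
  exact List.getElem_mem h

theorem exists_getD_of_mem {α : Type} {l : List α} {a : α} (d : α) (h : a ∈ l) :
    ∃ i < l.length, l.getD i d = a := by
  obtain ⟨i, hi, rfl⟩ := List.mem_iff_getElem.1 h
  exact ⟨i, hi, List.getD_eq_getElem _ _ hi⟩

theorem insertClass_spec (x : Vec) {N : List Vec} (h : (N.map cls).Nodup) :
    ((insertClass x N).map cls).Nodup ∧
      ∀ κ, κ ∈ (insertClass x N).map cls ↔ κ = cls x ∨ κ ∈ N.map cls := by
  unfold insertClass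
  have h1 : N.any (fun y => equiv x y) = true ↔ cls x ∈ N.map cls := by
    simp only [List.any_eq_true, equiv_iff, List.mem_map]
    exact exists_congr fun y => and_congr_right fun _ => eq_comm
  cases hb : N.any (fun y => equiv x y) with
  | true =>
    rw [cond_true]
    refine ⟨h, fun κ => ⟨.inr, ?_⟩⟩
    rintro (rfl | h2)
    · exact h1.1 hb
    · exact h2
  | false =>
    rw [cond_false, List.map_cons, List.nodup_cons]
    exact ⟨⟨fun h2 => by rw [h1.2 h2] at hb; exact Bool.noConfusion hb, h⟩, fun κ => List.mem_cons⟩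

theorem Fresh.congr {n m : ℕ} {w w' : ℕ → Vec} (h : ∀ i < n + m, w i = w' i) {k : ℕ} :
    Fresh n m w k ↔ Fresh n m w' k := by
  unfold Fresh
  refine and_congr_right fun hk => ?_
  rw [h (n + k) (by omega)]
  refine and_congr_right fun _ => forall_congr' fun j => forall_congr' fun hj => ?_
  rw [h j (by omega)]

theorem Fresh.succ_iff {n m : ℕ} {w : ℕ → Vec} {k : ℕ} :
    Fresh n (m + 1) w k ↔ Fresh n m w k ∨
      k = m ∧ cls (w (n + m)) ≠ 0 ∧ ∀ j < n + m, cls (w j) ≠ cls (w (n + m)) := by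
  unfold Fresh
  constructor
  · rintro ⟨h1, h2⟩
    rcases Nat.lt_succ_iff_lt_or_eq.1 h1 with h | rfl
    · exact .inl ⟨h, h2⟩
    · exact .inr ⟨rfl, h2⟩
  · rintro (⟨h1, h2⟩ | ⟨rfl, h2⟩)
    · exact ⟨by omega, h2⟩
    · exact ⟨by omega, h2⟩

theorem classes_congr {n m : ℕ} {g g' : ℕ → NGate} {w w' : ℕ → Vec} (hw : ∀ i < n + m, w i = w' i)
    (hg : ∀ k < m, g k = g' k) (hlt : ∀ k < m, (g k).2.1 < n + k ∧ (g k).2.2 < n + k) :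
    classes n m g w = classes n m g' w' := by
  ext κ
  refine exists_congr fun k => ?_
  rw [Fresh.congr hw]
  refine and_congr_right fun hk => ?_
  have hkm := hk.1
  have h1 := hlt k hkm
  unfold Reads
  rw [← hg k hkm, hw _ (by omega), hw _ (by omega), hw (n + k) (by omega)]

/-- Appending a gate alters no earlier wire. The classes in use stay the same if the gate is not
fresh, and otherwise gain those of the gate and its operands. The recorded list has no repeated
class, so its length is the true count. -/
theorem run_spec {n d : ℕ} {rows : List Vec} (hr : GoodRows n d rows) (gs : List NGate)
    (hlt : ∀ k < gs.length, (gateAt gs k).2.1 < n + k ∧ (gateAt gs k).2.2 < n + k) :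
    ∃ ws N, gs.foldl stepGate (rows, List.replicate (d + 1) 0, []) =
        (ws, List.replicate (d + gs.length + 1) 0, N) ∧
      ws.length = n + gs.length ∧ (∀ i < n, ws.getD i [] = rows.getD i []) ∧
      IsRun n d gs.length (gateAt gs) (fun i => ws.getD i []) ∧ (N.map cls).Nodup ∧
      ∀ κ, κ ∈ N.map cls ↔ κ ∈ classes n gs.length (gateAt gs) (fun i => ws.getD i []) := by
  induction gs using List.reverseRecOn with
  | nil =>
    refine ⟨rows, [], rfl, hr.length, fun _ _ => rfl, ⟨fun k hk => absurd hk (by simp), hr.row,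
      fun k hk => absurd hk (by simp)⟩, List.nodup_nil, fun κ => ?_⟩
    simp [classes, Fresh]
  | append_singleton gs g ih =>
    set m := gs.length with hm
    have hg : ∀ k < m, gateAt gs k = gateAt (gs ++ [g]) k := fun k hk =>
      (List.getD_append _ _ _ _ hk).symm
    have hgm : gateAt (gs ++ [g]) m = g := by
      unfold gateAt
      rw [List.getD_append_right _ _ _ _ (by omega)]
      simp [hm]
    have hlen : (gs ++ [g]).length = m + 1 := by simp [hm]
    rw [hlen] at hlt ⊢
    obtain ⟨ws, N, hs, h1, h2, h3, h4, h5⟩ := ih fun k hk => by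
      rw [hg k hk]; exact hlt k (by omega)
    have hltm := hlt m (by omega)
    rw [hgm] at hltm
    set r := gateForm (List.replicate (d + m + 1) 0 ++ [1]) g.1 (ws.getD g.2.1 [])
      (ws.getD g.2.2 []) with hrdef
    have hw : ∀ i < n + m, ws.getD i [] = (ws ++ [r]).getD i [] := fun i hi =>
      (List.getD_append _ _ _ _ (by omega)).symm
    have hwr : (ws ++ [r]).getD (n + m) [] = r := by
      rw [List.getD_append_right _ _ _ _ (by omega)]
      simp [h1]
    rw [List.foldl_append, hs]
    refine ⟨ws ++ [r], bif isConst r || ws.any (fun y => equiv r y) then N else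
      insertClass (ws.getD g.2.1 []) (insertClass (ws.getD g.2.2 []) (insertClass r N)),
      rfl, by simp [h1]; omega, ?_, ?_, ?_⟩
    · intro i hi
      rw [← hw i (by omega), h2 i hi]
    · refine ⟨hlt, fun i hi => ?_, fun k hk => ?_⟩
      · rw [← hw i (by omega)]
        exact h3.row i hi
      · have hk' := hlt k hk
        rcases Nat.lt_succ_iff_lt_or_eq.1 hk with h | rfl
        · rw [← hw _ (by omega), ← hw _ (by omega), ← hw _ (by omega), ← hg k h]
          exact h3.gate k h
        · rw [hgm] at hk' ⊢
          rw [hwr, ← hw _ (by omega), ← hw _ (by omega)]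
    · have hcong : classes n m (gateAt gs) (fun i => ws.getD i []) =
          classes n m (gateAt (gs ++ [g])) (fun i => (ws ++ [r]).getD i []) :=
        classes_congr hw hg h3.lt
      have htest : (isConst r || ws.any (fun y => equiv r y)) = false ↔
          cls r ≠ 0 ∧ ∀ j < n + m, cls (ws.getD j []) ≠ cls r := by
        rw [Bool.or_eq_false_iff, ← Bool.not_eq_true, isConst_iff, List.any_eq_false]
        refine and_congr_right fun _ => ⟨fun h j hj e => ?_, fun h y hy e => ?_⟩
        · exact h _ (getD_mem [] (by omega)) (equiv_iff.2 e.symm)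
        · obtain ⟨j, hj, rfl⟩ := exists_getD_of_mem [] hy
          exact h j (by omega) (equiv_iff.1 e).symm
      rw [hcong] at h5
      cases hb : isConst r || ws.any (fun y => equiv r y) with
      | true =>
        rw [cond_true]
        refine ⟨h4, fun κ => (h5 κ).trans (exists_congr fun k => and_congr_left fun _ => ?_)⟩
        rw [Fresh.succ_iff]
        refine ⟨.inl, fun h => h.resolve_right ?_⟩
        rintro ⟨-, h6, h7⟩
        have := htest.2 ⟨by rwa [hwr] at h6, fun j hj => by
          have := h7 j hj
          rwa [hwr, ← hw j hj] at this⟩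
        rw [this] at hb
        cases hb
      | false =>
        rw [cond_false]
        obtain ⟨a1, b1⟩ := insertClass_spec r h4
        obtain ⟨a2, b2⟩ := insertClass_spec (ws.getD g.2.2 []) a1
        obtain ⟨a3, b3⟩ := insertClass_spec (ws.getD g.2.1 []) a2
        refine ⟨a3, fun κ => ?_⟩
        obtain ⟨h6, h7⟩ := htest.1 hb
        rw [b3, b2, b1, h5]
        have hfr : ∀ k, Fresh n (m + 1) (fun i => (ws ++ [r]).getD i []) k ↔
            Fresh n m (fun i => (ws ++ [r]).getD i []) k ∨ k = m := by
          intro k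
          rw [Fresh.succ_iff]
          refine or_congr_right (and_iff_left ?_)
          rw [hwr]
          exact ⟨h6, fun j hj => by rw [← hw j hj]; exact h7 j hj⟩
        have hnew : (Reads (gateAt (gs ++ [g])) (fun i => (ws ++ [r]).getD i []) m κ ∨
            cls ((ws ++ [r]).getD (n + m) []) = κ) ↔
            κ = cls (ws.getD g.2.1 []) ∨ κ = cls (ws.getD g.2.2 []) ∨ κ = cls r := by
          unfold Reads
          dsimp only
          rw [hgm, hwr, ← hw _ hltm.1, ← hw _ hltm.2, or_assoc, eq_comm (b := κ), eq_comm (b := κ),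
            eq_comm (b := κ)]
        constructor
        · intro h
          have hnew' : ∀ h' : κ = cls (ws.getD g.2.1 []) ∨ κ = cls (ws.getD g.2.2 []) ∨ κ = cls r,
              κ ∈ classes n (m + 1) (gateAt (gs ++ [g])) (fun i => (ws ++ [r]).getD i []) :=
            fun h' => ⟨m, (hfr m).2 (.inr rfl), hnew.2 h'⟩
          rcases h with h | h | h | ⟨k, hk, hc⟩
          · exact hnew' (.inl h)
          · exact hnew' (.inr (.inl h))
          · exact hnew' (.inr (.inr h))
          · exact ⟨k, (hfr k).2 (.inl hk), hc⟩
        · rintro ⟨k, hk, hc⟩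
          rcases (hfr k).1 hk with hk | rfl
          · exact .inr (.inr (.inr ⟨k, hk, hc⟩))
          · rcases hnew.1 hc with h | h | h
            · exact .inl h
            · exact .inr (.inl h)
            · exact .inr (.inr (.inl h))

section
variable {n d : ℕ} {c : Net} {rows : List Vec}

theorem GoodNet.runGates_eq (hc : GoodNet n d c) (hr : GoodRows n d rows) :
    ∃ ws N, runGates c rows = (ws, List.replicate (d + c.1.length + 1) 0, N) ∧
      ws.length = n + c.1.length ∧ (∀ i < n, ws.getD i [] = rows.getD i []) ∧
      IsRun n d c.1.length (gateAt c.1) (fun i => ws.getD i []) ∧ (N.map cls).Nodup ∧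
      ∀ κ, κ ∈ N.map cls ↔ κ ∈ classes n c.1.length (gateAt c.1) (fun i => ws.getD i []) := by
  unfold runGates
  rw [hc.zeros]
  exact run_spec hr c.1 hc.lt

theorem GoodNet.isRun (hc : GoodNet n d c) (hr : GoodRows n d rows) :
    IsRun n d c.1.length (gateAt c.1) (wires c rows) := by
  obtain ⟨ws, N, h, -, -, h1, -⟩ := hc.runGates_eq hr
  unfold wires
  rw [h]
  exact h1

theorem GoodNet.wires_input (hc : GoodNet n d c) (hr : GoodRows n d rows) {i : ℕ} (hi : i < n) :
    wires c rows i = rows.getD i [] := by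
  obtain ⟨ws, N, h, -, h1, -⟩ := hc.runGates_eq hr
  unfold wires
  rw [h]
  exact h1 i hi

theorem GoodNet.length_runGates (hc : GoodNet n d c) (hr : GoodRows n d rows) :
    (runGates c rows).1.length = n + c.1.length := by
  obtain ⟨ws, N, h, h1, -⟩ := hc.runGates_eq hr
  rw [h]
  exact h1

/-- The number of classes in use. -/
noncomputable def numClasses (n : ℕ) (c : Net) (rows : List Vec) : ℕ :=
  (classes n c.1.length (gateAt c.1) (wires c rows)).ncard

theorem GoodNet.key_eq (hc : GoodNet n d c) (hr : GoodRows n d rows) :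
    (cls (wires c rows c.2.1) = 0 → key c rows = 0) ∧
      (cls (wires c rows c.2.1) ≠ 0 → key c rows = numClasses n c rows + 1) := by
  obtain ⟨ws, N, h, -, -, -, h1, h2⟩ := hc.runGates_eq hr
  unfold key numClasses wires
  rw [h]
  dsimp only
  refine ⟨fun h => by rw [isConst_iff.2 h, cond_true], fun h => ?_⟩
  rw [isConst_eq_false h, cond_false]
  classical
  have : classes n c.1.length (gateAt c.1) (fun i => ws.getD i []) = (N.map cls).toFinset := by
    ext κ
    simp only [List.coe_toFinset, Set.mem_ofPred_eq]
    exact (h2 κ).symm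
  rw [this, Set.ncard_coe_finset, List.toFinset_card_of_nodup h1, List.length_map]

end

/-! ### Restricting an affine space -/

theorem getD_smul_eq_zero {b : ZMod 2} {v : Vec} {i : ℕ} (h : v.getD i 0 = 0) :
    (smul b v).getD i 0 = 0 := by
  unfold smul
  cases b == 0
  · exact h
  · rfl

theorem getD_gateForm_eq_zero {z p q : Vec} {c : Coeffs} {i : ℕ} (hz : z.getD (i + 1) 0 = 0)
    (hp : p.getD (i + 1) 0 = 0) (hq : q.getD (i + 1) 0 = 0) :
    (gateForm z c p q).getD (i + 1) 0 = 0 := by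
  have hm : (mulForm z p q).getD (i + 1) 0 = 0 := by
    unfold mulForm
    cases isConst p <;> cases isConst q <;> cases equiv p q <;>
      simp only [cond_true, cond_false] <;>
      first | exact hz | exact getD_smul_eq_zero hp | exact getD_smul_eq_zero hq
  rw [gateForm, getD_vadd, getD_vadd, getD_vadd, getD_smul_eq_zero hp, getD_smul_eq_zero hq,
    getD_smul_eq_zero hm]
  simp

/-- A variable that does not occur in the inputs does not occur anywhere. -/
theorem IsRun.getD_eq_zero {n d m : ℕ} {g : ℕ → NGate} {w : ℕ → Vec} (h : IsRun n d m g w) {j : ℕ}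
    (hj : j < d) (h0 : ∀ i < n, (w i).getD (j + 1) 0 = 0) :
    ∀ i < n + m, (w i).getD (j + 1) 0 = 0 := by
  intro i
  induction i using Nat.strong_induction_on with
  | _ i ih =>
    intro hi
    rcases wire_cases hi with h' | ⟨k, hk, rfl⟩
    · exact h0 i h'
    · have h1 := h.lt k hk
      rw [h.gate k hk]
      refine getD_gateForm_eq_zero ?_ (ih _ h1.1 (by omega)) (ih _ h1.2 (by omega))
      rw [List.getD_append _ _ _ _ (by simp; omega), List.getD_replicate _ (by omega)]

theorem getD_pivot {v : Vec} (h : cls v ≠ 0) : v.getD (pivot v + 1) 0 = 1 := by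
  have h1 : isConst v = false := isConst_eq_false h
  cases v with
  | nil => simp [isConst] at h1
  | cons b v =>
    simp only [isConst, List.tail_cons, Bool.not_eq_false'] at h1
    rw [List.getD_cons_succ, pivot, List.tail_cons]
    clear h
    induction v with
    | nil => simp at h1
    | cons a v ih =>
      rcases bit_cases a with rfl | rfl
      · have : (List.any v fun b => !(b == 0)) = true := by simpa using h1
        simpa using ih this
      · rfl

theorem getD_restrictRow {v row : Vec} {b : ZMod 2} {i : ℕ} (hi : i < row.length) :
    (restrictRow v b row).getD i 0 =
      row.getD i 0 + row.getD (pivot v + 1) 0 * (vadd v [b]).getD i 0 := by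
  have h1 : row.tail.getD (pivot v) 0 = row.getD (pivot v + 1) 0 := by cases row <;> rfl
  unfold restrictRow
  rw [h1]
  rcases bit_cases (row.getD (pivot v + 1) 0) with h | h <;> rw [h]
  · simp
  · have : ((1 : ZMod 2) == 0) = false := rfl
    rw [this, cond_false, getD_zipPad, if_pos hi, one_mul]

/-- The affine form of the restriction, truncated to the first `d` variables. -/
def truncEv (d : ℕ) (v : Vec) (t : ℕ → ZMod 2) : ZMod 2 :=
  ∑ i ∈ Finset.range (d + 1), v.getD i 0 * withOne t i

theorem ev_restrictRow {d : ℕ} {v row : Vec} {b : ZMod 2} (hrow : row.length = d + 1)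
    (t : ℕ → ZMod 2) : ev (restrictRow v b row) t =
      ev row t + row.getD (pivot v + 1) 0 * truncEv d (vadd v [b]) t := by
  rw [ev, length_restrictRow, hrow, ev, hrow, truncEv, Finset.mul_sum, ← Finset.sum_add_distrib]
  refine Finset.sum_congr rfl fun i hi => ?_
  rw [getD_restrictRow (by rw [hrow]; simpa using hi)]
  ring

/-- An affine space `rows`, parametrized injectively by the variables in `J`, inside the affine
space `rows₀`. -/
structure SubSpace (n d : ℕ) (rows₀ rows : List Vec) (J : Finset ℕ) : Prop where
  good : GoodRows n d rows
  subset : J ⊆ Finset.range d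
  zero : ∀ i < n, ∀ j < d, j ∉ J → (rows.getD i []).getD (j + 1) 0 = 0
  inj : ∀ y : ℕ → ZMod 2, (∀ j, j ∉ J → y j = 0) → (∀ i < n, cls (rows.getD i []) y = 0) → y = 0
  le : ∀ y, ∃ y₀, ∀ i < n, ev (rows.getD i []) y = ev (rows₀.getD i []) y₀

section
variable {n d : ℕ} {c : Net} {rows₀ rows : List Vec} {J : Finset ℕ}

theorem getD_restrict (hr : rows.length = n) {v : Vec} (hv : cls v ≠ 0) (b : ZMod 2) {i : ℕ}
    (hi : i < n) : (restrict v b rows).getD i [] = restrictRow v b (rows.getD i []) := by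
  have h1 : isConst v = false := isConst_eq_false hv
  have hi' : i < rows.length := by omega
  unfold restrict
  rw [h1, cond_false, List.getD_eq_getElem _ _ (by simpa using hi'), List.getElem_map,
    List.getD_eq_getElem _ _ hi']

theorem GoodRows.of_shape (h : GoodRows n d rows) {rows' : List Vec}
    (e : rows'.map List.length = rows.map List.length) : GoodRows n d rows' := by
  have h0 : rows'.length = rows.length := by simpa using congrArg List.length e
  refine ⟨h0.trans h.length, fun i hi => ?_⟩
  have h1 : i < rows.length := by rw [h.length]; exact hi
  have h2 : (rows'.map List.length)[i]? = (rows.map List.length)[i]? := by rw [e]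
  rw [List.getElem?_map, List.getElem?_map, List.getElem?_eq_getElem h1,
    List.getElem?_eq_getElem (h0 ▸ h1)] at h2
  have h3 := h.row i hi
  rw [List.getD_eq_getElem _ _ h1] at h3
  rw [List.getD_eq_getElem _ _ (h0 ▸ h1), ← h3]
  simpa using h2

/-- Solving v = b for its first variable removes at most this one free variable. The form v need not
be linear: the rows only receive its part in the space variables. -/
theorem SubSpace.restrict (h : SubSpace n d rows₀ rows J) {v : Vec}
    (hv : ∀ j < d, j ∉ J → v.getD (j + 1) 0 = 0) (b : ZMod 2) :
    ∃ J', SubSpace n d rows₀ (restrict v b rows) J' ∧ J.card ≤ J'.card + 1 := by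
  by_cases hc : cls v = 0
  · refine ⟨J, ?_, by omega⟩
    rw [GateElim.restrict, isConst_iff.2 hc, cond_true]
    exact h
  have hgood := h.good.of_shape (shape_restrict v b rows)
  have hget : ∀ i < n, (GateElim.restrict v b rows).getD i [] = restrictRow v b (rows.getD i []) :=
    fun i hi => getD_restrict h.good.length hc b hi
  have hpiv := getD_pivot hc
  set π := pivot v with hπ
  -- If the first variable of v belongs to a gate, no row contains it and nothing changes.
  by_cases hπd : π < d
  swap
  · have hsame : ∀ i < n, (GateElim.restrict v b rows).getD i [] = rows.getD i [] := by
      intro i hi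
      rw [hget i hi, restrictRow]
      have h1 := h.good.row i hi
      have : (rows.getD i []).tail.getD (pivot v) 0 = 0 :=
        List.getD_eq_default _ _ (by rw [List.length_tail, h1]; omega)
      rw [this]
      rfl
    refine ⟨J, ⟨hgood, h.subset, ?_, ?_, ?_⟩, by omega⟩
    · intro i hi
      rw [hsame i hi]
      exact h.zero i hi
    · intro y hy hy'
      exact h.inj y hy fun i hi => by rw [← hsame i hi]; exact hy' i hi
    · intro y
      obtain ⟨y₀, hy₀⟩ := h.le y
      exact ⟨y₀, fun i hi => by rw [hsame i hi, hy₀ i hi]⟩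
  have hπJ : π ∈ J := by
    by_contra hn
    rw [hv π hπd hn] at hpiv
    exact absurd hpiv (by decide)
  have hvb : ∀ j, (vadd v [b]).getD (j + 1) 0 = v.getD (j + 1) 0 := by
    intro j
    rw [getD_vadd]
    simp
  refine ⟨J.erase π, ⟨hgood, (Finset.erase_subset _ _).trans h.subset, ?_, ?_, ?_⟩, ?_⟩
  · intro i hi j hj hjJ
    have hrow := h.good.row i hi
    rw [hget i hi, getD_restrictRow (by omega), hvb]
    by_cases hjπ : j = π
    · rw [hjπ, hpiv, mul_one, ← hπ, bit_add_self]
    · have hjJ' : j ∉ J := fun hm => hjJ (Finset.mem_erase.2 ⟨hjπ, hm⟩)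
      rw [h.zero i hi j hj hjJ', hv j hj hjJ', mul_zero, add_zero]
  · intro y hy hy'
    -- Modulo constants, a new row at y is the old row at y with coordinate π shifted by δ.
    -- Injectivity of the old rows kills the shifted point, and y vanishes at π because π is no
    -- longer free.
    set δ := truncEv d (vadd v [b]) y + truncEv d (vadd v [b]) 0 with hδ
    have h0 : Function.update y π (y π + δ) = 0 := by
      refine h.inj _ (fun j hj => ?_) fun i hi => ?_
      · have hjπ : j ≠ π := fun e => hj (e ▸ hπJ)
        rw [Function.update_of_ne hjπ]
        exact hy j fun hm => hj (Finset.mem_of_mem_erase hm)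
      · rw [← hy' i hi, hget i hi]
        unfold cls
        rw [ev_restrictRow (h.good.row i hi), ev_restrictRow (h.good.row i hi), ev_update, hδ,
          ← hπ]
        ring
    funext j
    by_cases hjπ : j = π
    · rw [hjπ]
      exact hy π fun hm => (Finset.mem_erase.1 hm).1 rfl
    · have := congrFun h0 j
      rwa [Function.update_of_ne hjπ] at this
  · intro y
    obtain ⟨y₀, hy₀⟩ := h.le (Function.update y π (y π + truncEv d (vadd v [b]) y))
    refine ⟨y₀, fun i hi => ?_⟩
    rw [← hy₀ i hi, hget i hi, ev_restrictRow (h.good.row i hi), ev_update]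
  · rw [Finset.card_erase_of_mem hπJ]
    omega

theorem SubSpace.best (hc : GoodNet n d c) (h : SubSpace n d rows₀ rows J) :
    ∃ J', SubSpace n d rows₀ (best c rows) J' ∧ J.card ≤ J'.card + 1 := by
  refine best_induction c rows (p := fun r => ∃ J', SubSpace n d rows₀ r J' ∧ J.card ≤ J'.card + 1)
    ⟨J, h, by omega⟩ fun v hv b => h.restrict (fun j hj hjJ => ?_) b
  obtain ⟨i, hi, rfl⟩ := exists_getD_of_mem [] hv
  rw [hc.length_runGates h.good] at hi
  refine (hc.isRun h.good).getD_eq_zero hj (fun i hi => ?_) i hi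
  rw [hc.wires_input h.good hi]
  exact h.zero i hi j hj hjJ

/-- After a restriction, the forms arise by a substitution that makes the given form constant. -/
theorem exists_subst_restrict (hc : GoodNet n d c) (hr : GoodRows n d rows) {j : ℕ}
    (hj : j < n + c.1.length) (hl : Lin d (cls (wires c rows j)))
    (h0 : cls (wires c rows j) ≠ 0) (b : ZMod 2) :
    ∃ T : (ℕ → ZMod 2) → ℕ → ZMod 2,
      (∀ i < n + c.1.length, ∀ t, ev (wires c (restrict (wires c rows j) b rows) i) t =
        ev (wires c rows i) (T t)) ∧
      ∀ t, ev (wires c (restrict (wires c rows j) b rows) j) t = b := by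
  set v := wires c rows j with hv
  have hr' := hr.of_shape (shape_restrict v b rows)
  -- On the space variables the restriction adds v + b to the pivot; as v has coefficient one there,
  -- v becomes v + (v + b) = b.
  obtain ⟨T, hT1, hT2⟩ := (hc.isRun hr).exists_subst (hc.isRun hr')
    (fun t => Function.update t (pivot v) (t (pivot v) + truncEv d (vadd v [b]) t))
    (fun i hi t => by
      rw [hc.wires_input hr hi, hc.wires_input hr' hi, getD_restrict hr.length h0 b hi,
        ev_restrictRow (hr.row i hi), ev_update])
  refine ⟨T, hT2, fun t => ?_⟩
  -- A linear form has no gate variables, so truncating it loses nothing.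
  have hcoef : ∀ i, d ≤ i → v.getD (i + 1) 0 = 0 := by
    intro i hi
    have h1 := hl (Function.update 0 i (0 + 1)) 0 fun k hk => by
      rw [Function.update_of_ne (by omega)]
    have h2 := ev_update v 0 i 1
    simp only [cls, add_left_inj] at h1
    rw [Pi.zero_apply, h1] at h2
    simpa using h2
  have htr : truncEv d (vadd v [b]) t = ev v t + b := by
    have h1 : v.length ≤ max v.length (d + 1) := le_max_left _ _
    have h2 : ev v t = ∑ i ∈ Finset.range (d + 1), v.getD i 0 * withOne t i := by
      rw [ev_eq_sum h1]
      symm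
      refine Finset.sum_subset (Finset.range_mono (le_max_right _ _)) fun i _ hi => ?_
      have hi' : d + 1 ≤ i := by simpa using hi
      obtain ⟨i, rfl⟩ : ∃ i', i = i' + 1 := ⟨i - 1, by omega⟩
      rw [hcoef i (by omega), zero_mul]
    rw [h2, truncEv, Finset.sum_range_succ', Finset.sum_range_succ' _ d]
    have h3 : ∀ i, (vadd v [b]).getD (i + 1) 0 = v.getD (i + 1) 0 := by
      intro i
      rw [getD_vadd]
      simp
    simp only [h3, getD_vadd, withOne]
    simp
    ring
  rw [hT2 j hj]
  have h4 : ev v (T t) =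
      ev v (Function.update t (pivot v) (t (pivot v) + truncEv d (vadd v [b]) t)) := by
    have := hl (T t) _ (hT1 t)
    simpa only [cls, add_left_inj] using this
  rw [← hv, h4, ev_update, getD_pivot h0, htr, one_mul, ← add_assoc, bit_add_self, zero_add]

end

/-! ### The loop -/

section
variable {n d : ℕ} {c : Net} {rows₀ rows : List Vec} {J : Finset ℕ}

theorem key_better (c : Net) (r r' : List Vec) :
    key c (better c r r') ≤ key c r ∧ key c (better c r r') ≤ key c r' := by
  unfold better
  by_cases h : key c r' < key c r
  · rw [decide_eq_true h, cond_true]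
    exact ⟨h.le, le_rfl⟩
  · rw [decide_eq_false h, cond_false]
    exact ⟨le_rfl, not_lt.1 h⟩

theorem key_best_le (c : Net) (rows : List Vec) {v : Vec} (hv : v ∈ (runGates c rows).1)
    (b : ZMod 2) : key c (best c rows) ≤ key c (restrict v b rows) := by
  unfold best
  have hmono : ∀ (l : List Vec) r, key c (l.foldl (fun r v => better c (better c r
      (restrict v 0 rows)) (restrict v 1 rows)) r) ≤ key c r := by
    intro l
    induction l with
    | nil => exact fun r => le_rfl
    | cons v l ih =>
      intro r
      exact (ih _).trans ((key_better _ _ _).1.trans (key_better _ _ _).1)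
  suffices H : ∀ (l : List Vec) r, v ∈ l → key c (l.foldl (fun r v => better c (better c r
      (restrict v 0 rows)) (restrict v 1 rows)) r) ≤ key c (restrict v b rows) from H _ _ hv
  intro l
  induction l with
  | nil => simp
  | cons u l ih =>
    intro r hu
    rcases List.mem_cons.1 hu with rfl | hu
    · refine (hmono l _).trans ?_
      rcases bit_cases b with rfl | rfl
      · exact (key_better _ _ _).1.trans (key_better _ _ _).2
      · exact (key_better _ _ _).2
    · exact ih _ hu

/-- `better` demands strict improvement, so no dimension is wasted once the output is constant. -/
theorem best_of_key_eq_zero (h : key c rows = 0) : best c rows = rows := by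
  have hb : ∀ r', better c rows r' = rows := by
    intro r'
    rw [better, h, decide_eq_false (Nat.not_lt_zero _), cond_false]
  unfold best
  suffices H : ∀ l : List Vec, l.foldl (fun r v => better c (better c r
      (restrict v 0 rows)) (restrict v 1 rows)) rows = rows from H _
  intro l
  induction l with
  | nil => rfl
  | cons u l ih => rw [List.foldl_cons, hb, hb, ih]

/-- A step makes the output constant or removes four classes. -/
theorem best_spec (hc : GoodNet n d c) (hr : GoodRows n d rows)
    (h0 : cls (wires c rows c.2.1) ≠ 0) :
    cls (wires c (best c rows) c.2.1) = 0 ∨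
      numClasses n c (best c rows) + 4 ≤ numClasses n c rows := by
  obtain ⟨j, hj, hl, hne, b, hb⟩ := (hc.isRun hr).exists_good_wire hc.out h0
  obtain ⟨T, hT, hTb⟩ := exists_subst_restrict hc hr hj hl hne b
  have hr' := hr.of_shape (shape_restrict (wires c rows j) b rows)
  have hgood := hr.of_shape (shape_best c rows)
  have hle := key_best_le c rows (v := wires c rows j)
    (getD_mem [] (by rwa [hc.length_runGates hr])) b
  by_cases hbest : cls (wires c (best c rows) c.2.1) = 0
  · exact .inl hbest
  right
  -- The round does at least as well as the good restriction. With a nonconstant result its key is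
  -- positive, which excludes that the good restriction had a constant output.
  rw [(hc.key_eq hgood).2 hbest] at hle
  rcases hb _ T (hc.isRun hr') hT hTb with h | h
  · rw [(hc.key_eq hr').1 h] at hle
    omega
  · by_cases h' : cls (wires c (restrict (wires c rows j) b rows) c.2.1) = 0
    · rw [(hc.key_eq hr').1 h'] at hle
      omega
    · rw [(hc.key_eq hr').2 h'] at hle
      exact (Nat.add_le_add_right (Nat.le_of_succ_le_succ hle) 4).trans h

/-- The list only counts rounds. A round that does not finish lowers the number of classes by four
and the dimension by at most one, which preserves both inequalities. -/
theorem solve_spec (hc : GoodNet n d c) (l : List Vec) {δ : ℕ} (h : SubSpace n d rows₀ rows J)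
    (hδ : cls (wires c rows c.2.1) = 0 ∧ δ ≤ J.card ∨
      numClasses n c rows + 4 * δ < 4 * J.card ∧ numClasses n c rows < 4 * l.length) :
    ∃ J', SubSpace n d rows₀ (solve c rows l) J' ∧ δ ≤ J'.card ∧
      cls (wires c (solve c rows l) c.2.1) = 0 := by
  induction l generalizing rows J with
  | nil =>
    rcases hδ with hδ | hδ
    · exact ⟨J, h, hδ.2, hδ.1⟩
    · exact absurd hδ.2 (by simp)
  | cons v l ih =>
    show ∃ J', SubSpace n d rows₀ (solve c (best c rows) l) J' ∧ δ ≤ J'.card ∧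
      cls (wires c (solve c (best c rows) l) c.2.1) = 0
    by_cases h0 : cls (wires c rows c.2.1) = 0
    · rw [best_of_key_eq_zero ((hc.key_eq h.good).1 h0)]
      refine ih h (.inl ⟨h0, ?_⟩)
      rcases hδ with hδ | hδ
      · exact hδ.2
      · omega
    · have hδ' := hδ.resolve_left fun h => h0 h.1
      obtain ⟨J', hJ', hcard⟩ := h.best hc
      refine ih hJ' ?_
      rw [List.length_cons] at hδ'
      rcases best_spec hc h.good h0 with h1 | h1
      -- From N + 4δ < 4|J| follows δ < |J|, so the dimension spent on making the output constant is
      -- available.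
      · exact .inl ⟨h1, by omega⟩
      · exact .inr ⟨by omega, by omega⟩

end
end GateElim

/-! ### Circuits as nets, and encodings of input and output. -/

namespace GateElim
open Enc (enc)

/-! ### Circuits as nets -/

/-- The position of a wire in the list of all wires. -/
def wireNum {n k : ℕ} : Wire n k → ℕ := Sum.elim (fun i => i) (fun j => n + j)

theorem wireNum_lt {n k : ℕ} (u : Wire n k) : wireNum u < n + k := by
  rcases u with i | j
  · exact i.isLt.trans_le (Nat.le_add_right _ _)
  · exact Nat.add_lt_add_left j.isLt n

/-- The normal form of a gate. -/
def Gate.toNGate {n k : ℕ} : Gate n k → NGate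
  | .const b => ((b, 0, 0, 0), 0, 0)
  | .unary f u => ((f 0, f 0 + f 1, 0, 0), wireNum u, wireNum u)
  | .binary f u v => ((f 0 0, f 0 0 + f 1 0, f 0 0 + f 0 1, f 0 0 + f 0 1 + f 1 0 + f 1 1),
      wireNum u, wireNum v)

/-- The entries of the representation of a gate. -/
def Gate.toData {n k : ℕ} : Gate n k → List Data
  | .const b => [encNat 0, encBit b]
  | .unary f u => [encNat 1, encBit (f 0), encBit (f 1), encWire u]
  | .binary f u v => [encNat 2, encBit (f 0 0), encBit (f 0 1), encBit (f 1 0),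
      encBit (f 1 1), encWire u, encWire v]

/-- The input of the algorithm. -/
def toInput {n m : ℕ} (C : Circuit n) (A : Matrix (Fin n) (Fin m) (ZMod 2))
    (a : Fin n → ZMod 2) : Input :=
  ((encWire C.output, List.ofFn fun k => (C.gate k).toData),
    (List.ofFn fun j => List.ofFn fun i => A i j), List.ofFn a)

theorem enc_listData (l : List Data) : enc l = encList l := by
  show encList (l.map id) = _
  rw [List.map_id]

theorem enc_ofFn {n : ℕ} (v : Fin n → ZMod 2) : enc (List.ofFn v) = encVec v := by
  show encList ((List.ofFn v).map encBit) = _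
  rw [List.map_ofFn]
  rfl

theorem enc_toInput {n m : ℕ} (C : Circuit n) (A : Matrix (Fin n) (Fin m) (ZMod 2))
    (a : Fin n → ZMod 2) : enc (toInput C A a) = encInput C A a := by
  have h1 : enc (List.ofFn fun k => (C.gate k).toData) =
      encList (List.ofFn fun k => encGate (C.gate k)) := by
    show encList ((List.ofFn fun k => (C.gate k).toData).map enc) = _
    rw [List.map_ofFn]
    congr 2
    funext k
    show enc (C.gate k).toData = _
    rw [enc_listData]
    cases C.gate k <;> rfl
  have h2 : enc (List.ofFn fun j => List.ofFn fun i => A i j) = encMatrix A := by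
    show encList ((List.ofFn fun j => List.ofFn fun i => A i j).map enc) = _
    rw [List.map_ofFn]
    congr 2
    funext j
    exact enc_ofFn _
  have h3 : enc (toInput C A a) = .cons (.cons (encWire C.output)
      (enc (List.ofFn fun k => (C.gate k).toData)))
      (.cons (enc (List.ofFn fun j => List.ofFn fun i => A i j)) (enc (List.ofFn a))) := rfl
  rw [h3, h1, h2, enc_ofFn]
  rfl

theorem toBit_encBit (b : ZMod 2) : toBit (encBit b) = b := by
  rcases bit_cases b with rfl | rfl <;> rfl

theorem length_toList_encNat (k : ℕ) : (encNat k).toList.length = k := by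
  induction k with
  | zero => rfl
  | succ k ih => exact congrArg (· + 1) ih

theorem wireIdx_encWire {n k : ℕ} (u : Wire n k) : wireIdx n (encWire u) = wireNum u := by
  rcases u with i | j
  · exact length_toList_encNat _
  · exact congrArg (n + ·) (length_toList_encNat _)

theorem normalGate_toData {n k : ℕ} (G : Gate n k) : normalGate n G.toData = G.toNGate := by
  cases G with
  | const b =>
    show ((toBit (encBit b), 0, 0, 0), 0, 0) = _
    rw [toBit_encBit]
    rfl
  | unary f u =>
    show ((toBit (encBit (f 0)), toBit (encBit (f 0)) + toBit (encBit (f 1)), 0, 0),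
      wireIdx n (encWire u), wireIdx n (encWire u)) = _
    rw [toBit_encBit, toBit_encBit, wireIdx_encWire]
    rfl
  | binary f u v =>
    show ((toBit (encBit (f 0 0)), toBit (encBit (f 0 0)) + toBit (encBit (f 1 0)),
      toBit (encBit (f 0 0)) + toBit (encBit (f 0 1)), toBit (encBit (f 0 0)) +
        toBit (encBit (f 0 1)) + toBit (encBit (f 1 0)) + toBit (encBit (f 1 1))),
      wireIdx n (encWire u), wireIdx n (encWire v)) = _
    simp only [toBit_encBit, wireIdx_encWire]
    rfl

section
variable {n m : ℕ} (C : Circuit n) (A : Matrix (Fin n) (Fin m) (ZMod 2)) (a : Fin n → ZMod 2)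

theorem inputNet_toInput : inputNet (toInput C A a) =
    (List.ofFn (fun k => (C.gate k).toNGate), wireNum C.output, List.replicate (m + 1) 0) := by
  unfold inputNet toInput
  simp only [List.length_ofFn, List.map_ofFn, wireIdx_encWire]
  refine Prod.ext (congrArg List.ofFn (funext fun k => normalGate_toData _)) (Prod.ext rfl ?_)
  rw [List.replicate_succ]
  refine congrArg (List.cons 0) ?_
  exact List.ofFn_const m (0 : ZMod 2)

/-- The circuit as a net. -/
def Circuit.net (d : ℕ) : Net :=
  (List.ofFn (fun k => (C.gate k).toNGate), wireNum C.output, List.replicate (d + 1) 0)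

theorem Circuit.length_net (d : ℕ) : (C.net d).1.length = C.numGates := List.length_ofFn

theorem Circuit.gateAt_net (d : ℕ) (k : Fin C.numGates) :
    gateAt (C.net d).1 k = (C.gate k).toNGate := by
  unfold gateAt Circuit.net
  rw [List.getD_eq_getElem _ _ (by simp)]
  simp

theorem Circuit.goodNet (hn : 0 < n) (d : ℕ) : GoodNet n d (C.net d) := by
  refine ⟨rfl, fun k hk => ?_, ?_⟩
  · rw [C.length_net] at hk
    rw [C.gateAt_net d ⟨k, hk⟩]
    cases C.gate ⟨k, hk⟩ with
    -- Constant gates are given wire 0 as dummy operands; this precedes them because there is at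
    -- least one input.
    | const b => exact ⟨by simp only [Gate.toNGate]; omega, by simp only [Gate.toNGate]; omega⟩
    | unary f u => exact ⟨wireNum_lt u, wireNum_lt u⟩
    | binary f u v => exact ⟨wireNum_lt u, wireNum_lt v⟩
  · rw [C.length_net]
    exact wireNum_lt C.output

/-! ### The number of classes is at most the measure of the circuit -/

theorem Circuit.cls_const {d : ℕ} {w : ℕ → Vec} {M : ℕ}
    (h : IsRun n d M (gateAt (C.net d).1) w) (hM : M = C.numGates) {k : Fin C.numGates} {b : ZMod 2}
    (hG : C.gate k = .const b) : cls (w (n + k)) = 0 := by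
  rw [cls_eq_zero_iff]
  intro t
  rw [h.ev_gate (hM ▸ k.isLt), h.ev_gate (hM ▸ k.isLt), C.gateAt_net, hG]
  simp [Gate.toNGate]

theorem Circuit.cls_unary {d : ℕ} {w : ℕ → Vec} {M : ℕ}
    (h : IsRun n d M (gateAt (C.net d).1) w) (hM : M = C.numGates) {k : Fin C.numGates}
    {f : ZMod 2 → ZMod 2} {u : Wire n k} (hG : C.gate k = .unary f u) :
    cls (w (n + k)) = 0 ∨ cls (w (n + k)) = cls (w (wireNum u)) := by
  refine cls_of_affine (f 0) (f 0 + f 1) fun t => ?_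
  rw [h.ev_gate (hM ▸ k.isLt), C.gateAt_net, hG]
  simp [Gate.toNGate]

/-- Follow a chain of unary gates downwards: each step keeps the class or makes it zero, and the
chain ends at a constant, a binary gate or an input that some gate reads. -/
theorem Circuit.cls_of_read {d : ℕ} {w : ℕ → Vec} {M : ℕ}
    (h : IsRun n d M (gateAt (C.net d).1) w) (hM : M = C.numGates) :
    ∀ (i : ℕ) (k : Fin C.numGates) (u : Wire n k), wireNum u = i →
      ((∃ f, C.gate k = .unary f u) ∨ (∃ f v, C.gate k = .binary f u v) ∨
        ∃ f v, C.gate k = .binary f v u) → cls (w i) = 0 ∨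
      (∃ j : Fin n, (∃ k, (C.gate k).ReadsInput j) ∧ cls (w i) = cls (w j)) ∨
      ∃ j : Fin C.numGates, (C.gate j).IsBinary ∧ cls (w i) = cls (w (n + j)) := by
  intro i
  induction i using Nat.strong_induction_on with
  | _ i ih =>
    intro k u hu hread
    rcases u with j | j
    · refine .inr (.inl ⟨j, ⟨k, ?_⟩, by rw [← hu]; rfl⟩)
      rcases hread with ⟨f, e⟩ | ⟨f, v, e⟩ | ⟨f, v, e⟩ <;> rw [e]
      · exact rfl
      · exact .inl rfl
      · exact .inr rfl
    · have hi : i = n + (⟨j, j.isLt.trans k.isLt⟩ : Fin C.numGates) := hu.symm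
      generalize (⟨j, j.isLt.trans k.isLt⟩ : Fin C.numGates) = l at hi
      clear hu hread
      subst hi
      cases hG : C.gate l with
      | const b => exact .inl (C.cls_const h hM hG)
      | unary f u =>
        rcases C.cls_unary h hM hG with e | e
        · exact .inl e
        · have := ih (wireNum u) (wireNum_lt u) l u rfl (.inl ⟨f, hG⟩)
          rwa [← e] at this
      | binary f u v => exact .inr (.inr ⟨l, by rw [hG]; trivial, rfl⟩)

/-- Constant and unary gates are never fresh. So each class in use is the class of a binary gate or
of an input that is read, and these are counted by σ and η. -/
theorem Circuit.ncard_classes_le {d : ℕ} {w : ℕ → Vec} {M : ℕ}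
    (h : IsRun n d M (gateAt (C.net d).1) w) (hM : M = C.numGates) :
    (classes n M (gateAt (C.net d).1) w).ncard ≤ C.mu := by
  have hsub : classes n M (gateAt (C.net d).1) w ⊆
      (fun k : Fin C.numGates => cls (w (n + k))) '' {k | (C.gate k).IsBinary} ∪
      (fun i : Fin n => cls (w i)) '' {i | ∃ k, (C.gate k).ReadsInput i} := by
    intro κ hκ
    have h0 : κ ≠ 0 := fun e => h.zero_notMem_classes (e ▸ hκ)
    obtain ⟨k, hk, hr⟩ := hκ
    obtain ⟨k, rfl⟩ : ∃ k' : Fin C.numGates, (k' : ℕ) = k := ⟨⟨k, hM ▸ hk.1⟩, rfl⟩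
    have huse : ∀ u : Wire n k, cls (w (wireNum u)) = κ →
        ((∃ f v, C.gate k = .binary f u v) ∨ ∃ f v, C.gate k = .binary f v u) →
        κ ∈ (fun k : Fin C.numGates => cls (w (n + k))) '' {k | (C.gate k).IsBinary} ∪
          (fun i : Fin n => cls (w i)) '' {i | ∃ k, (C.gate k).ReadsInput i} := by
      intro u hu hc
      rcases C.cls_of_read h hM _ k u rfl (.inr hc) with e | ⟨j, hj, e⟩ | ⟨j, hj, e⟩
      · exact absurd (hu.symm.trans e) h0
      · exact .inr ⟨j, hj, e.symm.trans hu⟩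
      · exact .inl ⟨j, hj, e.symm.trans hu⟩
    unfold Reads at hr
    rw [C.gateAt_net] at hr
    cases hG : C.gate k with
    | const b => exact absurd (C.cls_const h hM hG) hk.2.1
    | unary f u =>
      rcases C.cls_unary h hM hG with e | e
      · exact absurd e hk.2.1
      · exact absurd e.symm (hk.2.2 _ (wireNum_lt u))
    | binary f u v =>
      rw [hG] at hr
      rcases hr with (hr | hr) | hr
      · exact huse u hr (.inl ⟨f, v, hG⟩)
      · exact huse v hr (.inr ⟨f, u, hG⟩)
      · exact .inl ⟨k, by show (C.gate k).IsBinary; rw [hG]; trivial, hr⟩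
  refine (Set.ncard_le_ncard hsub (Set.toFinite _)).trans ((Set.ncard_union_le _ _).trans ?_)
  exact Nat.add_le_add (Set.ncard_image_le (Set.toFinite _)) (Set.ncard_image_le (Set.toFinite _))

/-! ### The forms describe the values of the circuit -/

/-- The values at all wires. -/
def Circuit.wireValue (x : Fin n → ZMod 2) (i : ℕ) : ZMod 2 :=
  if h : i < n then x ⟨i, h⟩ else
    if h : i - n < C.numGates then C.value x ⟨i - n, h⟩ else 0

theorem Circuit.wireValue_input (x : Fin n → ZMod 2) {i : ℕ} (h : i < n) :
    C.wireValue x i = x ⟨i, h⟩ := dif_pos h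

theorem Circuit.wireValue_gate (x : Fin n → ZMod 2) {k : ℕ} (h : k < C.numGates) :
    C.wireValue x (n + k) = C.value x ⟨k, h⟩ := by
  unfold Circuit.wireValue
  rw [dif_neg (by omega)]
  simp [h]

theorem Circuit.wireValue_wireNum (x : Fin n → ZMod 2) {k : ℕ} (hk : k ≤ C.numGates)
    (u : Wire n k) : C.wireValue x (wireNum u) =
      Sum.elim x (fun j : Fin k => C.value x ⟨j, j.isLt.trans_le hk⟩) u := by
  rcases u with i | j
  · exact C.wireValue_input x i.isLt
  · exact C.wireValue_gate x (j.isLt.trans_le hk)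

theorem Circuit.wireValue_eq (x : Fin n → ZMod 2) (d : ℕ) {k : ℕ} (hk : k < C.numGates) :
    C.wireValue x (n + k) = (gateAt (C.net d).1 k).1.1 +
      (gateAt (C.net d).1 k).1.2.1 * C.wireValue x (gateAt (C.net d).1 k).2.1 +
      (gateAt (C.net d).1 k).1.2.2.1 * C.wireValue x (gateAt (C.net d).1 k).2.2 +
      (gateAt (C.net d).1 k).1.2.2.2 * (C.wireValue x (gateAt (C.net d).1 k).2.1 *
        C.wireValue x (gateAt (C.net d).1 k).2.2) := by
  rw [C.wireValue_gate x hk, C.gateAt_net d ⟨k, hk⟩, Circuit.value]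
  have hw := fun u : Wire n k => C.wireValue_wireNum x hk.le u
  cases C.gate ⟨k, hk⟩ with
  | const b => simp [Gate.eval, Gate.toNGate]
  | unary f u =>
    simp only [Gate.eval, Gate.toNGate]
    rw [hw u]
    generalize Sum.elim x (fun j : Fin k => C.value x ⟨j, j.isLt.trans_le hk.le⟩) u = y
    rcases bit_cases y with rfl | rfl
    · simp
    · have : ∀ a b : ZMod 2, b = a + (a + b) * 1 + 0 * 1 + 0 * (1 * 1) := by decide
      exact this _ _
  | binary f u v =>
    simp only [Gate.eval, Gate.toNGate]
    rw [hw u, hw v]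
    generalize Sum.elim x (fun j : Fin k => C.value x ⟨j, j.isLt.trans_le hk.le⟩) u = y
    generalize Sum.elim x (fun j : Fin k => C.value x ⟨j, j.isLt.trans_le hk.le⟩) v = z
    generalize h00 : f 0 0 = a
    generalize h01 : f 0 1 = b
    generalize h10 : f 1 0 = c
    generalize h11 : f 1 1 = e
    have key : ∀ a b c e : ZMod 2,
      (a = a + (a + c) * 0 + (a + b) * 0 + (a + b + c + e) * (0 * 0)) ∧
      (b = a + (a + c) * 0 + (a + b) * 1 + (a + b + c + e) * (0 * 1)) ∧
      (c = a + (a + c) * 1 + (a + b) * 0 + (a + b + c + e) * (1 * 0)) ∧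
      (e = a + (a + c) * 1 + (a + b) * 1 + (a + b + c + e) * (1 * 1)) := by decide
    obtain ⟨k1, k2, k3, k4⟩ := key a b c e
    rcases bit_cases y with rfl | rfl <;> rcases bit_cases z with rfl | rfl
    · rw [h00]; exact k1
    · rw [h01]; exact k2
    · rw [h10]; exact k3
    · rw [h11]; exact k4

theorem Circuit.exists_eval_eq {d : ℕ} {rows : List Vec} (hn : 0 < n) (hr : GoodRows n d rows)
    (h0 : cls (wires (C.net d) rows (wireNum C.output)) = 0) :
    ∃ b, ∀ (x : Fin n → ZMod 2) (y : ℕ → ZMod 2),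
      (∀ i : Fin n, x i = ev (rows.getD i []) y) → C.eval x = b := by
  refine ⟨ev (wires (C.net d) rows (wireNum C.output)) 0, fun x y hxy => ?_⟩
  have hc := C.goodNet hn d
  have hlen := C.length_net d
  set g := gateAt (C.net d).1 with hg
  -- Give each gate variable the true product of the operand values. Then every form takes the value
  -- of its wire, and a constant output form gives a value that does not depend on the point.
  set T : Unit → ℕ → ZMod 2 := fun _ i => if i < d then y i else
    C.wireValue x (g (i - d)).2.1 * C.wireValue x (g (i - d)).2.2 with hT
  have hTd : ∀ k s, T s (d + k) = C.wireValue x (g k).2.1 * C.wireValue x (g k).2.2 := by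
    intro k s
    simp [hT]
  have := (hc.isRun hr).transfer (fun i (_ : Unit) => C.wireValue x i) T ?_ ?_ ?_
    (wireNum C.output) (by rw [hlen]; exact wireNum_lt _) ()
  · rw [← cls_eq_zero_iff.1 h0 (T ()), ← this]
    exact (C.wireValue_wireNum x le_rfl C.output).symm
  · intro i hi s
    rw [C.wireValue_input x hi, hxy, hc.wires_input hr hi]
    refine ev_congr fun j hj => ?_
    rw [hr.row i hi] at hj
    exact (if_pos (by omega)).symm
  · intro k hk s
    rw [hTd k s]
    exact C.wireValue_eq x d (hlen ▸ hk)
  · intro k hk _ _ _ s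
    exact hTd k s

end

/-! ### Input and output of the affine space -/

theorem transp_spec {k : ℕ} {l : List Vec} (h : ∀ v ∈ l, v.length = k) :
    (transp (List.replicate k []) l).length = k ∧
      ∀ i < k, (transp (List.replicate k []) l).getD i [] = l.map fun v => v.getD i 0 := by
  have hz : ∀ (v : Vec) (acc : List Vec) (i : ℕ), i < v.length →
      (zipPad (fun b w => b :: w) [] v acc).getD i [] = v.getD i 0 :: acc.getD i [] := by
    intro v
    induction v with
    | nil => simp
    | cons b v ih =>
      intro acc i hi
      cases i with
      | zero => cases acc <;> rfl
      | succ i =>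
        rw [zipPad, List.getD_cons_succ, ih _ _ (by simpa using hi)]
        cases acc <;> simp
  induction l with
  | nil =>
    refine ⟨by simp [transp], fun i hi => ?_⟩
    show (List.replicate k ([] : Vec)).getD i [] = []
    rw [List.getD_replicate _ hi]
  | cons v l ih =>
    obtain ⟨h1, h2⟩ := ih fun u hu => h u (List.mem_cons_of_mem _ hu)
    have hv := h v List.mem_cons_self
    refine ⟨?_, fun i hi => ?_⟩
    · show (zipPad _ _ _ _).length = k
      rw [length_zipPad, hv]
    · show (zipPad _ _ _ _).getD i [] = _
      rw [hz _ _ _ (by omega), List.map_cons]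
      exact congrArg _ (h2 i hi)

theorem ev_eq_of_length {r : Vec} {d : ℕ} (h : r.length = d + 1) (y : ℕ → ZMod 2) :
    ev r y = ∑ j ∈ Finset.range d, r.getD (j + 1) 0 * y j + r.getD 0 0 := by
  rw [ev, h, Finset.sum_range_succ']
  simp [withOne]

section
variable {n m : ℕ} (C : Circuit n) (A : Matrix (Fin n) (Fin m) (ZMod 2)) (a : Fin n → ZMod 2)

theorem getD_ofFn {α : Type} {k : ℕ} (f : Fin k → α) (d : α) (i : Fin k) :
    (List.ofFn f).getD i d = f i := by
  rw [List.getD_eq_getElem _ _ (by simp)]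
  simp

theorem inputRows_spec : GoodRows n m (inputRows (toInput C A a)) ∧
    (∀ i : Fin n, ((inputRows (toInput C A a)).getD i []).getD 0 0 = a i) ∧
    ∀ (i : Fin n) (j : Fin m), ((inputRows (toInput C A a)).getD i []).getD (j + 1) 0 = A i j := by
  have h1 : inputRows (toInput C A a) = transp (List.replicate n [])
      (List.ofFn a :: List.ofFn fun j => List.ofFn fun i => A i j) := by
    unfold inputRows toInput
    dsimp only
    rw [List.map_const', List.length_ofFn]
  obtain ⟨h2, h3⟩ := transp_spec (k := n)
    (l := List.ofFn a :: List.ofFn fun j => List.ofFn fun i => A i j) (by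
      intro v hv
      rcases List.mem_cons.1 hv with rfl | hv
      · simp
      · obtain ⟨j, rfl⟩ := List.mem_ofFn.1 hv
        simp)
  rw [h1]
  refine ⟨⟨h2, fun i hi => ?_⟩, fun i => ?_, fun i j => ?_⟩
  · rw [h3 i hi]
    simp
  · rw [h3 i i.isLt, List.map_cons, List.getD_cons_zero, getD_ofFn]
  · rw [h3 i i.isLt, List.map_cons, List.getD_cons_succ, List.map_ofFn, getD_ofFn]
    exact getD_ofFn _ _ _

theorem ev_inputRows (i : Fin n) (y : ℕ → ZMod 2) :
    ev ((inputRows (toInput C A a)).getD i []) y = (A *ᵥ (fun j => y j) + a) i := by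
  obtain ⟨h1, h2, h3⟩ := inputRows_spec C A a
  rw [ev_eq_of_length (h1.row i i.isLt), h2, Finset.sum_range]
  simp only [h3]
  rfl

theorem mulVec_eq_zero_of_rank (hA : A.rank = m) {y : Fin m → ZMod 2} (hy : A *ᵥ y = 0) : y = 0 := by
  have h1 := A.mulVecLin.finrank_range_add_finrank_ker
  have h2 : Module.finrank (ZMod 2) (LinearMap.range A.mulVecLin) = m := hA
  rw [h2, Module.finrank_fin_fun] at h1
  have h3 : LinearMap.ker A.mulVecLin = ⊥ := by
    rw [← Submodule.finrank_eq_zero (R := ZMod 2)]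
    omega
  have h4 : y ∈ LinearMap.ker A.mulVecLin := by
    rw [LinearMap.mem_ker, Matrix.mulVecLin_apply, hy]
  rwa [h3, Submodule.mem_bot] at h4

theorem subSpace_inputRows (hA : A.rank = m) :
    SubSpace n m (inputRows (toInput C A a)) (inputRows (toInput C A a)) (Finset.range m) := by
  refine ⟨(inputRows_spec C A a).1, subset_rfl, fun i _ j hj hn => ?_, fun y hy h0 => ?_,
    fun y => ⟨y, fun _ _ => rfl⟩⟩
  · exact absurd (Finset.mem_range.2 hj) hn
  · have h1 : A *ᵥ (fun j : Fin m => y j) = 0 := by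
      funext i
      have h2 := h0 i i.isLt
      simp only [cls, ev_inputRows] at h2
      have h3 : A *ᵥ (fun _ : Fin m => (0 : ZMod 2)) = 0 := Matrix.mulVec_zero A
      simp only [Pi.add_apply, Pi.zero_apply, h3] at h2
      rw [zero_add, add_assoc, bit_add_self, add_zero] at h2
      exact h2
    have h2 := mulVec_eq_zero_of_rank A hA h1
    funext j
    by_cases hj : j < m
    · exact congrFun h2 ⟨j, hj⟩
    · exact hy j (by simpa using hj)

end

/-- Eliminated variables leave zero columns; dropping these gives a matrix whose columns are indexed
by the free variables, and injectivity in them is full column rank. -/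
theorem exists_output {n d : ℕ} {rows₀ rows : List Vec} {J : Finset ℕ}
    (h : SubSpace n d rows₀ rows J) :
    ∃ (W : Matrix (Fin n) (Fin J.card) (ZMod 2)) (w : Fin n → ZMod 2),
      enc (toAffine (columns (List.replicate (d + 1) 0) rows)) = encAffine W w ∧
      W.rank = J.card ∧ ∀ x ∈ affineSet W w, ∃ y : ℕ → ZMod 2, ∀ i : Fin n,
        x i = ev (rows.getD i []) y := by
  set col : ℕ → Fin n → ZMod 2 := fun j i => (rows.getD i []).getD j 0 with hcol
  have hrows : ∀ v ∈ rows, v.length = d + 1 := by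
    intro v hv
    obtain ⟨i, hi, rfl⟩ := exists_getD_of_mem [] hv
    exact h.good.row i (h.good.length ▸ hi)
  have hcols : columns (List.replicate (d + 1) 0) rows =
      (List.range (d + 1)).map fun j => List.ofFn (col j) := by
    obtain ⟨h1, h2⟩ := transp_spec hrows
    unfold columns
    rw [List.map_const', List.length_replicate]
    refine List.ext_getElem (by simpa using h1) fun j hj _ => ?_
    rw [← List.getD_eq_getElem _ [] hj, h2 j (by omega), List.getElem_map, List.getElem_range]
    refine List.ext_getElem (by simp [h.good.length]) fun i hi hi' => ?_
    have hi'' : i < rows.length := by simpa using hi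
    rw [List.getElem_map, List.getElem_ofFn]
    show _ = (rows.getD i []).getD j 0
    rw [List.getD_eq_getElem rows [] hi'']
  set nz : ℕ → Bool := fun j => (List.ofFn (col (j + 1))).any (fun b => !(b == 0)) with hnz
  set idx : List ℕ := (List.range d).filter nz with hidx
  have hnodup : idx.Nodup := List.nodup_range.filter _
  have hout : toAffine (columns (List.replicate (d + 1) 0) rows) =
      (idx.map fun j => List.ofFn (col (j + 1)), List.ofFn (col 0)) := by
    rw [hcols, List.range_succ_eq_map, List.map_cons]
    unfold toAffine
    rw [List.tail_cons, List.headD_cons, List.map_map, List.filter_map]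
    rfl
  -- A zero column at a free variable j would make the unit vector at j invisible to all rows,
  -- against injectivity.
  have hmem : ∀ j, j ∈ idx ↔ j ∈ J := by
    intro j
    have hnzj : nz j = true ↔ ∃ i : Fin n, col (j + 1) i ≠ 0 := by
      simp [hnz, List.any_eq_true, List.mem_ofFn]
    rw [hidx, List.mem_filter, List.mem_range, hnzj]
    constructor
    · rintro ⟨hj, i, hi⟩
      by_contra hn
      exact hi (h.zero i i.isLt j hj hn)
    · intro hj
      have hjd : j < d := Finset.mem_range.1 (h.subset hj)
      refine ⟨hjd, ?_⟩
      by_contra! hn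
      have h1 := h.inj (Function.update 0 j (0 + 1)) (fun k hk => by
        rw [Function.update_of_ne (fun e : k = j => hk (e ▸ hj))]; rfl) fun i hi => by
          have h2 := ev_update (rows.getD i []) 0 j 1
          have h3 : (rows.getD i []).getD (j + 1) 0 = 0 := hn ⟨i, hi⟩
          rw [h3, zero_mul, add_zero] at h2
          exact bit_add_eq_zero.2 h2
      have h2 := congrFun h1 j
      rw [Function.update_self] at h2
      exact one_ne_zero ((zero_add (1 : ZMod 2)).symm.trans h2)
  have hcard : idx.length = J.card := by
    rw [← List.toFinset_card_of_nodup hnodup]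
    congr 1
    ext j
    rw [List.mem_toFinset, hmem]
  set e : Fin J.card → ℕ := fun p => idx.get (p.cast hcard.symm) with he
  have heJ : ∀ p, e p ∈ J := fun p => (hmem _).1 (List.get_mem _ _)
  have hinj : Function.Injective e := by
    intro p q hpq
    have := hnodup.injective_get hpq
    exact Fin.cast_injective _ this
  set W : Matrix (Fin n) (Fin J.card) (ZMod 2) := fun i p => col (e p + 1) i with hW
  have hval : ∀ z : Fin J.card → ZMod 2, ∃ y : ℕ → ZMod 2, (∀ p, y (e p) = z p) ∧
      (∀ j, j ∉ J → y j = 0) ∧ ∀ i : Fin n, ev (rows.getD i []) y = (W *ᵥ z) i + col 0 i := by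
    intro z
    refine ⟨fun j => ∑ p, if e p = j then z p else 0, fun p => ?_, fun j hj => ?_, fun i => ?_⟩
    · dsimp only
      rw [Finset.sum_eq_single p]
      · simp
      · intro q _ hq
        exact if_neg fun h => hq (hinj h)
      · simp
    · exact Finset.sum_eq_zero fun p _ => if_neg fun hp : e p = j => hj (hp ▸ heJ p)
    · rw [ev_eq_of_length (h.good.row i i.isLt)]
      refine congrArg (· + _) ?_
      simp only [Finset.mul_sum]
      rw [Finset.sum_comm]
      refine Finset.sum_congr rfl fun p _ => ?_
      have hep : e p ∈ Finset.range d := h.subset (heJ p)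
      rw [Finset.sum_eq_single (e p)]
      · rw [if_pos rfl]
      · intro j _ hj
        rw [if_neg (Ne.symm hj), mul_zero]
      · exact fun hn => absurd hep hn
  refine ⟨W, col 0, ?_, ?_, ?_⟩
  · rw [hout]
    show Data.cons (encList ((idx.map fun j => List.ofFn (col (j + 1))).map enc))
      (enc (List.ofFn (col 0))) = _
    rw [enc_ofFn, List.map_map]
    refine congrArg (fun l => Data.cons (encList l) _) ?_
    refine List.ext_getElem (by simpa using hcard) fun p hp _ => ?_
    rw [List.getElem_map, List.getElem_ofFn]
    exact enc_ofFn _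
  · have hker : Function.Injective W.mulVecLin := by
      rw [injective_iff_map_eq_zero]
      intro z hz
      obtain ⟨y, hy1, hy2, hy3⟩ := hval z
      obtain ⟨y', hy1', hy2', hy3'⟩ := hval 0
      have h0 : y' = 0 := by
        funext j
        by_cases hj : j ∈ J
        · obtain ⟨p, hp⟩ := List.mem_iff_get.1 ((hmem j).2 hj)
          have := hy1' (p.cast hcard)
          simp only [he, Fin.cast_cast, Fin.cast_eq_self, hp] at this
          exact this
        · exact hy2' j hj
      have : y = 0 := h.inj y hy2 fun i hi => by
        have h1 := hy3 ⟨i, hi⟩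
        have h2 := hy3' ⟨i, hi⟩
        rw [Matrix.mulVec_zero, h0] at h2
        have h3 : W *ᵥ z = 0 := hz
        rw [h3] at h1
        exact bit_add_eq_zero.2 (h1.trans h2.symm)
      funext p
      rw [← hy1 p, this]
      rfl
    show Module.finrank (ZMod 2) (LinearMap.range W.mulVecLin) = _
    rw [LinearMap.finrank_range_of_inj hker, Module.finrank_fin_fun]
  · rintro x ⟨z, rfl⟩
    obtain ⟨y, -, -, hy⟩ := hval z
    exact ⟨y, fun i => (hy i).symm⟩

/-! ### The size of the input -/

theorem sz_encWire {n k s : ℕ} (u : Wire n k) (h : n + k ≤ s) : sz (encWire u) ≤ 2 * s + 5 := by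
  rcases u with i | j
  · show (encNat 0).size + (encNat i).size + 1 ≤ _
    have h1 : (encNat i).size = 2 * i + 1 := sz_nat i
    have h2 : (encNat 0).size = 1 := rfl
    have := i.isLt
    omega
  · show (encNat 1).size + (encNat j).size + 1 ≤ _
    have h1 : (encNat j).size = 2 * j + 1 := sz_nat j
    have h2 : (encNat 1).size = 3 := rfl
    have := j.isLt
    omega

theorem sz_gate {n k s : ℕ} (G : Gate n k) (h : n + k ≤ s) : sz G.toData ≤ 7 * (2 * s + 6) + 1 := by
  have hb : ∀ b, sz (encBit b) ≤ 2 * s + 5 := fun b => (sz_bit b).trans (by omega)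
  have hn : ∀ k, k ≤ 2 → sz (encNat k) ≤ 2 * s + 5 := fun k hk => by
    have : sz (encNat k) = 2 * k + 1 := sz_nat k
    omega
  have h1 : ∀ x ∈ G.toData, sz x ≤ 2 * s + 5 := by
    intro x hx
    cases G with
    | const b =>
      simp only [Gate.toData, List.mem_cons, List.not_mem_nil, or_false] at hx
      rcases hx with rfl | rfl
      · exact hn 0 (by omega)
      · exact hb _
    | unary f u =>
      simp only [Gate.toData, List.mem_cons, List.not_mem_nil, or_false] at hx
      rcases hx with rfl | rfl | rfl | rfl
      · exact hn 1 (by omega)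
      · exact hb _
      · exact hb _
      · exact sz_encWire u h
    | binary f u v =>
      simp only [Gate.toData, List.mem_cons, List.not_mem_nil, or_false] at hx
      rcases hx with rfl | rfl | rfl | rfl | rfl | rfl | rfl
      · exact hn 2 (by omega)
      · exact hb _
      · exact hb _
      · exact hb _
      · exact hb _
      · exact sz_encWire u h
      · exact sz_encWire v h
  refine (sz_le_of_forall h1).trans (Nat.add_le_add_right (Nat.mul_le_mul_right _ ?_) 1)
  cases G <;> simp [Gate.toData]

/-- A gate has linear size because its wire indices are unary, and m ≤ n keeps the matrix quadratic.
-/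
theorem sz_toInput {n m : ℕ} (C : Circuit n) (A : Matrix (Fin n) (Fin m) (ZMod 2))
    (a : Fin n → ZMod 2) (hm : m ≤ n) :
    sz (toInput C A a) ≤ 100 * (n + C.numGates + 1) ^ 2 := by
  set s := n + C.numGates with hs
  have h1 : sz (encWire C.output) ≤ 2 * s + 5 := sz_encWire _ le_rfl
  have h2 : sz (List.ofFn fun k => (C.gate k).toData) ≤ s * (7 * (2 * s + 6) + 2) + 1 := by
    refine (sz_le_of_forall (B := 7 * (2 * s + 6) + 1) fun x hx => ?_).trans
      (Nat.add_le_add_right (Nat.mul_le_mul_right _ ?_) 1)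
    · obtain ⟨k, rfl⟩ := List.mem_ofFn.1 hx
      exact sz_gate _ (by have := k.isLt; omega)
    · rw [List.length_ofFn]
      omega
  have h3 : sz (List.ofFn fun j => List.ofFn fun i => A i j) ≤ s * (4 * s + 2) + 1 := by
    refine (sz_le_of_forall (B := 4 * s + 1) fun x hx => ?_).trans
      (Nat.add_le_add_right (Nat.mul_le_mul_right _ ?_) 1)
    · obtain ⟨k, rfl⟩ := List.mem_ofFn.1 hx
      refine (sz_vec _).trans ?_
      rw [List.length_ofFn]
      omega
    · rw [List.length_ofFn]
      omega
  have h4 : sz (List.ofFn a) ≤ 4 * s + 1 := by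
    refine (sz_vec _).trans ?_
    rw [List.length_ofFn]
    omega
  have h5 : sz (toInput C A a) = sz (encWire C.output) +
      sz (List.ofFn fun k => (C.gate k).toData) + 1 +
      (sz (List.ofFn fun j => List.ofFn fun i => A i j) + sz (List.ofFn a) + 1) + 1 := rfl
  rw [h5]
  nlinarith

end GateElim

/-! ### Assembling the theorem. -/

namespace GateElim
open Enc (enc)

theorem algorithm_spec {n d' d : ℕ} (A : Matrix (Fin n) (Fin d') (ZMod 2)) (a : Fin n → ZMod 2)
    (C : Circuit n) (hA : A.rank = d') (hn : 0 < n) (hμ : C.mu < 4 * (d' - d)) :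
    ∃ (δ : ℕ) (W : Matrix (Fin n) (Fin δ) (ZMod 2)) (w : Fin n → ZMod 2),
      enc (algorithm (toInput C A a)) = encAffine W w ∧ W.rank = δ ∧ d ≤ δ ∧
      affineSet W w ⊆ affineSet A a ∧ ∃ b : ZMod 2, ∀ x ∈ affineSet W w, C.eval x = b := by
  have hc := C.goodNet hn d'
  have h₀ := subSpace_inputRows C A a hA
  have hle : numClasses n (C.net d') (inputRows (toInput C A a)) ≤ C.mu :=
    C.ncard_classes_le (hc.isRun h₀.good) (C.length_net d')
  have hlen : (List.ofFn a :: List.ofFn fun j => List.ofFn fun i => A i j).length = d' + 1 := by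
    simp
  obtain ⟨J, hJ, hδ, hconst⟩ := solve_spec hc
    (List.ofFn a :: List.ofFn fun j => List.ofFn fun i => A i j) (δ := d) h₀
    -- The translation vector and the columns allow d' + 1 rounds, enough because μ(C) < 4(d' - d).
    (.inr (by rw [Finset.card_range, hlen]; omega))
  obtain ⟨W, w, henc, hrank, hmem⟩ := exists_output hJ
  refine ⟨J.card, W, w, ?_, hrank, hδ, fun x hx => ?_, ?_⟩
  · rw [← henc]
    refine congrArg enc ?_
    have hz : (0 :: (toInput C A a).2.1.map fun _ => (0 : ZMod 2)) = List.replicate (d' + 1) 0 := by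
      rw [List.replicate_succ]
      refine congrArg (List.cons 0) ?_
      show (List.ofFn fun j => List.ofFn fun i => A i j).map _ = _
      rw [List.map_ofFn]
      exact List.ofFn_const d' (0 : ZMod 2)
    unfold algorithm
    rw [inputNet_toInput, hz]
    rfl
  · obtain ⟨y, hy⟩ := hmem x hx
    obtain ⟨y₀, hy₀⟩ := hJ.le y
    refine ⟨fun j => y₀ j, funext fun i => ?_⟩
    rw [hy i, hy₀ i i.isLt, ev_inputRows]
  · obtain ⟨b, hb⟩ := C.exists_eval_eq hn hJ.good hconst
    refine ⟨b, fun x hx => ?_⟩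
    obtain ⟨y, hy⟩ := hmem x hx
    exact hb x y hy

end GateElim

theorem mainTheorem3 :
    ∃ (P : GateElim.Program) (p : Polynomial ℕ),
      ∀ (n d' d : ℕ) (A : Matrix (Fin n) (Fin d') (ZMod 2)) (a : Fin n → ZMod 2)
        (C : GateElim.Circuit n),
        A.rank = d' → d < d' → C.mu < 4 * (d' - d) →
        ∃ (δ : ℕ) (W : Matrix (Fin n) (Fin δ) (ZMod 2)) (w : Fin n → ZMod 2) (t : ℕ),
          P.Runs (GateElim.encInput C A a) (GateElim.encAffine W w) t ∧
          t ≤ p.eval (n + C.numGates) ∧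
          W.rank = δ ∧ d ≤ δ ∧
          GateElim.affineSet W w ⊆ GateElim.affineSet A a ∧
          ∃ b : ZMod 2, ∀ x ∈ GateElim.affineSet W w, C.eval x = b := by
  obtain ⟨P, p, hP⟩ := GateElim.Poly.exists_program GateElim.Poly.algorithm
  refine ⟨P, p.comp (Polynomial.C 100 * (Polynomial.X + 1) ^ 2), ?_⟩
  intro n d' d A a C hA hd hμ
  -- Full column rank gives d' ≤ n. Thus the input size is polynomial in n and the number of gates,
  -- and d < d' forces n > 0.
  have hm : d' ≤ n := hA ▸ (A.rank_le_card_height.trans_eq (Fintype.card_fin n))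
  obtain ⟨δ, W, w, henc, hrank, hδ, hsub, hconst⟩ :=
    GateElim.algorithm_spec A a C hA (by omega) hμ
  obtain ⟨t, hrun, ht⟩ := hP (GateElim.toInput C A a)
  rw [GateElim.enc_toInput, henc] at hrun
  refine ⟨δ, W, w, t, hrun, ht.trans ?_, hrank, hδ, hsub, hconst⟩
  rw [Polynomial.eval_comp]
  refine GateElim.eval_mono p ?_
  simpa using GateElim.sz_toInput C A a hm
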